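/- A *surface-knot* is a smoothly embedded closed connected oriented surface in $\mathbb{R}^4=\mathbb{R}^3\times\mathbb{R}$. A *diagram* of it is its image under a generic projection to $\mathbb{R}^3$ (locally an embedded sheet, a transverse double point, a transverse triple point or a Whitney umbrella, whose singular point is called a *branch point*), together with the information which of the points with the same projection is higher. Two diagrams are *equivalent* if they are related by ambient isotopies of $\mathbb{R}^3$ and a finite sequence of the seven Roseman moves D1, D2, T1, T2, B1, B2, BT and their inverses: a paraboloid (D1) or a saddle (D2) passes through a sheet, a sheet passes through a double curve at a tangency (T1) or through a triple point (T2), a double arc bounded by two branch points is created (B1), two double arcs ending in branch points are joined at these ends (B2), a branch point passes through a sheet (BT). A diagram is *regular* if it has no branch points, and two diagrams are *regular-equivalent* if they are related by ambient isotopies of $\mathbb{R}^3$ and a finite sequence of the branch-free moves D1, D2, T1, T2 and their inverses. A *rack* is a set $R$ with an operation $*$ such that every map $a\mapsto a*b$ is bijective and $(a*b)*c=(a*c)*(b*c)$; it is a *quandle* if $a*a=a$ for all $a$, and *connected* if the maps $a\mapsto a*b$ and their inverses act transitively on $R$. A *coloring* of a diagram $D$ by $R$ assigns an element of $R$ to each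 sheet of $D$ (each component of the surface cut along the lower points of the double curves) so that $c(x_k)=c(x_i)*c(x_j)$ along each double point curve, where $x_j$ is the over-sheet and its normal direction points from the under-sheet $x_i$ to the under-sheet $x_k$. Let $\mathrm{Col}_R(D)$ be the set of these colorings. **Corollary 6.2.** There exist two regular surface-knot diagrams which are equivalent but not regular-equivalent. More precisely, there are regular diagrams $D_1$ and $D_2$ of trivial $T^2$-knots (each knot bounds a smoothly embedded solid torus in $\mathbb{R}^4$) which are equivalent but not regular-equivalent, and such that for every finite connected rack $R$ that is not a quandle, $|\mathrm{Col}_R(D_1)|=|R|$ and $\mathrm{Col}_R(D_2)=\emptyset$. -/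

import Mathlib

open scoped Manifold ContDiff Topology Quandles

noncomputable section

/-- The plane, which is also the model space of all surfaces. -/
abbrev R2 : Type := EuclideanSpace ℝ (Fin 2)

/-- The 3-space into which surface-knots are projected. -/
abbrev R3 : Type := EuclideanSpace ℝ (Fin 3)

/-- The 4-space `ℝ⁴ = ℝ³ × ℝ`; the last factor is the height, which the projection drops. -/
abbrev R4 : Type := R3 × ℝ

/-! ## Closed connected oriented surfaces -/

/-- `S` is a closed connected smooth surface, oriented by its atlas: all transition maps between
charts of the atlas have positive Jacobian determinant. As the tangent space at `x` is written in
the chart `chartAt R2 x` of the atlas, the standard basis of `R2` is a positive basis of it. -/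
class ClosedOrientedSurface (S : Type) [TopologicalSpace S] [ChartedSpace R2 S] : Prop where
  t2 : T2Space S
  compact : CompactSpace S
  connected : ConnectedSpace S
  smooth : IsManifold (𝓡 2) ∞ S
  oriented : ∀ e ∈ atlas R2 S, ∀ e' ∈ atlas R2 S, ∀ u ∈ (e.symm.trans e').source,
    0 < (fderiv ℝ (e.symm.trans e' : R2 → R2) u).det

/-! ## Local coordinates -/

/-- `φ` is a diffeomorphism from `ℝ³` onto an open subset of `ℝ³`
(a coordinate system on an open ball of `ℝ³`). -/
def IsSpaceChart (φ : R3 → R3) : Prop :=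
  ContDiff ℝ ∞ φ ∧ Function.Injective φ ∧ ∀ p, Function.Bijective (fderiv ℝ φ p)

section Surface

variable {S : Type} [TopologicalSpace S] [ChartedSpace R2 S]

/-- `ψ` is a diffeomorphism from the disjoint union of `n` planes onto an open subset of `S`
(coordinate systems on `n` disjoint open discs of `S`). -/
def IsDiscChart {n : ℕ} (ψ : Fin n → R2 → S) : Prop :=
  (∀ i, ContMDiff (𝓡 2) (𝓡 2) ∞ (ψ i)) ∧
  (∀ i j u v, ψ i u = ψ j v → i = j ∧ u = v) ∧
  ∀ i u, Function.Bijective (mfderiv (𝓡 2) (𝓡 2) (ψ i) u)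

/-- In the coordinates `φ` and `ψ`, the part of the map `f` lying over the open set `range φ` is
the system of sheets `m`. -/
def MatchesOver {n : ℕ} (f : S → R3) (φ : R3 → R3) (ψ : Fin n → R2 → S)
    (m : Fin n → R2 → R3) : Prop :=
  (∀ i u, f (ψ i u) = φ (m i u)) ∧ ∀ x, f x ∈ Set.range φ ↔ ∃ i u, ψ i u = x

/-- The differential of `f : S → ℝ³` at `x`. -/
def diffAt (f : S → R3) (x : S) : R2 →L[ℝ] R3 := mfderiv (𝓡 2) 𝓘(ℝ, R3) f x

/-- The standard Whitney umbrella `(x, y) ↦ (x, y², xy)`. -/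
def whitneyUmbrella (u : R2) : R3 := !₂[u 0, u 1 ^ 2, u 0 * u 1]

/-- `f` is a Whitney umbrella (cross-cap) with branch point at `x`. -/
def IsWhitneyUmbrellaAt (f : S → R3) (x : S) : Prop :=
  ∃ (φ : R3 → R3) (ψ : Fin 1 → R2 → S), IsSpaceChart φ ∧ IsDiscChart ψ ∧ ψ 0 0 = x ∧
    MatchesOver f φ ψ (fun _ => whitneyUmbrella)

/-- `f : S → ℝ³` is generic: where it is not immersive it is a Whitney umbrella, and over every
point of `ℝ³` above which it is immersive, there are finitely many sheets and they are in general
position (the intersection of the tangent planes of the `k` sheets has codimension `k`). Hence its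
image consists of regular points, transverse double points, transverse triple points and
branch points. -/
def IsGeneric (f : S → R3) : Prop :=
  (∀ x, ¬ Function.Injective (diffAt f x) → IsWhitneyUmbrellaAt f x) ∧
  ∀ p : R3, (∀ x, f x = p → Function.Injective (diffAt f x)) →
    (f ⁻¹' {p}).Finite ∧
    Module.finrank ℝ (⨅ x ∈ f ⁻¹' {p}, LinearMap.range (diffAt f x : R2 →ₗ[ℝ] R3) :
      Submodule ℝ R3) + (f ⁻¹' {p}).ncard = 3

end Surface

/-! ## Surface-knot diagrams -/

/-- A surface-knot diagram: a smooth embedding of `S` in `ℝ⁴` (an injective immersion of a compact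
surface) whose projection to `ℝ³` is generic. Of the heights only the order of the points with the
same projection matters for the diagram; the relations below between diagrams see nothing else. -/
structure SurfaceKnotDiagram (S : Type) [TopologicalSpace S] [ChartedSpace R2 S] where
  knot : S → R4
  smooth : ContMDiff (𝓡 2) 𝓘(ℝ, R4) ∞ knot
  injective : Function.Injective knot
  immersive : ∀ x, Function.Injective (mfderiv (𝓡 2) 𝓘(ℝ, R4) knot x)
  generic : IsGeneric (fun x => (knot x).1)

/-! ## The local pictures of the seven Roseman moves -/

/-- `1/8` times a smooth bump function of the squared radius: it equals `1/8` for
`u₀² + u₁² ≤ 1`, vanishes for `u₀² + u₁² ≥ 2`, and is decreasing in the radius in between. -/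
def bump (u : R2) : ℝ := Real.smoothTransition (2 - (u 0 ^ 2 + u 1 ^ 2)) / 8

/-- The graph of `g` over the plane. -/
def graphSheet (g : R2 → ℝ) (u : R2) : R3 := !₂[u 0, u 1, g u]

/-- The sheet `(x, y) ↦ (x, y², y (y² + q(x, y)))`. -/
def kinkSheet (q : R2 → ℝ) (u : R2) : R3 := !₂[u 0, u 1 ^ 2, u 1 * (u 1 ^ 2 + q u)]

/-- A one-parameter family of `n` sheets in `ℝ³`. A move replaces the picture at parameter `1` by
the picture at parameter `-1`, or the other way round; the two differ only in a bounded region. -/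
structure LocalPicture where
  n : ℕ
  sheet : ℝ → Fin n → R2 → R3

/-- A paraboloid passes through a plane: a closed double curve appears or disappears. -/
def moveD1 : LocalPicture where
  n := 2
  sheet t := ![graphSheet (fun _ => 0), graphSheet (fun u => u 0 ^ 2 + u 1 ^ 2 + t * bump u)]

/-- A saddle passes through a plane: surgery on double curves. -/
def moveD2 : LocalPicture where
  n := 2
  sheet t := ![graphSheet (fun _ => 0), graphSheet (fun u => u 0 ^ 2 - u 1 ^ 2 + t * bump u)]

/-- A sheet touching a double curve passes through it: a pair of triple points appears or
disappears. -/
def moveT1 : LocalPicture where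
  n := 3
  sheet t := ![graphSheet (fun u => u 1), graphSheet (fun u => - u 1),
    graphSheet (fun u => u 0 ^ 2 + t * bump u)]

/-- A sheet passes through a triple point: the tetrahedron is inverted. -/
def moveT2 : LocalPicture where
  n := 4
  sheet t := ![graphSheet (fun u => u 0), graphSheet (fun u => u 1),
    graphSheet (fun u => - u 0 - u 1), graphSheet (fun u => t * bump u)]

/-- A double arc whose two ends are branch points appears or disappears. -/
def moveB1 : LocalPicture where
  n := 1
  sheet t := ![kinkSheet (fun u => u 0 ^ 2 + t * bump u)]

/-- Two double arcs ending in branch points are joined at these ends, or a double arc is cut. -/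
def moveB2 : LocalPicture where
  n := 1
  sheet t := ![kinkSheet (fun u => - u 0 ^ 2 + t * bump u)]

/-- A branch point passes through a sheet: a triple point appears or disappears. -/
def moveBT : LocalPicture where
  n := 2
  sheet t := ![whitneyUmbrella, fun u => !₂[u 0 + t * bump u, u 0, u 1]]

/-- The branch-free Roseman moves. -/
def branchFreeMoves : Set LocalPicture := {moveD1, moveD2, moveT1, moveT2}

/-- All seven Roseman moves. -/
def rosemanMoves : Set LocalPicture := branchFreeMoves ∪ {moveB1, moveB2, moveBT}

/-- Whether the point `u` of sheet `i` is lower than the point `v` of sheet `j` in a local picture.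
Distinct sheets are ordered by `σ`. Only the sheets with cross-caps have double points of their
own; there the two points differ in the sign of the second coordinate, and `ε = ±1` says on which
side the sheet is lower. -/
def LocalUnder {n : ℕ} (σ : Equiv.Perm (Fin n)) (ε : ℝ) (i : Fin n) (u : R2)
    (j : Fin n) (v : R2) : Prop :=
  σ i < σ j ∨ (i = j ∧ ε * u 1 < ε * v 1)

/-- An ambient isotopy of `ℝ³`, with time in `[0, 1]`. -/
def IsAmbientIsotopy (Φ : ℝ → R3 → R3) : Prop :=
  ContDiff ℝ ∞ (fun p : ℝ × R3 => Φ p.1 p.2) ∧ (∀ p, Φ 0 p = p) ∧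
  ∀ t ∈ Set.Icc (0 : ℝ) 1, ∃ e : Diffeomorph 𝓘(ℝ, R3) 𝓘(ℝ, R3) R3 R3 ∞, ∀ p, Φ t p = e p

/-- The determinant of three vectors of `ℝ³`. -/
def det3 (a b c : R3) : ℝ := Matrix.det !![a 0, a 1, a 2; b 0, b 1, b 2; c 0, c 1, c 2]

namespace SurfaceKnotDiagram

variable {S : Type} [TopologicalSpace S] [ChartedSpace R2 S]

/-- The projection of the surface-knot to `ℝ³`. -/
def proj (D : SurfaceKnotDiagram S) (x : S) : R3 := (D.knot x).1

/-- The fourth coordinate. -/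
def height (D : SurfaceKnotDiagram S) (x : S) : ℝ := (D.knot x).2

/-- `x` lies under `y`: they have the same projection and `y` is higher. -/
def Under (D : SurfaceKnotDiagram S) (x y : S) : Prop :=
  D.proj x = D.proj y ∧ D.height x < D.height y

/-- `x` is a branch point: the projection is not immersive at `x`. -/
def IsBranchPoint (D : SurfaceKnotDiagram S) (x : S) : Prop :=
  ¬ Function.Injective (diffAt D.proj x)

/-- A regular diagram is one without branch points. -/
def IsRegular (D : SurfaceKnotDiagram S) : Prop := ∀ x, ¬ D.IsBranchPoint x

/-! ### Equivalence and regular-equivalence -/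

/-- `D` and `D'` are the same diagram up to an orientation preserving reparametrization of the
surface. -/
def Reparametrized (D D' : SurfaceKnotDiagram S) : Prop :=
  ∃ g : Diffeomorph (𝓡 2) (𝓡 2) S S ∞,
    (∀ x, 0 < ContinuousLinearMap.det (mfderiv (𝓡 2) (𝓡 2) g x : R2 →L[ℝ] R2)) ∧
    (∀ x, D'.proj x = D.proj (g x)) ∧ ∀ x y, D'.Under x y ↔ D.Under (g x) (g y)

/-- `D'` is the image of `D` under an ambient isotopy of `ℝ³`. -/
def Isotopic (D D' : SurfaceKnotDiagram S) : Prop :=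
  ∃ Φ : ℝ → R3 → R3, IsAmbientIsotopy Φ ∧
    (∀ x, D'.proj x = Φ 1 (D.proj x)) ∧ ∀ x y, D'.Under x y ↔ D.Under x y

/-- In the coordinates `φ` and `ψ`, the diagram `D` over the open set `range φ` is the picture `m`,
with height information given by `σ` and `ε`. -/
def LooksLike (D : SurfaceKnotDiagram S) {n : ℕ} (φ : R3 → R3) (ψ : Fin n → R2 → S)
    (m : Fin n → R2 → R3) (σ : Equiv.Perm (Fin n)) (ε : ℝ) : Prop :=
  MatchesOver D.proj φ ψ m ∧
  ∀ i u j v, m i u = m j v →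
    (D.Under (ψ i u) (ψ j v) ↔ LocalUnder σ ε i u j v)

/-- `D'` is obtained from `D` by replacing the picture `P` at parameter `1`, inside an open ball
of `ℝ³`, by the picture at parameter `-1`, with the same height information. -/
def Moved (P : LocalPicture) (D D' : SurfaceKnotDiagram S) : Prop :=
  ∃ (φ : R3 → R3) (ψ : Fin P.n → R2 → S) (σ : Equiv.Perm (Fin P.n)) (ε : ℝ),
    IsSpaceChart φ ∧ IsDiscChart ψ ∧ (ε = 1 ∨ ε = -1) ∧
    D.LooksLike φ ψ (P.sheet 1) σ ε ∧ D'.LooksLike φ ψ (P.sheet (-1)) σ ε ∧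
    (∀ x, D.proj x ∉ Set.range φ → D'.proj x = D.proj x) ∧
    ∀ x y, D.proj x ∉ Set.range φ → D.proj y ∉ Set.range φ → (D'.Under x y ↔ D.Under x y)

/-- One elementary step between diagrams, with moves from `moves`. -/
def Step (moves : Set LocalPicture) (D D' : SurfaceKnotDiagram S) : Prop :=
  Reparametrized D D' ∨ Isotopic D D' ∨ ∃ P ∈ moves, Moved P D D'

/-- Two diagrams are equivalent if they are related by a finite sequence of Roseman moves and
their inverses (and ambient isotopies of `ℝ³`). -/
def Equivalent (D D' : SurfaceKnotDiagram S) : Prop :=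
  Relation.EqvGen (Step rosemanMoves) D D'

/-- Two diagrams are regular-equivalent if they are related by a finite sequence of branch-free
Roseman moves and their inverses (and ambient isotopies of `ℝ³`). -/
def RegularEquivalent (D D' : SurfaceKnotDiagram S) : Prop :=
  Relation.EqvGen (Step branchFreeMoves) D D'

/-! ### Trivial torus knots -/

/-- The surface-knot bounds a smoothly embedded solid torus `(ℝ/ℤ) × (closed unit disc)`
in `ℝ⁴`. -/
def BoundsSolidTorus (D : SurfaceKnotDiagram S) : Prop :=
  ∃ G : ℝ × ℂ → R4, ContDiff ℝ ∞ G ∧ (∀ t w, G (t + 1, w) = G (t, w)) ∧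
    (∀ p, ‖p.2‖ ≤ 1 → Function.Injective (fderiv ℝ G p)) ∧
    (∀ p q, ‖p.2‖ ≤ 1 → ‖q.2‖ ≤ 1 → G p = G q → p.2 = q.2 ∧ ∃ k : ℤ, p.1 - q.1 = k) ∧
    Set.range D.knot = G '' {p | ‖p.2‖ = 1}

/-! ### Rack colorings -/

/-- The closure of the set of the lower points of the double points. -/
def lowerSet (D : SurfaceKnotDiagram S) : Set S := closure {x | ∃ y, D.Under x y}

/-- The sheets of a diagram: the components of the surface cut along the lower points. -/
def Sheets (D : SurfaceKnotDiagram S) : Type := ConnectedComponents ↥(D.lowerSetᶜ)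

/-- The point `x` lies on the sheet `s`. -/
def OnSheet (D : SurfaceKnotDiagram S) (x : S) (s : D.Sheets) : Prop :=
  ∃ hx : x ∈ D.lowerSetᶜ, ConnectedComponents.mk (⟨x, hx⟩ : ↥(D.lowerSetᶜ)) = s

/-- `sᵢ` and `sₖ` are under-sheets and `sⱼ` is the over-sheet at some double point of `D`, and the
normal direction of `sⱼ` points from `sᵢ` to `sₖ`. The double point has lower preimage `x` and
upper preimage `y`, and a curve `γ` on the surface passes through `x` from `sᵢ` to `sₖ`, crossing
the over-sheet in the normal direction, that is, in a direction `v` such that `(v₁, v₂, v)` is a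
positive frame of `ℝ³` when `(v₁, v₂)` is a positive frame of the over-sheet at `y`. -/
def MeetAt (D : SurfaceKnotDiagram S) (si sj sk : D.Sheets) : Prop :=
  ∃ (x y : S) (γ : ℝ → S), D.Under x y ∧ (∀ z, D.proj z = D.proj x → z = x ∨ z = y) ∧
    D.OnSheet y sj ∧ ContMDiff 𝓘(ℝ, ℝ) (𝓡 2) ∞ γ ∧ γ 0 = x ∧
    0 < det3 (diffAt D.proj y (EuclideanSpace.single 0 1))
      (diffAt D.proj y (EuclideanSpace.single 1 1)) (deriv (fun t => D.proj (γ t)) 0) ∧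
    ∀ᶠ t in 𝓝[>] (0 : ℝ), D.OnSheet (γ (-t)) si ∧ D.OnSheet (γ t) sk

/-- The set of rack colorings of `D` by `R`. The operation written `a * b` for racks acting from
the right is `b ◃ a` here. -/
def Colorings (D : SurfaceKnotDiagram S) (R : Type) [Rack R] : Type :=
  {c : D.Sheets → R // ∀ si sj sk, D.MeetAt si sj sk → c sk = c sj ◃ c si}

end SurfaceKnotDiagram

/-- A rack is connected if the translations by its elements (and their inverses) act
transitively. -/
def IsConnectedRack (R : Type) [Rack R] : Prop :=
  ∀ a b : R, Relation.EqvGen (fun a b => ∃ c : R, b = c ◃ a) a b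

/-- A rack is a quandle if all its elements are idempotent. -/
def IsQuandleRack (R : Type) [Rack R] : Prop := ∀ a : R, a ◃ a = a

end

/-! All diagrams come from one family of tori. The torus with angles (θ, φ) is mapped to 4-space by
(e^X cos θ, e^X sin θ, sin φ · H, sin φ), where X = 1 - cos φ and H is a function on the plane. This
is a standard torus sheared in the third direction; letting the meridian circle fill its disc in the
same formula gives a solid torus (`ringDiagram_boundsSolidTorus`). The first two coordinates fold
the torus two-to-one onto the annulus 0 ≤ X ≤ 2, and the two points over p have third coordinates ±
sin φ · H(p). So they meet in 3-space exactly where H(p) = 0: the zeros of H inside the annulus give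
the double curves, and zeros on the boundary circles give branch points.

Equivalence. The function `middleHeight`, X - cos θ / 2, vanishes on an arc with both ends on the
inner circle. Raising it in a patch makes it positive (`emptyHeight`: no double points). Lowering it
in a patch around θ = π joins the two ends of the arc, giving a closed curve that runs once around
the annulus (`loopHeight`). Neither of the two new functions has zeros on the boundary circles, so
both diagrams are regular. The passages are a B1 move and a B2 move (`moved_empty_middle`,
`moved_middle_loop`); the work is to find coordinates in which the heights become, up to a positive
factor, the prescribed local models.

Inequivalence. A checkerboard coloring gives signs to the points of the surface that are not lower
points, so that the sign changes whenever the surface passes under another sheet. Every branch-free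
move replaces graphs by graphs that differ in a bounded region. Over a disc, the coloring of a graph
is, up to a constant, the product of the signs telling above which higher graphs it lies; the same
formula for the new graphs extends the coloring from outside. Hence the existence of such a coloring
is invariant (`RegularEquivalent.hasCheckerboard_iff`). It holds trivially without double points. It
fails for `loopDiagram`: the lower curve does not separate the torus
(`isPreconnected_compl_lowerSet`), so the coloring would be constant, but it must change at a
crossing.

Rack colorings. Both diagrams have a single sheet. Without double points there is no condition. In
`loopDiagram` the sheet passes under itself, so its color is idempotent; translations preserve
idempotence, so a connected rack with an idempotent element is a quandle. -/

noncomputable section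

/-! ## The torus as a smooth oriented surface -/

/-- The universal covering of the torus. -/
def torusCover (u : R2) : Circle × Circle := (Circle.exp (u 0), Circle.exp (u 1))

/-- The plane as a product of two lines. -/
def planeHomeomorph : R2 ≃ₜ ℝ × ℝ :=
  (EuclideanSpace.equiv (Fin 2) ℝ).toHomeomorph.trans (Homeomorph.piFinTwo fun _ => ℝ)

theorem isLocalHomeomorph_torusCover : IsLocalHomeomorph torusCover := by
  have h : IsLocalHomeomorph (Prod.map Circle.exp Circle.exp : ℝ × ℝ → Circle × Circle) := by
    intro x
    obtain ⟨e, he, hee⟩ := isLocalHomeomorph_circleExp x.1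
    obtain ⟨e', he', hee'⟩ := isLocalHomeomorph_circleExp x.2
    refine ⟨e.prod e', ⟨he, he'⟩, ?_⟩
    simp only [Prod.map_def, hee, OpenPartialHomeomorph.prod_apply]
    exact hee ▸ hee' ▸ rfl
  exact h.comp planeHomeomorph.isLocalHomeomorph

theorem surjective_torusCover : Function.Surjective torusCover := by
  rintro ⟨z, w⟩
  refine ⟨!₂[Complex.arg z, Complex.arg w], ?_⟩
  simp [torusCover, Circle.exp_arg]

theorem torusCover_eq_iff {u v : R2} : torusCover u = torusCover v ↔
    (∃ m : ℤ, u 0 = v 0 + m * (2 * Real.pi)) ∧ ∃ n : ℤ, u 1 = v 1 + n * (2 * Real.pi) := by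
  simp [torusCover, Circle.exp_eq_exp]

theorem torusCover_add {u v : R2} (h : torusCover u = torusCover v) (w : R2) :
    torusCover (w + (u - v)) = torusCover w := by
  obtain ⟨⟨m, hm⟩, n, hn⟩ := torusCover_eq_iff.1 h
  exact torusCover_eq_iff.2 ⟨⟨m, by simp [hm]⟩, n, by simp [hn]⟩

/-- A continuous map that preserves the points of the torus is locally a translation. -/
theorem eventuallyEq_translation {g : R2 → R2} {u : R2} (hg : ContinuousAt g u)
    (h : ∀ᶠ v in 𝓝 u, torusCover (g v) = torusCover v) : g =ᶠ[𝓝 u] fun v => v + (g u - u) := by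
  obtain ⟨e, he, hee⟩ := isLocalHomeomorph_torusCover (g u)
  have h1 : ∀ᶠ v in 𝓝 u, g v ∈ e.source := hg (e.open_source.mem_nhds he)
  have h2 : ∀ᶠ v in 𝓝 u, v + (g u - u) ∈ e.source := by
    have : ContinuousAt (fun v => v + (g u - u)) u := by fun_prop
    exact this (e.open_source.mem_nhds (by simpa using he))
  filter_upwards [h, h1, h2] with v hv hv1 hv2
  apply e.injOn hv1 hv2
  rw [← hee, hv, torusCover_add h.self_of_nhds]

/-- The atlas consists of the local inverses of the universal covering. Transitions are then locally
translations by periods, so smoothness and positivity of the Jacobian are immediate. -/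
instance torusChartedSpace : ChartedSpace R2 (Circle × Circle) where
  atlas := {e | ⇑e.symm = torusCover}
  chartAt q := isLocalHomeomorph_torusCover.localInverseAt (surjective_torusCover q).choose
  mem_chart_source q := by
    have := (isLocalHomeomorph_torusCover.apply_self_mem_localInverseAt_source
      (x := (surjective_torusCover q).choose))
    rwa [(surjective_torusCover q).choose_spec] at this
  chart_mem_atlas q := by simp

theorem mem_torus_atlas {e : OpenPartialHomeomorph (Circle × Circle) R2} :
    e ∈ atlas R2 (Circle × Circle) ↔ ⇑e.symm = torusCover := Iff.rfl

theorem torus_transition {e e' : OpenPartialHomeomorph (Circle × Circle) R2}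
    (he : e ∈ atlas R2 (Circle × Circle)) (he' : e' ∈ atlas R2 (Circle × Circle)) {u : R2}
    (hu : u ∈ (e.symm.trans e').source) :
    (e.symm.trans e' : R2 → R2) =ᶠ[𝓝 u] fun v => v + ((e.symm.trans e') u - u) := by
  apply eventuallyEq_translation
  · exact (e.symm.trans e').continuousAt hu
  · filter_upwards [(e.symm.trans e').open_source.mem_nhds hu] with v hv
    rw [← mem_torus_atlas.1 he']
    have hv2 : e.symm v ∈ e'.source := hv.2
    simp only [OpenPartialHomeomorph.coe_trans, Function.comp_apply]
    rw [e'.left_inv hv2, mem_torus_atlas.1 he', mem_torus_atlas.1 he]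

instance torus_isManifold : IsManifold (𝓡 2) ∞ (Circle × Circle) := by
  apply isManifold_of_contDiffOn
  intro e e' he he' u hu
  simp only [modelWithCornersSelf_coe, modelWithCornersSelf_coe_symm, Function.comp_id,
    Set.preimage_id_eq, id_eq, Set.range_id, Set.inter_univ, Function.id_comp] at hu ⊢
  have h := torus_transition he he' hu
  exact (ContDiffAt.congr_of_eventuallyEq (by fun_prop) h).contDiffWithinAt

instance torus_closedOrientedSurface : ClosedOrientedSurface (Circle × Circle) where
  t2 := inferInstance
  compact := inferInstance
  connected := by
    have : ConnectedSpace Circle :=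
      Function.Surjective.connectedSpace (f := Circle.exp)
        (fun z => ⟨Complex.arg z, Circle.exp_arg z⟩) Circle.exp.continuous
    infer_instance
  smooth := inferInstance
  oriented e he e' he' u hu := by
    rw [(torus_transition he he' hu).fderiv_eq]
    rw [fderiv_add_const]
    simp [ContinuousLinearMap.det]

theorem contMDiff_torusCover : ContMDiff (𝓡 2) (𝓡 2) ∞ torusCover := by
  intro u
  set e := isLocalHomeomorph_torusCover.localInverseAt u
  have he : e ∈ IsManifold.maximalAtlas (𝓡 2) ∞ (Circle × Circle) :=
    IsManifold.subset_maximalAtlas (isLocalHomeomorph_torusCover.localInverseAt_symm u)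
  have h := contMDiffOn_symm_of_mem_maximalAtlas he
  rw [isLocalHomeomorph_torusCover.localInverseAt_symm u] at h
  exact h.contMDiffAt
    (e.open_target.mem_nhds isLocalHomeomorph_torusCover.self_mem_localInverseAt_target)

/-! ### Calculus on the torus through its universal covering -/

theorem contMDiff_torus_iff {V : Type*} [NormedAddCommGroup V] [NormedSpace ℝ V]
    {f : Circle × Circle → V} :
    ContMDiff (𝓡 2) 𝓘(ℝ, V) ∞ f ↔ ContDiff ℝ ∞ (f ∘ torusCover) := by
  constructor
  · intro h
    exact (h.comp contMDiff_torusCover).contDiff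
  · intro h q
    obtain ⟨u, rfl⟩ := surjective_torusCover q
    set e := isLocalHomeomorph_torusCover.localInverseAt u
    have he : e ∈ IsManifold.maximalAtlas (𝓡 2) ∞ (Circle × Circle) :=
      IsManifold.subset_maximalAtlas (isLocalHomeomorph_torusCover.localInverseAt_symm u)
    have hs : e.source ∈ 𝓝 (torusCover u) := e.open_source.mem_nhds
      isLocalHomeomorph_torusCover.apply_self_mem_localInverseAt_source
    have h1 : ContMDiffAt (𝓡 2) (𝓡 2) ∞ e (torusCover u) :=
      (contMDiffOn_of_mem_maximalAtlas he).contMDiffAt hs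
    have h2 := (h.contMDiff.contMDiffAt (x := e (torusCover u))).comp (torusCover u) h1
    refine h2.congr_of_eventuallyEq ?_
    filter_upwards [hs] with q hq
    simp [isLocalHomeomorph_torusCover.apply_localInverseAt_of_mem hq, e]

/-- The preferred chart at the image point is a local inverse of the covering based at a chosen
lift. Composed with the covering it is a translation, whose derivative is the identity. -/
theorem mfderiv_torusCover (u : R2) :
    mfderiv (𝓡 2) (𝓡 2) torusCover u = ContinuousLinearMap.id ℝ R2 := by
  have hd : MDifferentiableAt (𝓡 2) (𝓡 2) torusCover u :=
    contMDiff_torusCover.mdifferentiable (by simp) u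
  rw [hd.mfderiv]
  simp only [modelWithCornersSelf_coe, Set.range_id, fderivWithin_univ]
  set q := (surjective_torusCover (torusCover u)).choose
  set e := isLocalHomeomorph_torusCover.localInverseAt q with he
  have h : writtenInExtChartAt (𝓡 2) (𝓡 2) u torusCover = e ∘ torusCover := by
    rfl
  have hs : torusCover u ∈ e.source := mem_chart_source R2 (torusCover u)
  have hc : ContinuousAt torusCover u := contMDiff_torusCover.continuous.continuousAt
  have h2 : e ∘ torusCover =ᶠ[𝓝 u] fun v => v + ((e ∘ torusCover) u - u) := by
    apply eventuallyEq_translation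
    · exact (e.continuousAt hs).comp hc
    · filter_upwards [hc (e.open_source.mem_nhds hs)] with v hv
      exact isLocalHomeomorph_torusCover.apply_localInverseAt_of_mem hv
  have h3 : extChartAt (𝓡 2) u u = u := rfl
  rw [h, h3, h2.fderiv_eq, fderiv_add_const, fderiv_fun_id]

theorem mfderiv_torus {V : Type*} [NormedAddCommGroup V] [NormedSpace ℝ V]
    {f : Circle × Circle → V} (hf : ContMDiff (𝓡 2) 𝓘(ℝ, V) ∞ f) (u : R2) :
    (mfderiv (𝓡 2) 𝓘(ℝ, V) f (torusCover u) : R2 →L[ℝ] V) = fderiv ℝ (f ∘ torusCover) u := by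
  have h := mfderiv_comp u (hf.mdifferentiable (by simp) (torusCover u))
    (contMDiff_torusCover.mdifferentiable (by simp) u)
  rw [mfderiv_torusCover, mfderiv_eq_fderiv] at h
  rw [h]
  rfl

theorem isDiscChart_torusCover_comp {h : R2 → R2} (hh : ContDiff ℝ ∞ h)
    (hb : ∀ u, Function.Bijective (fderiv ℝ h u)) (hi : Function.Injective (torusCover ∘ h)) :
    IsDiscChart (fun _ : Fin 1 => torusCover ∘ h) := by
  refine ⟨fun _ => contMDiff_torusCover.comp hh.contMDiff, fun i j u v huv =>
    ⟨Subsingleton.elim _ _, hi huv⟩, fun _ u => ?_⟩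
  have h := mfderiv_comp u (contMDiff_torusCover.mdifferentiable (by simp) (h u))
    (hh.contMDiff.mdifferentiable (by simp) u)
  rw [mfderiv_torusCover, mfderiv_eq_fderiv] at h
  rw [h]
  exact hb u

/-! ## Smooth open embeddings -/

section SmoothEmbedding

variable {E : Type*} [NormedAddCommGroup E] [NormedSpace ℝ E] [FiniteDimensional ℝ E]

/-- The derivative of a map with bijective derivative, as an equivalence. -/
theorem exists_hasFDerivAt_equiv {f : E → E} (hf : ContDiff ℝ ∞ f) {p : E}
    (hb : Function.Bijective (fderiv ℝ f p)) :
    ∃ L : E ≃L[ℝ] E, HasFDerivAt f (L : E →L[ℝ] E) p := by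
  have : CompleteSpace E := FiniteDimensional.complete ℝ E
  refine ⟨(LinearEquiv.ofBijective (fderiv ℝ f p : E →ₗ[ℝ] E) hb).toContinuousLinearEquiv, ?_⟩
  exact (hf.differentiable (by simp) p).hasFDerivAt

theorem isOpenEmbedding_of_fderiv_bijective {f : E → E} (hf : ContDiff ℝ ∞ f)
    (hi : Function.Injective f) (hb : ∀ p, Function.Bijective (fderiv ℝ f p)) :
    Topology.IsOpenEmbedding f := by
  have : CompleteSpace E := FiniteDimensional.complete ℝ E
  refine .of_continuous_injective_isOpenMap hf.continuous hi ?_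
  rw [isOpenMap_iff_nhds_le]
  intro p
  obtain ⟨L, hL⟩ := exists_hasFDerivAt_equiv hf (hb p)
  exact ((hf.contDiffAt.hasStrictFDerivAt' hL (by simp)).map_nhds_eq_of_equiv).ge

/-- Near a point of the open range, `Function.invFun` is the local inverse given by the inverse
function theorem; its arbitrary values off the range play no role. -/
theorem contDiffAt_invFun {f : E → E} (hf : ContDiff ℝ ∞ f) (hi : Function.Injective f)
    (hb : ∀ p, Function.Bijective (fderiv ℝ f p)) (p : E) :
    ContDiffAt ℝ ∞ (Function.invFun f) (f p) := by
  have : CompleteSpace E := FiniteDimensional.complete ℝ E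
  have ho := isOpenEmbedding_of_fderiv_bijective hf hi hb
  obtain ⟨L, hL⟩ := exists_hasFDerivAt_equiv hf (hb p)
  set e := ho.toOpenPartialHomeomorph f
  have hp : e.symm (f p) = p := e.left_inv (x := p) (by simp [e])
  have h := e.contDiffAt_symm (a := f p) (n := ∞) (by simp [e]) (f₀' := L)
    (by rw [hp]; exact hL) (by rw [hp]; exact hf.contDiffAt)
  refine h.congr_of_eventuallyEq ?_
  filter_upwards [ho.isOpen_range.mem_nhds ⟨p, rfl⟩] with q hq
  obtain ⟨q, rfl⟩ := hq
  rw [Function.leftInverse_invFun hi, show f q = e q from rfl, e.left_inv (x := q) (by simp [e])]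

end SmoothEmbedding

/-! ## Sheet equations and checkerboard colorings -/

/-- The sign of a real number as a unit; zero counts as negative. -/
def signUnit (a : ℝ) : ℤˣ := if 0 < a then 1 else -1

theorem signUnit_of_pos {a : ℝ} (h : 0 < a) : signUnit a = 1 := if_pos h

theorem signUnit_of_nonpos {a : ℝ} (h : a ≤ 0) : signUnit a = -1 := if_neg h.not_gt

namespace SurfaceKnotDiagram

variable {S : Type} [TopologicalSpace S] [ChartedSpace R2 S]

/-- `F` vanishes on the sheet of `D` through `y`, with nonzero differential. -/
structure IsSheetEquation (D : SurfaceKnotDiagram S) (y : S) (F : R3 → ℝ) : Prop where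
  contDiffAt : ContDiffAt ℝ 1 F (D.proj y)
  fderiv_ne_zero : fderiv ℝ F (D.proj y) ≠ 0
  eventually_eq_zero : ∀ᶠ y' in 𝓝 y, F (D.proj y') = 0

/-- `c` is a checkerboard coloring of the surface cut along the lower points: it changes sign
when the surface crosses a higher sheet. -/
def IsCheckerboard (D : SurfaceKnotDiagram S) (c : S → ℤˣ) : Prop :=
  ∀ x, ∃ (s : Finset S) (F : S → R3 → ℝ) (ε : ℤˣ),
    (∀ y, y ∈ s ↔ D.Under x y) ∧ (∀ y ∈ s, D.IsSheetEquation y (F y)) ∧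
    ∀ᶠ x' in 𝓝 x, (∀ y, ¬ D.Under x' y) → c x' = ε * ∏ y ∈ s, signUnit (F y (D.proj x'))

/-- The surface has a checkerboard coloring. -/
def HasCheckerboard (D : SurfaceKnotDiagram S) : Prop := ∃ c, D.IsCheckerboard c

/-! ### Checkerboard colorings under isotopy and reparametrization -/

theorem HasCheckerboard.of_diffeomorph {D D' : SurfaceKnotDiagram S}
    (e : Diffeomorph 𝓘(ℝ, R3) 𝓘(ℝ, R3) R3 R3 ∞) (hp : ∀ x, D'.proj x = e (D.proj x))
    (hu : ∀ x y, D'.Under x y ↔ D.Under x y) (h : D.HasCheckerboard) : D'.HasCheckerboard := by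
  obtain ⟨c, hc⟩ := h
  refine ⟨c, fun x => ?_⟩
  obtain ⟨s, F, ε, hs, hF, hx⟩ := hc x
  have he : ContDiff ℝ ∞ e := e.contMDiff.contDiff
  have he' : ContDiff ℝ ∞ e.symm := e.symm.contMDiff.contDiff
  -- The coloring stays the same; only the sheet equations are carried along by the diffeomorphism.
  refine ⟨s, fun y => F y ∘ e.symm, ε, fun y => by rw [hs, hu], fun y hy => ⟨?_, fun h0 => ?_, ?_⟩,
    ?_⟩
  · rw [hp]
    refine ContDiffAt.comp _ ?_ (he'.of_le (by simp)).contDiffAt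
    rw [e.symm_apply_apply]
    exact (hF y hy).contDiffAt
  · apply (hF y hy).fderiv_ne_zero
    have h1 : F y = (F y ∘ e.symm) ∘ e := by ext q; simp
    have h2 : DifferentiableAt ℝ (F y ∘ e.symm) (e (D.proj y)) := by
      refine DifferentiableAt.comp _ ?_ (he'.differentiable (by simp) _)
      rw [e.symm_apply_apply]
      exact (hF y hy).contDiffAt.differentiableAt (by simp)
    rw [h1, fderiv_comp _ h2 (he.differentiable (by simp) _), ← hp, h0]
    simp
  · filter_upwards [(hF y hy).eventually_eq_zero] with y' hy'
    simp [hp, hy']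
  · filter_upwards [hx] with x' hx' hf
    rw [hx' fun y => by rw [← hu]; exact hf y]
    simp [hp]

theorem HasCheckerboard.of_homeomorph {D D' : SurfaceKnotDiagram S} (g : S ≃ₜ S)
    (hp : ∀ x, D'.proj x = D.proj (g x)) (hu : ∀ x y, D'.Under x y ↔ D.Under (g x) (g y))
    (h : D.HasCheckerboard) : D'.HasCheckerboard := by
  obtain ⟨c, hc⟩ := h
  refine ⟨c ∘ g, fun x => ?_⟩
  obtain ⟨s, F, ε, hs, hF, hx⟩ := hc (g x)
  refine ⟨s.map g.symm.toEquiv.toEmbedding, fun y => F (g y), ε, fun y => ?_, fun y hy => ?_, ?_⟩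
  · rw [hu, ← hs]
    simp only [Finset.mem_map, Equiv.coe_toEmbedding, Homeomorph.coe_toEquiv]
    constructor
    · rintro ⟨z, hz, rfl⟩
      simpa using hz
    · intro hy
      exact ⟨g y, hy, by simp⟩
  · have hy : g y ∈ s := by
      obtain ⟨z, hz, rfl⟩ := Finset.mem_map.1 hy
      simpa using hz
    refine ⟨?_, ?_, ?_⟩
    · rw [hp]; exact (hF _ hy).contDiffAt
    · rw [hp]; exact (hF _ hy).fderiv_ne_zero
    · filter_upwards [g.continuous.continuousAt.eventually (hF _ hy).eventually_eq_zero] with z hz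
      rw [hp, hz]
  · filter_upwards [g.continuous.continuousAt.eventually hx] with x' hx' hf
    rw [Function.comp_apply, hx' fun y hy => hf (g.symm y) (by rw [hu]; simpa using hy)]
    simp [hp]

theorem contMDiff_proj (D : SurfaceKnotDiagram S) : ContMDiff (𝓡 2) 𝓘(ℝ, R3) ∞ D.proj :=
  (contDiff_fst (𝕜 := ℝ) (E := R3) (F := ℝ)).contMDiff.comp D.smooth

end SurfaceKnotDiagram

/-! ## Graph sheets -/

/-- The vertical projection. -/
def planePart (q : R3) : R2 := !₂[q 0, q 1]

theorem contDiff_planePart : ContDiff ℝ ∞ planePart := by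
  unfold planePart
  rw [contDiff_euclidean]
  intro i
  fin_cases i <;> simp <;> fun_prop

theorem contDiff_graphSheet {g : R2 → ℝ} (hg : ContDiff ℝ ∞ g) : ContDiff ℝ ∞ (graphSheet g) := by
  unfold graphSheet
  rw [contDiff_euclidean]
  intro i
  fin_cases i <;> simp <;> fun_prop

@[simp] theorem planePart_graphSheet (g : R2 → ℝ) (u : R2) : planePart (graphSheet g u) = u := by
  ext i
  fin_cases i <;> simp [planePart, graphSheet]

@[simp] theorem graphSheet_apply_two (g : R2 → ℝ) (u : R2) : graphSheet g u 2 = g u := by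
  simp [graphSheet]

/-- A point and its foot on the graph differ by a vertical vector, which makes `q 2 - g (planePart
q)` the model equation of the sheet. -/
theorem sub_graphSheet (g : R2 → ℝ) (q : R3) : q - graphSheet g (planePart q) =
    (q 2 - g (planePart q)) • EuclideanSpace.single 2 1 := by
  ext i
  fin_cases i <;> simp [planePart, graphSheet]

theorem graphSheet_injective {g g' : R2 → ℝ} {u v : R2} (h : graphSheet g u = graphSheet g' v) :
    u = v ∧ g u = g' v := by
  constructor
  · rw [← planePart_graphSheet g u, h, planePart_graphSheet]
  · rw [← graphSheet_apply_two g u, h, graphSheet_apply_two]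

theorem injective_fderiv_graphSheet {g : R2 → ℝ} (hg : ContDiff ℝ ∞ g) (u : R2) :
    Function.Injective (fderiv ℝ (graphSheet g) u) := by
  have h : planePart ∘ graphSheet g = id := by ext1 u; simp
  have h1 := fderiv_comp u (contDiff_planePart.differentiable (by simp) (graphSheet g u))
    ((contDiff_graphSheet hg).differentiable (by simp) u)
  rw [h, fderiv_id] at h1
  intro v w hvw
  have h2 := congrArg (fun L : R2 →L[ℝ] R2 => L v) h1
  have h3 := congrArg (fun L : R2 →L[ℝ] R2 => L w) h1
  simp only [ContinuousLinearMap.id_apply, ContinuousLinearMap.comp_apply] at h2 h3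
  rw [h2, h3, hvw]

/-- Two equations of the same sheet differ in sign by a constant. -/
theorem exists_signUnit_eq {G : R3 → ℝ} {g : R2 → ℝ} (hg : ContDiff ℝ ∞ g) {u : R2}
    (hG : ContDiffAt ℝ 1 G (graphSheet g u)) (h0 : fderiv ℝ G (graphSheet g u) ≠ 0)
    (hz : ∀ᶠ v in 𝓝 u, G (graphSheet g v) = 0) :
    ∃ ε : ℤˣ, ∀ᶠ q in 𝓝 (graphSheet g u), q 2 - g (planePart q) ≠ 0 →
      signUnit (G q) = ε * signUnit (q 2 - g (planePart q)) := by
  set q₀ := graphSheet g u with hq₀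
  set L := fderiv ℝ G q₀
  set a := L (EuclideanSpace.single 2 1) with ha
  have hd : DifferentiableAt ℝ G q₀ := hG.differentiableAt (by simp)
  -- The differential of `G` kills the tangent plane of the graph. If it also killed the vertical
  -- direction it would be zero, as these span the space.
  have ha0 : a ≠ 0 := by
    intro ha0
    apply h0
    have hcomp : fderiv ℝ (G ∘ graphSheet g) u = 0 := by
      have : G ∘ graphSheet g =ᶠ[𝓝 u] fun _ => 0 := hz
      rw [this.fderiv_eq]
      simp
    rw [fderiv_comp u hd ((contDiff_graphSheet hg).differentiable (by simp) u)] at hcomp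
    ext w
    have h1 : w = fderiv ℝ (graphSheet g) u (fderiv ℝ planePart q₀ w) +
        (w 2 - fderiv ℝ g u (fderiv ℝ planePart q₀ w)) • EuclideanSpace.single 2 1 := by
      have hfun : ∀ q, q = graphSheet g (planePart q) +
          (q 2 - g (planePart q)) • (EuclideanSpace.single 2 1 : R3) := fun q => by
        rw [← sub_graphSheet]; abel
      have hid : HasFDerivAt (fun q : R3 => q) (ContinuousLinearMap.id ℝ R3) q₀ := hasFDerivAt_id _
      have hpp : HasFDerivAt planePart (fderiv ℝ planePart q₀) q₀ :=
        (contDiff_planePart.differentiable (by simp) _).hasFDerivAt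
      have hu : planePart q₀ = u := planePart_graphSheet g u
      have hgs : HasFDerivAt (graphSheet g) (fderiv ℝ (graphSheet g) u) (planePart q₀) := by
        rw [hu]; exact ((contDiff_graphSheet hg).differentiable (by simp) _).hasFDerivAt
      have hgg : HasFDerivAt g (fderiv ℝ g u) (planePart q₀) := by
        rw [hu]; exact (hg.differentiable (by simp) _).hasFDerivAt
      have h2 : HasFDerivAt (fun q : R3 => q 2) (EuclideanSpace.proj (2 : Fin 3) : R3 →L[ℝ] ℝ) q₀ :=
        (EuclideanSpace.proj (2 : Fin 3) : R3 →L[ℝ] ℝ).hasFDerivAt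
      have hr := (hgs.comp q₀ hpp).add
        ((h2.sub (hgg.comp q₀ hpp)).smul_const (EuclideanSpace.single 2 1 : R3))
      have heq := hid.unique (hr.congr_of_eventuallyEq (.of_forall fun q => by
        simpa using hfun q))
      have := congrArg (fun T : R3 →L[ℝ] R3 => T w) heq
      simpa using this
    have h3 := congrArg (fun T : R2 →L[ℝ] ℝ => T (fderiv ℝ planePart q₀ w)) hcomp
    simp only [ContinuousLinearMap.comp_apply, zero_apply] at h3
    rw [h1, map_add, map_smul]
    simp only [zero_apply]
    rw [show fderiv ℝ G q₀ (EuclideanSpace.single 2 1) = a from rfl, ha0]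
    simpa using h3
  have hs : HasStrictFDerivAt G L q₀ := hG.hasStrictFDerivAt (by simp)
  -- Strict differentiability compares `G` at `q` and at its foot, where `G` vanishes: `G q` is `a`
  -- times the vertical distance `b`, with an error of at most half of this. So its sign is that of
  -- `a * b`.
  have hlo := hs.isLittleO.def (c := |a| / 2) (by positivity)
  have hq : q₀ = graphSheet g (planePart q₀) := by rw [hq₀, planePart_graphSheet]
  have hcont : ContinuousAt (fun q => graphSheet g (planePart q)) q₀ :=
    ((contDiff_graphSheet hg).continuous.comp contDiff_planePart.continuous).continuousAt
  have ht : Filter.Tendsto (fun q => (q, graphSheet g (planePart q))) (𝓝 q₀) (𝓝 (q₀, q₀)) := by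
    refine Filter.Tendsto.prodMk_nhds Filter.tendsto_id ?_
    have := hcont.tendsto
    rwa [← hq] at this
  have hz' : ∀ᶠ q in 𝓝 q₀, G (graphSheet g (planePart q)) = 0 := by
    have hc : ContinuousAt planePart q₀ := contDiff_planePart.continuous.continuousAt
    have hu : planePart q₀ = u := planePart_graphSheet g u
    exact hc.eventually (by rw [hu]; exact hz)
  refine ⟨signUnit a, ?_⟩
  filter_upwards [ht.eventually hlo, hz'] with q h1 h2 h3
  rw [h2, sub_graphSheet, map_smul, norm_smul, ← ha] at h1
  set b := q 2 - g (planePart q)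
  simp only [sub_zero, smul_eq_mul, Real.norm_eq_abs, PiLp.norm_single, mul_one,
    norm_one] at h1
  have hab : |b * a| = |b| * |a| := abs_mul b a
  have hb : 0 < |b| := abs_pos.2 h3
  have hapos : 0 < |a| := abs_pos.2 ha0
  have h4 := abs_le.1 h1
  have h5 : 0 < |b| * |a| := by positivity
  rcases lt_or_gt_of_ne ha0 with hna | hpa <;> rcases lt_or_gt_of_ne h3 with hnb | hpb
  · have : 0 < b * a := mul_pos_of_neg_of_neg hnb hna
    rw [abs_of_pos this] at hab
    rw [signUnit_of_nonpos hna.le, signUnit_of_nonpos hnb.le, signUnit_of_pos (by nlinarith)]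
    rfl
  · have : b * a < 0 := mul_neg_of_pos_of_neg hpb hna
    rw [abs_of_neg this] at hab
    rw [signUnit_of_nonpos hna.le, signUnit_of_pos hpb, signUnit_of_nonpos (by nlinarith)]
    rfl
  · have : b * a < 0 := mul_neg_of_neg_of_pos hnb hpa
    rw [abs_of_neg this] at hab
    rw [signUnit_of_pos hpa, signUnit_of_nonpos hnb.le, signUnit_of_nonpos (by nlinarith)]
    rfl
  · have : 0 < b * a := mul_pos hpb hpa
    rw [abs_of_pos this] at hab
    rw [signUnit_of_pos hpa, signUnit_of_pos hpb, signUnit_of_pos (by nlinarith)]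
    rfl

/-! ## Intersections of planes -/

/-- Intersecting with one more plane lowers the dimension by at most one. -/
theorem three_le_finrank_biInf_add_card {ι : Type*} [DecidableEq ι] (T : ι → Submodule ℝ R3)
    (A : Finset ι) (hT : ∀ x ∈ A, Module.finrank ℝ (T x) = 2) :
    3 ≤ Module.finrank ℝ (⨅ x ∈ A, T x : Submodule ℝ R3) + A.card := by
  induction A using Finset.induction_on with
  | empty =>
    have h5 : (⨅ x ∈ (∅ : Finset ι), T x) = ⊤ := by simp
    rw [h5, finrank_top]
    simp
  | insert a A ha ih =>
    have h1 := ih fun x hx => hT x (Finset.mem_insert_of_mem hx)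
    have h2 := hT a (Finset.mem_insert_self a A)
    have h3 := Submodule.finrank_sup_add_finrank_inf_eq (T a) (⨅ x ∈ A, T x)
    have h4 := Submodule.finrank_le (T a ⊔ ⨅ x ∈ A, T x)
    have h5 : Module.finrank ℝ R3 = 3 := by simp
    rw [Finset.iInf_insert, Finset.card_insert_of_notMem ha]
    omega

/-- A repeated plane can be dropped from the intersection without changing it. This contradicts the
codimension count in the definition of a generic map. -/
theorem four_le_finrank_biInf_add_card {ι : Type*} (T : ι → Submodule ℝ R3) (A : Finset ι)
    (hT : ∀ x ∈ A, Module.finrank ℝ (T x) = 2) {a b : ι} (ha : a ∈ A) (hb : b ∈ A) (hab : a ≠ b)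
    (h : T a = T b) : 4 ≤ Module.finrank ℝ (⨅ x ∈ A, T x : Submodule ℝ R3) + A.card := by
  classical
  have h1 := three_le_finrank_biInf_add_card T (A.erase b)
    fun x hx => hT x (Finset.mem_of_mem_erase hx)
  have h2 : (⨅ x ∈ A, T x) = ⨅ x ∈ A.erase b, T x := by
    rw [← Finset.insert_erase hb, Finset.iInf_insert, Finset.erase_insert_eq_erase,
      Finset.erase_idem, inf_eq_right, ← h]
    exact iInf₂_le a (Finset.mem_erase.2 ⟨hab, ha⟩)
  have h3 := Finset.card_erase_add_one hb
  rw [h2]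
  omega

namespace IsSpaceChart

variable {φ : R3 → R3}

theorem isOpenEmbedding (h : IsSpaceChart φ) : Topology.IsOpenEmbedding φ :=
  isOpenEmbedding_of_fderiv_bijective h.1 h.2.1 h.2.2

theorem invFun_apply (h : IsSpaceChart φ) (q : R3) : Function.invFun φ (φ q) = q :=
  Function.leftInverse_invFun h.2.1 q

end IsSpaceChart

/-! ## Pictures made of graphs -/

section DiscChart

variable {S : Type} [TopologicalSpace S] [ChartedSpace R2 S]

/-- The points with coordinate `u` of the discs. -/
def IsDiscChart.centers {n : ℕ} {ψ : Fin n → R2 → S} (hψ : IsDiscChart ψ) (u : R2) : Fin n ↪ S :=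
  ⟨fun j => ψ j u, fun _ _ h => (hψ.2.1 _ _ _ _ h).1⟩

@[simp] theorem IsDiscChart.centers_apply {n : ℕ} {ψ : Fin n → R2 → S} (hψ : IsDiscChart ψ)
    (u : R2) (j : Fin n) : hψ.centers u j = ψ j u := rfl

end DiscChart

namespace SurfaceKnotDiagram

variable {S : Type} [TopologicalSpace S] [ChartedSpace R2 S]

section Picture

variable {D : SurfaceKnotDiagram S} {n : ℕ} {φ : R3 → R3} {ψ : Fin n → R2 → S}
  {σ : Equiv.Perm (Fin n)} {ε : ℝ} {g : Fin n → R2 → ℝ}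

/-! ### Double points, topology and tangent planes of graph pictures -/

theorem LooksLike.proj_apply (h : D.LooksLike φ ψ (fun i => graphSheet (g i)) σ ε) (i : Fin n)
    (u : R2) : D.proj (ψ i u) = φ (graphSheet (g i) u) := h.1.1 i u

/-- Graphs can only meet over the same point of the plane. The alternative of `LocalUnder` for
points of one sheet then compares a number with itself and never occurs. -/
theorem LooksLike.under_iff (hφ : IsSpaceChart φ)
    (h : D.LooksLike φ ψ (fun i => graphSheet (g i)) σ ε) (i : Fin n) (u : R2) (y : S) :
    D.Under (ψ i u) y ↔ ∃ j, σ i < σ j ∧ g j u = g i u ∧ ψ j u = y := by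
  constructor
  · intro hu
    have hy : D.proj y ∈ Set.range φ := ⟨graphSheet (g i) u, by rw [← h.proj_apply, hu.1]⟩
    obtain ⟨j, v, rfl⟩ := (h.1.2 y).1 hy
    have h1 := hu.1
    rw [h.proj_apply, h.proj_apply] at h1
    obtain ⟨rfl, h2⟩ := graphSheet_injective (hφ.2.1 h1)
    have h3 := (h.2 i u j u (hφ.2.1 h1)).1 hu
    rcases h3 with h3 | ⟨_, h3⟩
    · exact ⟨j, h3, h2.symm, rfl⟩
    · exact absurd h3 (lt_irrefl _)
  · rintro ⟨j, h1, h2, rfl⟩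
    refine (h.2 i u j u ?_).2 (Or.inl h1)
    simp [graphSheet, h2]

theorem LooksLike.isOpen_union (hφ : IsSpaceChart φ) {m : Fin n → R2 → R3}
    (h : D.LooksLike φ ψ m σ ε) : IsOpen {x | ∃ i u, ψ i u = x} := by
  have : {x | ∃ i u, ψ i u = x} = D.proj ⁻¹' Set.range φ := by
    ext x
    exact (h.1.2 x).symm
  rw [this]
  exact hφ.isOpenEmbedding.isOpen_range.preimage D.contMDiff_proj.continuous

/-- Neighborhoods on the surface of a point of a disc are neighborhoods in the disc. -/
theorem LooksLike.eventually_nhds [T2Space S] (hφ : IsSpaceChart φ) (hψ : IsDiscChart ψ)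
    (h : D.LooksLike φ ψ (fun i => graphSheet (g i)) σ ε)
    {i : Fin n} {u : R2} {P : S → Prop} (hP : ∀ᶠ v in 𝓝 u, P (ψ i v)) : ∀ᶠ x in 𝓝 (ψ i u), P x := by
  have hψc : ∀ j, Continuous (ψ j) := fun j => (hψ.1 j).continuous
  have hne : ∀ j, ∀ᶠ p : S × R2 in 𝓝 (ψ i u, u), j ≠ i → p.1 ≠ ψ j p.2 := by
    intro j
    by_cases hj : j = i
    · simp [hj]
    have : ψ i u ≠ ψ j u := fun h => hj (hψ.2.1 _ _ _ _ h).1.symm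
    have hc1 : ContinuousAt (fun p : S × R2 => p.1) (ψ i u, u) := by fun_prop
    have hc2 : ContinuousAt (fun p : S × R2 => ψ j p.2) (ψ i u, u) :=
      ((hψc j).comp continuous_snd).continuousAt
    filter_upwards [(ContinuousAt.ne_iff_eventually_ne hc1 hc2).1 this] with p hp _ using hp
  -- `G` reads off the plane coordinate of a point of any disc. A nearby point lies in one of the
  -- discs, and by `hne` it cannot lie in a disc other than `i`, whose point with that coordinate
  -- would be too far away.
  let G : S → R2 := fun x => planePart (Function.invFun φ (D.proj x))
  have hG : ∀ j v, G (ψ j v) = v := fun j v => by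
    simp only [G]
    rw [h.proj_apply, hφ.invFun_apply, planePart_graphSheet]
  have hGc : Filter.Tendsto G (𝓝 (ψ i u)) (𝓝 u) := by
    have h1 : ContinuousAt (Function.invFun φ) (D.proj (ψ i u)) := by
      rw [h.proj_apply]
      exact (contDiffAt_invFun hφ.1 hφ.2.1 hφ.2.2 _).continuousAt
    have h2 : ContinuousAt G (ψ i u) :=
      contDiff_planePart.continuous.continuousAt.comp
        (h1.comp D.contMDiff_proj.continuous.continuousAt)
    have h3 := h2.tendsto
    rwa [hG] at h3
  have hGt : Filter.Tendsto (fun x => (x, G x)) (𝓝 (ψ i u)) (𝓝 (ψ i u, u)) :=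
    Filter.tendsto_id.prodMk_nhds hGc
  filter_upwards [hGt.eventually (Filter.eventually_all.2 hne), hGc.eventually hP,
    (h.isOpen_union hφ).mem_nhds ⟨i, u, rfl⟩] with x h1 h2 h3
  obtain ⟨j, v, rfl⟩ := h3
  rw [hG] at h1 h2
  by_cases hj : j = i
  · rw [hj]; exact h2
  · exact absurd rfl (h1 j hj)

theorem LooksLike.diffAt_comp (hφ : IsSpaceChart φ) (hψ : IsDiscChart ψ)
    (h : D.LooksLike φ ψ (fun i => graphSheet (g i)) σ ε) (hg : ∀ i, ContDiff ℝ ∞ (g i))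
    (i : Fin n) (u : R2) :
    (diffAt D.proj (ψ i u)).comp (mfderiv (𝓡 2) (𝓡 2) (ψ i) u : R2 →L[ℝ] R2) =
      (fderiv ℝ φ (graphSheet (g i) u)).comp (fderiv ℝ (graphSheet (g i)) u) := by
  have h1 := mfderiv_comp u (D.contMDiff_proj.mdifferentiable (by simp) (ψ i u))
    ((hψ.1 i).mdifferentiable (by simp) u)
  have h2 : D.proj ∘ ψ i = φ ∘ graphSheet (g i) := by
    ext1 v; exact h.proj_apply i v
  rw [h2, mfderiv_eq_fderiv, fderiv_comp u (hφ.1.differentiable (by simp) _)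
    ((contDiff_graphSheet (hg i)).differentiable (by simp) u)] at h1
  exact h1.symm

theorem LooksLike.injective_diffAt (hφ : IsSpaceChart φ) (hψ : IsDiscChart ψ)
    (h : D.LooksLike φ ψ (fun i => graphSheet (g i)) σ ε) (hg : ∀ i, ContDiff ℝ ∞ (g i))
    (i : Fin n) (u : R2) : Function.Injective (diffAt D.proj (ψ i u)) := by
  have h1 := h.diffAt_comp hφ hψ hg i u
  have h2 : Function.Injective ((diffAt D.proj (ψ i u)).comp
      (mfderiv (𝓡 2) (𝓡 2) (ψ i) u : R2 →L[ℝ] R2)) := by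
    rw [h1]
    exact (hφ.2.2 _).1.comp (injective_fderiv_graphSheet (hg i) u)
  intro v w hvw
  obtain ⟨v, rfl⟩ := (hψ.2.2 i u).2 v
  obtain ⟨w, rfl⟩ := (hψ.2.2 i u).2 w
  exact congrArg _ (h2 hvw)

theorem LooksLike.range_diffAt (hφ : IsSpaceChart φ) (hψ : IsDiscChart ψ)
    (h : D.LooksLike φ ψ (fun i => graphSheet (g i)) σ ε) (hg : ∀ i, ContDiff ℝ ∞ (g i))
    (i : Fin n) (u : R2) : LinearMap.range (diffAt D.proj (ψ i u) : R2 →ₗ[ℝ] R3) =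
      LinearMap.range (((fderiv ℝ φ (graphSheet (g i) u)).comp
        (fderiv ℝ (graphSheet (g i)) u) : R2 →L[ℝ] R3) : R2 →ₗ[ℝ] R3) := by
  rw [← h.diffAt_comp hφ hψ hg i u]
  ext w
  simp only [LinearMap.mem_range, ContinuousLinearMap.coe_coe]
  constructor
  · rintro ⟨v, rfl⟩
    obtain ⟨v', rfl⟩ := (hψ.2.2 i u).2 v
    exact ⟨v', rfl⟩
  · rintro ⟨v, rfl⟩
    exact ⟨_, rfl⟩

/-- Two sheets of a generic diagram do not coincide on an open set. -/
theorem LooksLike.dense_ne (hφ : IsSpaceChart φ) (hψ : IsDiscChart ψ)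
    (h : D.LooksLike φ ψ (fun i => graphSheet (g i)) σ ε) (hg : ∀ i, ContDiff ℝ ∞ (g i))
    {i j : Fin n} (hij : i ≠ j) : Dense {u | g j u ≠ g i u} := by
  rw [← Set.compl_ofPred, ← interior_eq_empty_iff_dense_compl, Set.eq_empty_iff_forall_notMem]
  intro u hu
  have heq : g j =ᶠ[𝓝 u] g i := mem_interior_iff_mem_nhds.1 hu
  have hgs : graphSheet (g j) =ᶠ[𝓝 u] graphSheet (g i) := by
    filter_upwards [heq] with v hv
    simp [graphSheet, hv]
  set p := D.proj (ψ i u) with hp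
  have hpj : D.proj (ψ j u) = p := by rw [hp, h.proj_apply, h.proj_apply, hgs.self_of_nhds]
  have himm : ∀ x, D.proj x = p → Function.Injective (diffAt D.proj x) := by
    intro x hx
    have : D.proj x ∈ Set.range φ := ⟨_, by rw [hx, hp, h.proj_apply]⟩
    obtain ⟨k, v, rfl⟩ := (h.1.2 x).1 this
    exact h.injective_diffAt hφ hψ hg k v
  obtain ⟨hfin, hcard⟩ := D.generic.2 p himm
  change (D.proj ⁻¹' {p}).Finite at hfin
  change Module.finrank ℝ (⨅ x ∈ D.proj ⁻¹' {p}, LinearMap.range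
    (diffAt D.proj x : R2 →ₗ[ℝ] R3) : Submodule ℝ R3) + (D.proj ⁻¹' {p}).ncard = 3 at hcard
  -- Graphs that agree near `u` have the same tangent plane at two different points of the surface,
  -- which general position forbids.
  have h4 := four_le_finrank_biInf_add_card
    (fun x => LinearMap.range (diffAt D.proj x : R2 →ₗ[ℝ] R3)) hfin.toFinset
    (fun x hx => by
      rw [LinearMap.finrank_range_of_inj (himm x (by simpa using hx))]
      simp)
    (a := ψ i u) (b := ψ j u) (by simp [hp]) (by simp [hpj])
    (fun h => hij (hψ.2.1 _ _ _ _ h).1) (by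
      simp only
      rw [h.range_diffAt hφ hψ hg, h.range_diffAt hφ hψ hg, hgs.fderiv_eq, hgs.self_of_nhds])
  rw [← Set.ncard_eq_toFinset_card _ hfin] at h4
  have h5 : (⨅ x ∈ hfin.toFinset, LinearMap.range (diffAt D.proj x : R2 →ₗ[ℝ] R3)) =
    ⨅ x ∈ D.proj ⁻¹' {p}, LinearMap.range (diffAt D.proj x : R2 →ₗ[ℝ] R3) := by simp
  rw [h5] at h4
  omega

/-! ### Checkerboard colorings over a disc -/

/-- The sign of the checkerboard coloring of the plane `i` cut along the higher planes. -/
def pictureSign (σ : Equiv.Perm (Fin n)) (g : Fin n → R2 → ℝ) (i : Fin n) (u : R2) : ℤˣ :=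
  ∏ j ∈ Finset.univ.filter fun j => σ i < σ j, signUnit (g i u - g j u)

/-- No higher plane meets plane `i` over `u`. -/
def IsFree (σ : Equiv.Perm (Fin n)) (g : Fin n → R2 → ℝ) (i : Fin n) (u : R2) : Prop :=
  ∀ j, σ i < σ j → g j u ≠ g i u

theorem LooksLike.isFree_iff (hφ : IsSpaceChart φ)
    (h : D.LooksLike φ ψ (fun i => graphSheet (g i)) σ ε) (i : Fin n) (u : R2) :
    IsFree σ g i u ↔ ∀ y, ¬ D.Under (ψ i u) y := by
  simp only [h.under_iff hφ, IsFree]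
  exact ⟨fun h1 y ⟨j, h2, h3, _⟩ => h1 j h2 h3, fun h1 j h2 h3 => h1 _ ⟨j, h2, h3, rfl⟩⟩

theorem LooksLike.dense_isFree (hφ : IsSpaceChart φ) (hψ : IsDiscChart ψ)
    (h : D.LooksLike φ ψ (fun i => graphSheet (g i)) σ ε) (hg : ∀ i, ContDiff ℝ ∞ (g i))
    (i : Fin n) : Dense {u | IsFree σ g i u} := by
  have : {u | IsFree σ g i u} = ⋂ j, {u | σ i < σ j → g j u ≠ g i u} := by
    ext u; simp [IsFree]
  rw [this]
  apply dense_iInter_of_isOpen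
  · intro j
    by_cases hj : σ i < σ j
    · simp only [hj, true_imp_iff]
      exact isOpen_ne_fun (hg j).continuous (hg i).continuous
    · simp [hj]
  · intro j
    by_cases hj : σ i < σ j
    · simp only [hj, true_imp_iff]
      exact h.dense_ne hφ hψ hg fun h => by simp [h] at hj
    · simp [hj]

theorem eventually_signUnit_eq {f : R2 → ℝ} (hf : Continuous f) {u : R2} (h : f u ≠ 0) :
    ∀ᶠ v in 𝓝 u, signUnit (f v) = signUnit (f u) := by
  rcases lt_or_gt_of_ne h with h | h
  · filter_upwards [hf.continuousAt.eventually_lt continuousAt_const h] with v hv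
    rw [signUnit_of_nonpos h.le, signUnit_of_nonpos (le_of_lt hv)]
  · filter_upwards [continuousAt_const.eventually_lt hf.continuousAt h] with v hv
    rw [signUnit_of_pos h, signUnit_of_pos hv]

/-- On each disc, a checkerboard coloring is `pictureSign` up to a constant, near each point. -/
theorem LooksLike.exists_eventually_eq (hφ : IsSpaceChart φ) (hψ : IsDiscChart ψ)
    (h : D.LooksLike φ ψ (fun i => graphSheet (g i)) σ ε) (hg : ∀ i, ContDiff ℝ ∞ (g i))
    {c : S → ℤˣ} (hc : D.IsCheckerboard c) (i : Fin n) (u : R2) :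
    ∃ κ : ℤˣ, ∀ᶠ v in 𝓝 u, IsFree σ g i v → c (ψ i v) = κ * pictureSign σ g i v := by
  classical
  obtain ⟨s, F, ε', hs, hF, hx⟩ := hc (ψ i u)
  have hψc : ∀ j, Continuous (ψ j) := fun j => (hψ.1 j).continuous
  let T := Finset.univ.filter fun j => σ i < σ j
  have hsT : s = (T.filter fun j => g j u = g i u).map
      (hψ.centers u) := by
    ext y
    rw [hs, h.under_iff hφ]
    simp [T, and_assoc]
  -- A higher graph meeting graph `i` over `u` enters through its sheet equation, which agrees in
  -- sign with the height difference up to a constant. One that does not meet it contributes a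
  -- locally constant sign. In both cases the factor of `pictureSign` is matched up to a constant
  -- `δ`.
  have key : ∀ j, ∃ δ : ℤˣ, σ i < σ j → ∀ᶠ v in 𝓝 u, g j v ≠ g i v →
      (if g j u = g i u then signUnit (F (ψ j u) (D.proj (ψ i v))) else 1) =
        δ * signUnit (g i v - g j v) := by
    intro j
    by_cases hj : σ i < σ j
    swap
    · exact ⟨1, fun h => absurd h hj⟩
    by_cases hgu : g j u = g i u
    · have hy : D.Under (ψ i u) (ψ j u) := (h.under_iff hφ _ _ _).2 ⟨j, hj, hgu, rfl⟩
      have hE := hF _ ((hs _).2 hy)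
      have hpj := h.proj_apply j u
      have hG1 : ContDiffAt ℝ 1 (F (ψ j u) ∘ φ) (graphSheet (g j) u) := by
        refine ContDiffAt.comp _ ?_ (hφ.1.of_le (by simp)).contDiffAt
        rw [← hpj]
        exact hE.contDiffAt
      have hG2 : fderiv ℝ (F (ψ j u) ∘ φ) (graphSheet (g j) u) ≠ 0 := by
        intro h0
        apply hE.fderiv_ne_zero
        rw [hpj]
        rw [fderiv_comp _ (by rw [← hpj]; exact hE.contDiffAt.differentiableAt (by simp))
          (hφ.1.differentiable (by simp) _)] at h0
        ext w
        obtain ⟨w, rfl⟩ := (hφ.2.2 (graphSheet (g j) u)).2 w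
        simpa using congrArg (fun L : R3 →L[ℝ] ℝ => L w) h0
      have hG3 : ∀ᶠ v in 𝓝 u, (F (ψ j u) ∘ φ) (graphSheet (g j) v) = 0 := by
        filter_upwards [(hψc j).continuousAt.eventually hE.eventually_eq_zero] with v hv
        rw [Function.comp_apply, ← h.proj_apply]
        exact hv
      obtain ⟨δ, hδ⟩ := exists_signUnit_eq (hg j) hG1 hG2 hG3
      refine ⟨δ, fun _ => ?_⟩
      have hij : graphSheet (g j) u = graphSheet (g i) u := by simp [graphSheet, hgu]
      rw [hij] at hδ
      filter_upwards [(contDiff_graphSheet (hg i)).continuous.continuousAt.eventually hδ] with v hv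
        hne
      rw [if_pos hgu, h.proj_apply]
      simpa using hv (by simpa [sub_eq_zero] using hne.symm)
    · refine ⟨signUnit (g i u - g j u), fun _ => ?_⟩
      filter_upwards [eventually_signUnit_eq (f := fun v => g i v - g j v)
        ((hg i).continuous.sub (hg j).continuous) (u := u)
        (sub_ne_zero.2 (Ne.symm hgu))] with v hv _
      rw [if_neg hgu, hv, Int.units_mul_self]
  choose δ hδ using key
  refine ⟨ε' * ∏ j ∈ T, δ j, ?_⟩
  have hall : ∀ᶠ v in 𝓝 u, ∀ j, σ i < σ j → g j v ≠ g i v →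
      (if g j u = g i u then signUnit (F (ψ j u) (D.proj (ψ i v))) else 1) =
        δ j * signUnit (g i v - g j v) :=
    Filter.eventually_all.2 fun j => by
      by_cases hj : σ i < σ j
      · filter_upwards [hδ j hj] with v hv _ using hv
      · simp [hj]
  filter_upwards [hall, (hψc i).continuousAt.eventually hx] with v h1 h2 hfree
  rw [h2 ((h.isFree_iff hφ i v).1 hfree), hsT, Finset.prod_map, Finset.prod_filter, mul_assoc,
    pictureSign, ← Finset.prod_mul_distrib]
  congr 1
  refine Finset.prod_congr rfl fun j hj => ?_
  have hj' : σ i < σ j := (Finset.mem_filter.1 hj).2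
  exact h1 j hj' (hfree j hj')

/-- On each disc, a checkerboard coloring is `pictureSign` up to a constant. -/
theorem LooksLike.exists_eq (hφ : IsSpaceChart φ) (hψ : IsDiscChart ψ)
    (h : D.LooksLike φ ψ (fun i => graphSheet (g i)) σ ε) (hg : ∀ i, ContDiff ℝ ∞ (g i))
    {c : S → ℤˣ} (hc : D.IsCheckerboard c) (i : Fin n) :
    ∃ κ : ℤˣ, ∀ u, IsFree σ g i u → c (ψ i u) = κ * pictureSign σ g i u := by
  have hloc := h.exists_eventually_eq hφ hψ hg hc i
  have hd := h.dense_isFree hφ hψ hg i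
  -- The plane is covered by the two open sets on which the constant is `1` or `-1`. They are
  -- disjoint because free points are dense, so by connectedness one of them is the whole plane.
  let A : ℤˣ → Set R2 := fun κ =>
    {u | ∀ᶠ v in 𝓝 u, IsFree σ g i v → c (ψ i v) = κ * pictureSign σ g i v}
  have hA : ∀ κ, IsOpen (A κ) := fun κ => by
    rw [isOpen_iff_mem_nhds]
    intro u hu
    exact eventually_eventually_nhds.2 hu
  have hdisj : A (-1) = (A 1)ᶜ := by
    ext u
    constructor
    · intro h1 h2
      have h3 : ∀ᶠ v in 𝓝 u, ¬ IsFree σ g i v := by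
        filter_upwards [h1, h2] with v hv1 hv2 hf
        have h4 := (hv1 hf).symm.trans (hv2 hf)
        exact absurd (mul_right_cancel h4) (by decide)
      obtain ⟨v, hv1, hv2⟩ := mem_closure_iff_nhds.1 (hd u) _ h3
      exact hv1 hv2
    · intro h1
      obtain ⟨κ, hκ⟩ := hloc u
      rcases Int.units_eq_one_or κ with rfl | rfl
      · exact absurd hκ h1
      · exact hκ
  have hclopen : IsClopen (A 1) := ⟨by rw [← isOpen_compl_iff, ← hdisj]; exact hA _, hA _⟩
  rcases isClopen_iff.1 hclopen with h1 | h1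
  · refine ⟨-1, fun u hu => ?_⟩
    have : u ∈ A (-1) := by rw [hdisj, h1]; simp
    exact this.self_of_nhds hu
  · refine ⟨1, fun u hu => ?_⟩
    have : u ∈ A 1 := by rw [h1]; trivial
    exact this.self_of_nhds hu

end Picture

/-! ### Invariance under replacing one graph picture by another -/

/-- Replacing a picture made of graphs by another one, which differs from it in a bounded region,
preserves checkerboard colorability. -/
theorem HasCheckerboard.of_graph_picture [T2Space S] {D D' : SurfaceKnotDiagram S} {n : ℕ}
    {φ : R3 → R3} {ψ : Fin n → R2 → S} {σ : Equiv.Perm (Fin n)} {ε : ℝ} {g g' : Fin n → R2 → ℝ}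
    (hφ : IsSpaceChart φ) (hψ : IsDiscChart ψ)
    (hg : ∀ i, ContDiff ℝ ∞ (g i)) (hg' : ∀ i, ContDiff ℝ ∞ (g' i))
    (hD : D.LooksLike φ ψ (fun i => graphSheet (g i)) σ ε)
    (hD' : D'.LooksLike φ ψ (fun i => graphSheet (g' i)) σ ε)
    {K : Set R2} (hK : IsCompact K) (hgK : ∀ u ∉ K, ∀ i, g' i u = g i u)
    (hout : ∀ x, D.proj x ∉ Set.range φ → D'.proj x = D.proj x)
    (hund : ∀ x y, D.proj x ∉ Set.range φ → D.proj y ∉ Set.range φ →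
      (D'.Under x y ↔ D.Under x y)) (h : D.HasCheckerboard) : D'.HasCheckerboard := by
  classical
  obtain ⟨c, hc⟩ := h
  have hψc : ∀ j, Continuous (ψ j) := fun j => (hψ.1 j).continuous
  choose κ hκ using fun i => hD.exists_eq hφ hψ hg hc i
  have hrange : ∀ x, D'.proj x ∈ Set.range φ ↔ D.proj x ∈ Set.range φ := fun x => by
    rw [hD.1.2, hD'.1.2]
  -- The old coloring is kept outside. On disc `i` it is replaced by the sign product of the new
  -- graphs, with the constant `κ i` of the old coloring so that the two agree off the compact set.
  let c' : S → ℤˣ := fun x => if hx : ∃ p : Fin n × R2, ψ p.1 p.2 = x then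
    κ hx.choose.1 * pictureSign σ g' hx.choose.1 hx.choose.2 else c x
  have hc'1 : ∀ i u, c' (ψ i u) = κ i * pictureSign σ g' i u := by
    intro i u
    have hx : ∃ p : Fin n × R2, ψ p.1 p.2 = ψ i u := ⟨(i, u), rfl⟩
    obtain ⟨h1, h2⟩ := hψ.2.1 _ _ _ _ hx.choose_spec
    simp only [c', dif_pos hx, h1, h2]
  have hc'2 : ∀ x, D.proj x ∉ Set.range φ → c' x = c x := by
    intro x hx
    have : ¬ ∃ p : Fin n × R2, ψ p.1 p.2 = x := by
      rintro ⟨p, rfl⟩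
      exact hx ((hD.1.2 _).2 ⟨p.1, p.2, rfl⟩)
    simp only [c', dif_neg this]
  refine ⟨c', fun x => ?_⟩
  by_cases hx : D.proj x ∈ Set.range φ
  · obtain ⟨i, u, rfl⟩ := (hD.1.2 x).1 hx
    let T := Finset.univ.filter fun j => σ i < σ j
    -- The new sheet equations are the vertical distances to the graphs, in the coordinates `φ`.
    let F₀ : Fin n → R3 → ℝ := fun j q =>
      (Function.invFun φ q) 2 - g' j (planePart (Function.invFun φ q))
    let F : S → R3 → ℝ := fun y => if hy : ∃ p : Fin n × R2, ψ p.1 p.2 = y then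
      F₀ hy.choose.1 else 0
    have hF : ∀ j v, F (ψ j v) = F₀ j := by
      intro j v
      have hy : ∃ p : Fin n × R2, ψ p.1 p.2 = ψ j v := ⟨(j, v), rfl⟩
      obtain ⟨h1, -⟩ := hψ.2.1 _ _ _ _ hy.choose_spec
      simp only [F, dif_pos hy, h1]
    have hF₀ : ∀ j k v, F₀ j (D'.proj (ψ k v)) = g' k v - g' j v := by
      intro j k v
      simp only [F₀]
      rw [hD'.proj_apply, hφ.invFun_apply, planePart_graphSheet, graphSheet_apply_two]
    -- Graphs not meeting graph `i` over `u` have locally constant sign and are absorbed into the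
    -- constant of the local formula.
    let η : Fin n → ℤˣ := fun j =>
      if g' j u = g' i u then 1 else signUnit (g' i u - g' j u)
    refine ⟨(T.filter fun j => g' j u = g' i u).map
      (hψ.centers u), F, κ i * ∏ j ∈ T, η j,
      fun y => ?_, fun y hy => ?_, ?_⟩
    · rw [hD'.under_iff hφ]
      simp [T, and_assoc]
    · obtain ⟨j, -, rfl⟩ := Finset.mem_map.1 hy
      simp only [IsDiscChart.centers_apply]
      rw [hF]
      have hcd : ContDiffAt ℝ 1 (F₀ j) (φ (graphSheet (g' j) u)) := by
        have h1 : ContDiffAt ℝ 1 (Function.invFun φ) (φ (graphSheet (g' j) u)) :=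
          (contDiffAt_invFun hφ.1 hφ.2.1 hφ.2.2 _).of_le (by simp)
        have h2 : ContDiff ℝ 1 fun q : R3 => q 2 - g' j (planePart q) := by
          have h3 : ContDiff ℝ 1 (g' j) := (hg' j).of_le (by simp)
          have h4 : ContDiff ℝ 1 planePart := contDiff_planePart.of_le (by simp)
          fun_prop
        exact h2.contDiffAt.comp _ h1
      refine ⟨?_, ?_, ?_⟩
      · rw [hD'.proj_apply]
        exact hcd
      · rw [hD'.proj_apply]
        intro h0
        have h1 : HasFDerivAt (F₀ j) (0 : R3 →L[ℝ] ℝ) (φ (graphSheet (g' j) u)) := by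
          rw [← h0]
          exact (hcd.differentiableAt (by simp)).hasFDerivAt
        -- Along the vertical line the equation is the parameter itself, so its derivative is 1 and
        -- its differential cannot vanish.
        let l : ℝ → R3 := fun t => graphSheet (g' j) u + t • EuclideanSpace.single 2 1
        have hl : HasDerivAt l (EuclideanSpace.single 2 1) 0 := by
          have := ((hasDerivAt_id (0 : ℝ)).smul_const
            (EuclideanSpace.single (2 : Fin 3) (1 : ℝ))).const_add (graphSheet (g' j) u)
          simpa [l] using this
        have hl0 : l 0 = graphSheet (g' j) u := by simp [l]
        have h2 : HasDerivAt (φ ∘ l) (fderiv ℝ φ (l 0) (EuclideanSpace.single 2 1)) 0 :=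
          (hφ.1.differentiable (by simp) (l 0)).hasFDerivAt.comp_hasDerivAt 0 hl
        have h3 : HasDerivAt (F₀ j ∘ (φ ∘ l)) 0 0 := by
          have h4 : HasFDerivAt (F₀ j) (0 : R3 →L[ℝ] ℝ) ((φ ∘ l) 0) := by
            rw [Function.comp_apply, hl0]
            exact h1
          simpa using h4.comp_hasDerivAt 0 h2
        have h5 : F₀ j ∘ (φ ∘ l) = fun t => t := by
          ext t
          simp only [Function.comp_apply, F₀, hφ.invFun_apply]
          have h6 : planePart (l t) = u := by
            ext k
            fin_cases k <;> simp [l, planePart, graphSheet]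
          rw [h6]
          simp [l]
        rw [h5] at h3
        exact zero_ne_one (h3.unique (hasDerivAt_id' 0))
      · refine hD'.eventually_nhds hφ hψ (.of_forall fun v => ?_)
        rw [hF₀, sub_self]
    · refine hD'.eventually_nhds hφ hψ ?_
      have hall : ∀ᶠ v in 𝓝 u, ∀ j, (if g' j u = g' i u then signUnit (g' i v - g' j v) else 1) =
          η j * signUnit (g' i v - g' j v) := by
        refine Filter.eventually_all.2 fun j => ?_
        by_cases hgu : g' j u = g' i u
        · simp [η, hgu]
        · filter_upwards [eventually_signUnit_eq (f := fun v => g' i v - g' j v)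
            ((hg' i).continuous.sub (hg' j).continuous) (u := u)
            (sub_ne_zero.2 (Ne.symm hgu))] with v hv
          rw [if_neg hgu]
          simp only [η, if_neg hgu]
          rw [hv, Int.units_mul_self]
      filter_upwards [hall] with v hv _
      rw [hc'1, Finset.prod_map, Finset.prod_filter (s := T), mul_assoc, pictureSign,
        ← Finset.prod_mul_distrib]
      congr 1
      refine Finset.prod_congr rfl fun j _ => ?_
      simp only [IsDiscChart.centers_apply, hF, hF₀]
      rw [hv j, ← mul_assoc, Int.units_mul_self, one_mul]
  -- The points moved by the replacement lie in a compact, hence closed, set. Off it the two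
  -- projections and colorings agree, also at nearby points inside the discs, so the old local data
  -- at an outside point can be reused.
  · let W : Set S := (⋃ i, ψ i '' K)ᶜ
    have hW : IsOpen W := by
      rw [isOpen_compl_iff]
      exact (isCompact_iUnion fun i => hK.image (hψc i)).isClosed
    have hWout : ∀ y, D.proj y ∉ Set.range φ → y ∈ W := by
      intro y hy hyW
      obtain ⟨i, v, -, rfl⟩ := Set.mem_iUnion.1 hyW
      exact hy ((hD.1.2 _).2 ⟨i, v, rfl⟩)
    have hWin : ∀ i v, ψ i v ∈ W → v ∉ K := fun i v h hv =>
      h (Set.mem_iUnion.2 ⟨i, v, hv, rfl⟩)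
    have hproj : ∀ y ∈ W, D'.proj y = D.proj y := by
      intro y hy
      by_cases hyr : D.proj y ∈ Set.range φ
      · obtain ⟨i, v, rfl⟩ := (hD.1.2 y).1 hyr
        rw [hD.proj_apply, hD'.proj_apply]
        simp [graphSheet, hgK v (hWin i v hy) i]
      · exact hout y hyr
    have hunder : ∀ y z, D.proj y ∉ Set.range φ → (D'.Under y z ↔ D.Under y z) := by
      intro y z hy
      have aux : D'.Under y z ∨ D.Under y z → D.proj z ∉ Set.range φ := by
        rintro (h | h)
        · rw [← hrange, ← h.1, hrange]; exact hy
        · rw [← h.1]; exact hy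
      constructor <;> intro h
      · exact (hund y z hy (aux (.inl h))).1 h
      · exact (hund y z hy (aux (.inr h))).2 h
    obtain ⟨s, F, ε', hs, hF, hev⟩ := hc x
    refine ⟨s, F, ε', fun y => by rw [hs, hunder x y hx], fun y hy => ?_, ?_⟩
    · have hyr : D.proj y ∉ Set.range φ := by
        rw [← ((hs y).1 hy).1]
        exact hx
      have hyW := hWout y hyr
      refine ⟨?_, ?_, ?_⟩
      · rw [hproj y hyW]; exact (hF y hy).contDiffAt
      · rw [hproj y hyW]; exact (hF y hy).fderiv_ne_zero
      · filter_upwards [(hF y hy).eventually_eq_zero, hW.mem_nhds hyW] with z hz hzW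
        rw [hproj z hzW, hz]
    · filter_upwards [hev, hW.mem_nhds (hWout x hx)] with z hz hzW hfree
      rw [hproj z hzW]
      by_cases hzr : D.proj z ∈ Set.range φ
      · obtain ⟨i, v, rfl⟩ := (hD.1.2 z).1 hzr
        have hv := hWin i v hzW
        have hfree' : IsFree σ g i v := by
          have := (hD'.isFree_iff hφ i v).2 hfree
          simpa only [IsFree, hgK v hv] using this
        rw [← hz ((hD.isFree_iff hφ i v).1 hfree'), hc'1, hκ i v hfree']
        simp only [pictureSign, hgK v hv]
      · rw [hc'2 z hzr, hz fun y hy => hfree y ((hunder z y hzr).2 hy)]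

/-! ## The branch-free moves -/

theorem contDiff_bump : ContDiff ℝ ∞ bump := by
  unfold bump
  have h : ContDiff ℝ ∞ Real.smoothTransition := Real.smoothTransition.contDiff
  fun_prop

theorem bump_eq_zero {u : R2} (h : 2 ≤ u 0 ^ 2 + u 1 ^ 2) : bump u = 0 := by
  simp [bump, Real.smoothTransition.zero_of_nonpos (show 2 - (u 0 ^ 2 + u 1 ^ 2) ≤ 0 by linarith)]

theorem isCompact_disc (r : ℝ) : IsCompact {u : R2 | u 0 ^ 2 + u 1 ^ 2 ≤ r} := by
  refine Metric.isCompact_of_isClosed_isBounded ?_ ?_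
  · exact isClosed_le (by fun_prop) (by fun_prop)
  · refine (Metric.isBounded_closedBall (x := (0 : R2)) (r := √r)).subset fun u hu => ?_
    rw [mem_closedBall_zero_iff, EuclideanSpace.norm_eq]
    apply Real.sqrt_le_sqrt
    simpa [Fin.sum_univ_two] using hu

/-- Every branch-free move consists of graphs, which move in a disc. -/
theorem exists_graphs_of_mem_branchFreeMoves {P : LocalPicture} (hP : P ∈ branchFreeMoves) :
    ∃ g : ℝ → Fin P.n → R2 → ℝ, (∀ t i, ContDiff ℝ ∞ (g t i)) ∧
      (∀ t, P.sheet t = fun i => graphSheet (g t i)) ∧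
      ∀ t t' u, u ∉ {u : R2 | u 0 ^ 2 + u 1 ^ 2 ≤ 2} → ∀ i, g t i u = g t' i u := by
  have hb := contDiff_bump
  have h0 : ∀ u : R2, u ∉ {u : R2 | u 0 ^ 2 + u 1 ^ 2 ≤ 2} → bump u = 0 := fun u hu =>
    bump_eq_zero (le_of_lt (by simpa using hu))
  simp only [branchFreeMoves, Set.mem_insert_iff, Set.mem_singleton_iff] at hP
  rcases hP with rfl | rfl | rfl | rfl
  · refine ⟨fun t => ![fun _ => 0, fun u => u 0 ^ 2 + u 1 ^ 2 + t * bump u],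
      fun t (i : Fin 2) => ?_, fun t => funext fun (i : Fin 2) => ?_,
      fun t t' u hu (i : Fin 2) => ?_⟩ <;> fin_cases i <;> simp [moveD1] <;>
      first | fun_prop | simp [h0 u hu]
  · refine ⟨fun t => ![fun _ => 0, fun u => u 0 ^ 2 - u 1 ^ 2 + t * bump u],
      fun t (i : Fin 2) => ?_, fun t => funext fun (i : Fin 2) => ?_,
      fun t t' u hu (i : Fin 2) => ?_⟩ <;> fin_cases i <;> simp [moveD2] <;>
      first | fun_prop | simp [h0 u hu]
  · refine ⟨fun t => ![fun u => u 1, fun u => - u 1, fun u => u 0 ^ 2 + t * bump u],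
      fun t (i : Fin 3) => ?_, fun t => funext fun (i : Fin 3) => ?_,
      fun t t' u hu (i : Fin 3) => ?_⟩ <;> fin_cases i <;> simp [moveT1] <;>
      first | fun_prop | simp [h0 u hu]
  · refine ⟨fun t => ![fun u => u 0, fun u => u 1, fun u => - u 0 - u 1, fun u => t * bump u],
      fun t (i : Fin 4) => ?_, fun t => funext fun (i : Fin 4) => ?_,
      fun t t' u hu (i : Fin 4) => ?_⟩ <;> fin_cases i <;> simp [moveT2] <;>
      first | fun_prop | simp [h0 u hu]

/-- The replacement lemma is symmetric in the two pictures, so the inverse move is covered by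
exchanging the parameters 1 and -1. -/
theorem Moved.hasCheckerboard_iff [T2Space S] {P : LocalPicture} (hP : P ∈ branchFreeMoves)
    {D D' : SurfaceKnotDiagram S} (h : Moved P D D') :
    D.HasCheckerboard ↔ D'.HasCheckerboard := by
  obtain ⟨φ, ψ, σ, ε, hφ, hψ, -, hD, hD', hout, hund⟩ := h
  obtain ⟨g, hg, hsheet, hdisc⟩ := exists_graphs_of_mem_branchFreeMoves hP
  rw [hsheet] at hD hD'
  have hrange : ∀ x, D'.proj x ∈ Set.range φ ↔ D.proj x ∈ Set.range φ := fun x => by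
    rw [hD.1.2, hD'.1.2]
  constructor
  · exact HasCheckerboard.of_graph_picture hφ hψ (hg 1) (hg (-1)) hD hD' (isCompact_disc 2)
      (hdisc _ _) hout hund
  · refine HasCheckerboard.of_graph_picture hφ hψ (hg (-1)) (hg 1) hD' hD (isCompact_disc 2)
      (hdisc _ _) (fun x hx => ?_) fun x y hx hy => ?_
    · rw [hrange] at hx
      exact (hout x hx).symm
    · rw [hrange] at hx hy
      exact (hund x y hx hy).symm

theorem Step.hasCheckerboard_iff [T2Space S] {D D' : SurfaceKnotDiagram S}
    (h : Step branchFreeMoves D D') : D.HasCheckerboard ↔ D'.HasCheckerboard := by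
  rcases h with ⟨g, -, hp, hu⟩ | ⟨Φ, hΦ, hp, hu⟩ | ⟨P, hP, h⟩
  · constructor
    · exact HasCheckerboard.of_homeomorph g.toHomeomorph hp hu
    · exact HasCheckerboard.of_homeomorph g.symm.toHomeomorph
        (fun x => by simp [hp]) (fun x y => by simp [hu])
  · obtain ⟨e, he⟩ := hΦ.2.2 1 ⟨zero_le_one, le_rfl⟩
    constructor
    · exact HasCheckerboard.of_diffeomorph e (fun x => by rw [hp, he]) hu
    · exact HasCheckerboard.of_diffeomorph e.symm (fun x => by simp [hp, he])
        fun x y => (hu x y).symm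
  · exact h.hasCheckerboard_iff hP

/-- Checkerboard colorability is an invariant of regular-equivalence. -/
theorem RegularEquivalent.hasCheckerboard_iff [T2Space S] {D D' : SurfaceKnotDiagram S}
    (h : D.RegularEquivalent D') : D.HasCheckerboard ↔ D'.HasCheckerboard := by
  induction h with
  | rel _ _ h => exact h.hasCheckerboard_iff
  | refl => rfl
  | symm _ _ _ ih => exact ih.symm
  | trans _ _ _ _ _ ih1 ih2 => exact ih1.trans ih2

end SurfaceKnotDiagram

/-! ## Sheared standard tori -/

/-- The point of the plane with argument `θ` and logarithmic radius `X`. -/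
def polar (θ X : ℝ) : R2 := !₂[Real.exp X * Real.cos θ, Real.exp X * Real.sin θ]

@[simp] theorem polar_zero (θ X : ℝ) : polar θ X 0 = Real.exp X * Real.cos θ := by simp [polar]

@[simp] theorem polar_one (θ X : ℝ) : polar θ X 1 = Real.exp X * Real.sin θ := by simp [polar]

theorem polar_sq (θ X : ℝ) : polar θ X 0 ^ 2 + polar θ X 1 ^ 2 = Real.exp X ^ 2 := by
  rw [polar_zero, polar_one]
  linear_combination Real.exp X ^ 2 * Real.sin_sq_add_cos_sq θ

theorem polar_ne_zero (θ X : ℝ) : polar θ X ≠ 0 := by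
  intro h
  have h1 := polar_sq θ X
  rw [h] at h1
  have := pow_pos (Real.exp_pos X) 2
  simp at h1
  linarith

theorem polar_eq_polar_iff {θ X θ' X' : ℝ} :
    polar θ X = polar θ' X' ↔ Circle.exp θ = Circle.exp θ' ∧ X = X' := by
  have hc : ∀ t : ℝ, ((Circle.exp t : Circle) : ℂ) = ⟨Real.cos t, Real.sin t⟩ := fun t => by
    apply Complex.ext <;> simp [Circle.coe_exp, Complex.exp_ofReal_mul_I_re,
      Complex.exp_ofReal_mul_I_im]
  constructor
  · intro h
    have h1 := polar_sq θ X
    rw [h, polar_sq] at h1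
    have h2 : Real.exp X' = Real.exp X :=
      (pow_left_inj₀ (Real.exp_pos _).le (Real.exp_pos _).le two_ne_zero).1 h1
    have hX : X = X' := (Real.exp_injective h2).symm
    subst hX
    have h3 := congrArg (fun p : R2 => p 0) h
    have h4 := congrArg (fun p : R2 => p 1) h
    simp only [polar_zero, polar_one, mul_eq_mul_left_iff, Real.exp_ne_zero, or_false] at h3 h4
    refine ⟨?_, rfl⟩
    ext
    rw [hc, hc, h3, h4]
  · rintro ⟨h, rfl⟩
    have h1 := congrArg (fun z : Circle => (z : ℂ)) h
    simp only [hc, Complex.mk.injEq] at h1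
    simp [polar, h1.1, h1.2]

/-! ### The torus folded over an annulus -/

/-- The horizontal position of a point of the standard torus. -/
def ringPoint (q : Circle × Circle) : R2 :=
  !₂[Real.exp (1 - (q.2 : ℂ).re) * (q.1 : ℂ).re, Real.exp (1 - (q.2 : ℂ).re) * (q.1 : ℂ).im]

theorem coe_circleExp_re (t : ℝ) : ((Circle.exp t : Circle) : ℂ).re = Real.cos t := by
  simp [Circle.coe_exp, Complex.exp_ofReal_mul_I_re]

theorem coe_circleExp_im (t : ℝ) : ((Circle.exp t : Circle) : ℂ).im = Real.sin t := by
  simp [Circle.coe_exp, Complex.exp_ofReal_mul_I_im]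

theorem ringPoint_torusCover (u : R2) :
    ringPoint (torusCover u) = polar (u 0) (1 - Real.cos (u 1)) := by
  simp only [ringPoint, torusCover, polar, coe_circleExp_re, coe_circleExp_im]

theorem ringPoint_ne_zero (q : Circle × Circle) : ringPoint q ≠ 0 := by
  obtain ⟨u, rfl⟩ := surjective_torusCover q
  rw [ringPoint_torusCover]
  exact polar_ne_zero _ _

/-- The logarithmic radius 1 - cos φ sees only the real part of the meridian coordinate: the
horizontal projection is the fold exchanging φ and -φ. -/
theorem ringPoint_eq_iff {q q' : Circle × Circle} :
    ringPoint q = ringPoint q' ↔ q.1 = q'.1 ∧ (q.2 : ℂ).re = (q'.2 : ℂ).re := by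
  obtain ⟨u, rfl⟩ := surjective_torusCover q
  obtain ⟨v, rfl⟩ := surjective_torusCover q'
  rw [ringPoint_torusCover, ringPoint_torusCover, polar_eq_polar_iff]
  simp [torusCover]

theorem circle_sq (z : Circle) : (z : ℂ).re ^ 2 + (z : ℂ).im ^ 2 = 1 := by
  have := Circle.normSq_coe z
  rw [Complex.normSq_apply] at this
  linarith

/-- Points of the circle with the same real part are equal or conjugate. -/
theorem circle_eq_or_im_eq_neg {z w : Circle} (h : (z : ℂ).re = (w : ℂ).re) :
    z = w ∨ (z : ℂ).im = -(w : ℂ).im := by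
  have h1 := circle_sq z
  have h2 := circle_sq w
  have h3 : ((z : ℂ).im - (w : ℂ).im) * ((z : ℂ).im + (w : ℂ).im) = 0 := by
    rw [h] at h1
    linear_combination h1 - h2
  rcases mul_eq_zero.1 h3 with h4 | h4
  · left
    ext
    exact Complex.ext h (sub_eq_zero.1 h4)
  · right
    linarith

/-- The projection of a sheared standard torus. -/
def ringProj (H : R2 → ℝ) (q : Circle × Circle) : R3 :=
  !₂[ringPoint q 0, ringPoint q 1, (q.2 : ℂ).im * H (ringPoint q)]

/-- The standard torus in 4-space, sheared in the third direction. -/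
def ringKnot (H : R2 → ℝ) (q : Circle × Circle) : R4 := (ringProj H q, (q.2 : ℂ).im)

/-- The lift of `ringPoint` to the plane. -/
def ringLift (u : R2) : R2 := polar (u 0) (1 - Real.cos (u 1))

theorem ringPoint_comp_torusCover : ringPoint ∘ torusCover = ringLift :=
  funext ringPoint_torusCover

theorem ringLift_ne_zero (u : R2) : ringLift u ≠ 0 := polar_ne_zero _ _

theorem contDiff_ringLift : ContDiff ℝ ∞ ringLift := by
  unfold ringLift polar
  rw [contDiff_euclidean]
  intro i
  fin_cases i <;> simp <;> fun_prop

/-- The differential of `ringLift`. -/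
theorem fderiv_ringLift (u v : R2) : fderiv ℝ ringLift u v =
    !₂[Real.exp (1 - Real.cos (u 1)) * (Real.sin (u 1) * v 1 * Real.cos (u 0)
        - v 0 * Real.sin (u 0)),
      Real.exp (1 - Real.cos (u 1)) * (Real.sin (u 1) * v 1 * Real.sin (u 0)
        + v 0 * Real.cos (u 0))] := by
  have h0 : HasFDerivAt (fun u : R2 => u 0) (EuclideanSpace.proj (0 : Fin 2) : R2 →L[ℝ] ℝ) u :=
    (EuclideanSpace.proj (0 : Fin 2) : R2 →L[ℝ] ℝ).hasFDerivAt
  have h1 : HasFDerivAt (fun u : R2 => u 1) (EuclideanSpace.proj (1 : Fin 2) : R2 →L[ℝ] ℝ) u :=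
    (EuclideanSpace.proj (1 : Fin 2) : R2 →L[ℝ] ℝ).hasFDerivAt
  have he := (h1.cos.const_sub 1).exp
  have h := (contDiff_ringLift.differentiable (by simp) u).hasFDerivAt
  have hc0 := (EuclideanSpace.proj (0 : Fin 2) : R2 →L[ℝ] ℝ).hasFDerivAt.comp u h
  have hc1 := (EuclideanSpace.proj (1 : Fin 2) : R2 →L[ℝ] ℝ).hasFDerivAt.comp u h
  have e0 : ((EuclideanSpace.proj (0 : Fin 2) : R2 →L[ℝ] ℝ) ∘ ringLift) =
      fun u : R2 => Real.exp (1 - Real.cos (u 1)) * Real.cos (u 0) := by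
    ext u; simp [ringLift]
  have e1 : ((EuclideanSpace.proj (1 : Fin 2) : R2 →L[ℝ] ℝ) ∘ ringLift) =
      fun u : R2 => Real.exp (1 - Real.cos (u 1)) * Real.sin (u 0) := by
    ext u; simp [ringLift]
  rw [e0] at hc0
  rw [e1] at hc1
  have r0 := congrArg (fun L : R2 →L[ℝ] ℝ => L v) (hc0.unique (he.mul h0.cos))
  have r1 := congrArg (fun L : R2 →L[ℝ] ℝ => L v) (hc1.unique (he.mul h0.sin))
  simp at r0 r1
  ext i
  fin_cases i
  · simp [r0]; ring
  · simp [r1]; ring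

/-- Rotating the image back by the angle `u 0` separates the angular and the radial component. -/
theorem fderiv_ringLift_eq_zero {u v : R2} (h : fderiv ℝ ringLift u v = 0) :
    v 0 = 0 ∧ Real.sin (u 1) * v 1 = 0 := by
  rw [fderiv_ringLift] at h
  have h0 := congrArg (fun p : R2 => p 0) h
  have h1 := congrArg (fun p : R2 => p 1) h
  simp at h0 h1
  have hs := Real.sin_sq_add_cos_sq (u 0)
  constructor
  · linear_combination (-Real.sin (u 0)) * h0 + Real.cos (u 0) * h1 - v 0 * hs
  · linear_combination Real.cos (u 0) * h0 + Real.sin (u 0) * h1 - Real.sin (u 1) * v 1 * hs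

theorem surjective_fderiv_ringLift {u : R2} (hu : Real.sin (u 1) ≠ 0) :
    Function.Surjective (fderiv ℝ ringLift u) := by
  have hi : Function.Injective (fderiv ℝ ringLift u : R2 →ₗ[ℝ] R2) := by
    rw [← LinearMap.ker_eq_bot, LinearMap.ker_eq_bot']
    intro v hv
    obtain ⟨h0, h1⟩ := fderiv_ringLift_eq_zero hv
    have h2 := (mul_eq_zero.1 h1).resolve_left hu
    ext i
    fin_cases i
    · exact h0
    · exact h2
  exact LinearMap.injective_iff_surjective.1 hi

section Shear

variable {H : R2 → ℝ}

theorem contDiff_comp_ringLift (hH : ∀ p ≠ 0, ContDiffAt ℝ ∞ H p) :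
    ContDiff ℝ ∞ (H ∘ ringLift) := by
  rw [contDiff_iff_contDiffAt]
  intro u
  exact (hH _ (ringLift_ne_zero u)).comp u contDiff_ringLift.contDiffAt

theorem ringProj_torusCover (u : R2) : ringProj H (torusCover u) =
    !₂[ringLift u 0, ringLift u 1, Real.sin (u 1) * H (ringLift u)] := by
  rw [ringProj, ringPoint_torusCover]
  simp only [torusCover, coe_circleExp_im, ringLift]

theorem contDiff_ringProj (hH : ∀ p ≠ 0, ContDiffAt ℝ ∞ H p) :
    ContDiff ℝ ∞ (ringProj H ∘ torusCover) := by
  have h1 := contDiff_comp_ringLift hH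
  have h2 := contDiff_ringLift
  have : ringProj H ∘ torusCover =
      fun u => !₂[ringLift u 0, ringLift u 1, Real.sin (u 1) * (H ∘ ringLift) u] :=
    funext ringProj_torusCover
  have h3 := contDiff_euclidean.1 h2
  rw [this, contDiff_euclidean]
  intro i
  fin_cases i
  · exact h3 0
  · exact h3 1
  · exact ContDiff.mul (by fun_prop) h1

theorem contMDiff_ringProj (hH : ∀ p ≠ 0, ContDiffAt ℝ ∞ H p) :
    ContMDiff (𝓡 2) 𝓘(ℝ, R3) ∞ (ringProj H) := contMDiff_torus_iff.2 (contDiff_ringProj hH)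

theorem diffAt_ringProj (hH : ∀ p ≠ 0, ContDiffAt ℝ ∞ H p) (u v : R2) :
    diffAt (ringProj H) (torusCover u) v = !₂[fderiv ℝ ringLift u v 0, fderiv ℝ ringLift u v 1,
      Real.cos (u 1) * v 1 * H (ringLift u) +
        Real.sin (u 1) * fderiv ℝ H (ringLift u) (fderiv ℝ ringLift u v)] := by
  unfold diffAt
  rw [mfderiv_torus (contMDiff_ringProj hH)]
  have h := ((contDiff_ringProj hH).differentiable (by simp) u).hasFDerivAt
  have hL := (contDiff_ringLift.differentiable (by simp) u).hasFDerivAt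
  have hHL := ((hH _ (ringLift_ne_zero u)).differentiableAt (by simp)).hasFDerivAt.comp u hL
  have h1 : HasFDerivAt (fun u : R2 => u 1) (EuclideanSpace.proj (1 : Fin 2) : R2 →L[ℝ] ℝ) u :=
    (EuclideanSpace.proj (1 : Fin 2) : R2 →L[ℝ] ℝ).hasFDerivAt
  have hc : ∀ i : Fin 3, HasFDerivAt (fun u => ringProj H (torusCover u) i)
      ((EuclideanSpace.proj i : R3 →L[ℝ] ℝ).comp (fderiv ℝ (ringProj H ∘ torusCover) u)) u :=
    fun i => (EuclideanSpace.proj i : R3 →L[ℝ] ℝ).hasFDerivAt.comp u h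
  have hl : ∀ i : Fin 2, HasFDerivAt (fun u => ringLift u i)
      ((EuclideanSpace.proj i : R2 →L[ℝ] ℝ).comp (fderiv ℝ ringLift u)) u :=
    fun i => (EuclideanSpace.proj i : R2 →L[ℝ] ℝ).hasFDerivAt.comp u hL
  have r0 := congrArg (fun L : R2 →L[ℝ] ℝ => L v) ((hc 0).unique
    ((hl 0).congr_of_eventuallyEq (.of_forall fun u => by simp [ringProj_torusCover])))
  have r1 := congrArg (fun L : R2 →L[ℝ] ℝ => L v) ((hc 1).unique
    ((hl 1).congr_of_eventuallyEq (.of_forall fun u => by simp [ringProj_torusCover])))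
  have r2 := congrArg (fun L : R2 →L[ℝ] ℝ => L v) ((hc 2).unique
    ((h1.sin.mul hHL).congr_of_eventuallyEq (.of_forall fun u => by simp [ringProj_torusCover])))
  simp at r0 r1 r2
  ext i
  fin_cases i
  · simp [r0]
  · simp [r1]
  · simp [r2]; ring

theorem diffAt_ringProj_eq_zero (hH : ∀ p ≠ 0, ContDiffAt ℝ ∞ H p) {u v : R2}
    (h : diffAt (ringProj H) (torusCover u) v = 0) :
    v 0 = 0 ∧ Real.sin (u 1) * v 1 = 0 ∧ Real.cos (u 1) * v 1 * H (ringLift u) = 0 := by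
  rw [diffAt_ringProj hH] at h
  have h0 := congrArg (fun p : R3 => p 0) h
  have h1 := congrArg (fun p : R3 => p 1) h
  have h2 := congrArg (fun p : R3 => p 2) h
  simp only [Fin.isValue, Matrix.cons_val, PiLp.zero_apply] at h0 h1 h2
  have h3 : fderiv ℝ ringLift u v = 0 := by
    ext i
    fin_cases i
    · exact h0
    · exact h1
  obtain ⟨h4, h5⟩ := fderiv_ringLift_eq_zero h3
  rw [h3, map_zero, mul_zero, add_zero] at h2
  exact ⟨h4, h5, h2⟩

/-- Away from the fold circles the horizontal part is already immersive. On them sin φ = 0, and the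
remaining meridian direction is seen by the third coordinate, whose derivative there is cos φ · H.
-/
theorem injective_diffAt_ringProj (hH : ∀ p ≠ 0, ContDiffAt ℝ ∞ H p) {u : R2}
    (h : Real.sin (u 1) ≠ 0 ∨ H (ringLift u) ≠ 0) :
    Function.Injective (diffAt (ringProj H) (torusCover u)) := by
  have hi : LinearMap.ker (diffAt (ringProj H) (torusCover u) : R2 →ₗ[ℝ] R3) = ⊥ := by
    rw [LinearMap.ker_eq_bot']
    intro v hv
    obtain ⟨h0, h1, h2⟩ := diffAt_ringProj_eq_zero hH hv
    have hv1 : v 1 = 0 := by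
      rcases h with h | h
      · exact (mul_eq_zero.1 h1).resolve_left h
      · have h3 := (mul_eq_zero.1 h2).resolve_right h
        have hs := Real.sin_sq_add_cos_sq (u 1)
        linear_combination Real.sin (u 1) * h1 + Real.cos (u 1) * h3 - v 1 * hs
    ext i
    fin_cases i
    · exact h0
    · exact hv1
  exact LinearMap.ker_eq_bot.1 hi

theorem not_injective_diffAt_ringProj (hH : ∀ p ≠ 0, ContDiffAt ℝ ∞ H p) {u : R2}
    (h : ¬ Function.Injective (diffAt (ringProj H) (torusCover u))) :
    Real.sin (u 1) = 0 ∧ H (ringLift u) = 0 := by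
  by_contra h'
  exact h (injective_diffAt_ringProj hH (by tauto))

end Shear

/-! ### Embeddedness and genericity -/

/-- The conditions under which a sheared standard torus has a generic projection. -/
structure IsRingHeight (H : R2 → ℝ) : Prop where
  smooth : ∀ p ≠ 0, ContDiffAt ℝ ∞ H p
  transverse : ∀ θ X, 0 < X → X < 2 → H (polar θ X) = 0 → fderiv ℝ H (polar θ X) ≠ 0
  outer : ∀ θ, H (polar θ 2) ≠ 0
  inner : ∀ θ, H (polar θ 0) = 0 → IsWhitneyUmbrellaAt (ringProj H) (torusCover !₂[θ, 0])

theorem injective_ringKnot (H : R2 → ℝ) : Function.Injective (ringKnot H) := by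
  intro q q' h
  have h1 : ringProj H q = ringProj H q' := congrArg Prod.fst h
  have h2 : (q.2 : ℂ).im = (q'.2 : ℂ).im := congrArg Prod.snd h
  have h3 : ringPoint q = ringPoint q' := by
    ext i
    fin_cases i
    · simpa [ringProj] using congrArg (fun p : R3 => p 0) h1
    · simpa [ringProj] using congrArg (fun p : R3 => p 1) h1
  obtain ⟨h4, h5⟩ := ringPoint_eq_iff.1 h3
  exact Prod.ext h4 (Circle.ext (Complex.ext h5 h2))

theorem contMDiff_ringKnot {H : R2 → ℝ} (hH : ∀ p ≠ 0, ContDiffAt ℝ ∞ H p) :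
    ContMDiff (𝓡 2) 𝓘(ℝ, R4) ∞ (ringKnot H) := by
  rw [contMDiff_torus_iff]
  have : ringKnot H ∘ torusCover = fun u => ((ringProj H ∘ torusCover) u, Real.sin (u 1)) := by
    ext1 u
    simp [ringKnot, torusCover]
  rw [this]
  exact (contDiff_ringProj hH).prodMk (by fun_prop)

/-- A kernel vector of the projection has no longitude component. Its meridian component is killed
by sin φ through the radius and by cos φ through the fourth coordinate, which are never both zero.
-/
theorem immersive_ringKnot {H : R2 → ℝ} (hH : ∀ p ≠ 0, ContDiffAt ℝ ∞ H p) (q : Circle × Circle) :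
    Function.Injective (mfderiv (𝓡 2) 𝓘(ℝ, R4) (ringKnot H) q) := by
  obtain ⟨u, rfl⟩ := surjective_torusCover q
  have hL := mfderiv_torus (contMDiff_ringKnot hH) u
  have h1 : HasFDerivAt (fun u : R2 => u 1) (EuclideanSpace.proj (1 : Fin 2) : R2 →L[ℝ] ℝ) u :=
    (EuclideanSpace.proj (1 : Fin 2) : R2 →L[ℝ] ℝ).hasFDerivAt
  have h2 := (((contDiff_ringProj hH).differentiable (by simp) u).hasFDerivAt.prodMk h1.sin)
  have h3 : ringKnot H ∘ torusCover = fun u => ((ringProj H ∘ torusCover) u, Real.sin (u 1)) := by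
    ext1 u
    simp [ringKnot, torusCover]
  rw [h3, h2.fderiv] at hL
  have hd : fderiv ℝ (ringProj H ∘ torusCover) u = diffAt (ringProj H) (torusCover u) :=
    (mfderiv_torus (contMDiff_ringProj hH) u).symm
  have hi : LinearMap.ker (((fderiv ℝ (ringProj H ∘ torusCover) u).prod
      (Real.cos (u 1) • (EuclideanSpace.proj (1 : Fin 2) : R2 →L[ℝ] ℝ)) : R2 →L[ℝ] R4) :
      R2 →ₗ[ℝ] R4) = ⊥ := by
    rw [LinearMap.ker_eq_bot']
    intro v hv
    have hv1 := congrArg Prod.fst hv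
    have hv2 := congrArg Prod.snd hv
    simp [hd] at hv1 hv2
    obtain ⟨h0, h1, -⟩ := diffAt_ringProj_eq_zero hH hv1
    have hs := Real.sin_sq_add_cos_sq (u 1)
    have h4 : Real.cos (u 1) * v 1 = 0 := by
      rcases hv2 with h | h <;> simp [h]
    ext i
    fin_cases i
    · exact h0
    · change v 1 = 0
      linear_combination Real.sin (u 1) * h1 + Real.cos (u 1) * h4 - v 1 * hs
  change Function.Injective (mfderiv (𝓡 2) 𝓘(ℝ, R4) (ringKnot H) (torusCover u) : R2 →L[ℝ] R4)
  rw [hL]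
  exact LinearMap.ker_eq_bot.1 hi

theorem ringProj_eq_iff {H : R2 → ℝ} {q q' : Circle × Circle} :
    ringProj H q = ringProj H q' ↔ q.1 = q'.1 ∧ (q.2 : ℂ).re = (q'.2 : ℂ).re ∧
      (q.2 : ℂ).im * H (ringPoint q) = (q'.2 : ℂ).im * H (ringPoint q') := by
  rw [← and_assoc, ← ringPoint_eq_iff]
  constructor
  · intro h
    refine ⟨?_, by simpa [ringProj] using congrArg (fun p : R3 => p 2) h⟩
    ext i
    fin_cases i
    · simpa [ringProj] using congrArg (fun p : R3 => p 0) h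
    · simpa [ringProj] using congrArg (fun p : R3 => p 1) h
  · rintro ⟨h1, h2⟩
    rw [h1] at h2
    simp only [ringProj, h1, h2]

/-- The reflection of the plane that exchanges the two points of a double point. -/
def flipPoint (u : R2) : R2 := !₂[u 0, -u 1]

theorem ringLift_flip (u : R2) : ringLift (flipPoint u) = ringLift u := by simp [ringLift, flipPoint]

theorem ringProj_eq_torusCover {H : R2 → ℝ} {q : Circle × Circle} {u : R2}
    (h : ringProj H q = ringProj H (torusCover u)) :
    q = torusCover u ∨ (q = torusCover (flipPoint u) ∧ Real.sin (u 1) * H (ringLift u) = 0) := by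
  obtain ⟨h1, h2, h3⟩ := ringProj_eq_iff.1 h
  have hp : ringPoint q = ringLift u := by
    rw [ringPoint_eq_iff.2 ⟨h1, h2⟩, ringPoint_torusCover]; rfl
  rcases circle_eq_or_im_eq_neg h2 with h4 | h4
  · exact .inl (Prod.ext h1 h4)
  · right
    rw [hp, h4, ringPoint_torusCover] at h3
    have him : (((torusCover u).2 : Circle) : ℂ).im = Real.sin (u 1) := coe_circleExp_im _
    rw [him] at h3 h4
    refine ⟨Prod.ext (by rw [h1]; simp [torusCover, flipPoint]) (Circle.ext (Complex.ext ?_ ?_)), ?_⟩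
    · rw [h2]
      simp only [torusCover, coe_circleExp_re]
      simp [flipPoint]
    · rw [h4]
      simp only [torusCover, coe_circleExp_im]
      simp [flipPoint]
    · change -Real.sin (u 1) * H (ringLift u) = Real.sin (u 1) * H (ringLift u) at h3
      linarith

theorem ringProj_flip {H : R2 → ℝ} {u : R2} (h : H (ringLift u) = 0) :
    ringProj H (torusCover (flipPoint u)) = ringProj H (torusCover u) := by
  simp [ringProj_torusCover, ringLift_flip, h]

theorem torusCover_flip_ne {u : R2} (h : Real.sin (u 1) ≠ 0) :
    torusCover (flipPoint u) ≠ torusCover u := by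
  intro h1
  have h2 := congrArg (fun q : Circle × Circle => (q.2 : ℂ).im) h1
  simp only [torusCover, flipPoint, coe_circleExp_im] at h2
  simp at h2
  apply h
  linarith

/-- A fiber has at most two points, exchanged by φ ↦ -φ. At a double point the two tangent planes
are graphs over the plane with slopes + sin φ · dH and - sin φ · dH, so they are transverse exactly
because dH ≠ 0. Failure of immersivity requires sin φ = 0 and H = 0. This is excluded on the outer
circle and is an umbrella on the inner one. -/
theorem IsRingHeight.isGeneric {H : R2 → ℝ} (hH : IsRingHeight H) : IsGeneric (ringProj H) := by
  refine ⟨fun q hq => ?_, fun p hp => ?_⟩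
  · obtain ⟨u, rfl⟩ := surjective_torusCover q
    obtain ⟨h1, h2⟩ := not_injective_diffAt_ringProj hH.smooth hq
    have h3 : Real.cos (u 1) = 1 := by
      rcases Real.sin_eq_zero_iff_cos_eq.1 h1 with h | h
      · exact h
      · exfalso
        apply hH.outer (u 0)
        rw [ringLift, h] at h2
        norm_num at h2
        exact h2
    have h4 : torusCover u = torusCover !₂[u 0, 0] := by
      refine Prod.ext (by simp [torusCover]) (Circle.ext (Complex.ext ?_ ?_))
      · simp [torusCover, h3]
      · simp [torusCover, h1]
    rw [h4]
    apply hH.inner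
    simpa [ringLift, h3] using h2
  · by_cases hne : ∃ q, ringProj H q = p
    swap
    · have : ringProj H ⁻¹' {p} = ∅ := by
        ext q
        simp only [Set.mem_preimage, Set.mem_singleton_iff, Set.mem_empty_iff_false, iff_false]
        exact fun h => hne ⟨q, h⟩
      rw [this]
      have h5 : (⨅ x ∈ (∅ : Set (Circle × Circle)),
        LinearMap.range (diffAt (ringProj H) x : R2 →ₗ[ℝ] R3)) = ⊤ := by simp
      rw [h5, finrank_top]
      simp
    obtain ⟨q, rfl⟩ := hne
    obtain ⟨u, rfl⟩ := surjective_torusCover q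
    by_cases h0 : H (ringLift u) = 0
    · have hs : Real.sin (u 1) ≠ 0 := by
        intro hs
        have hinj := hp _ rfl
        have hz : diffAt (ringProj H) (torusCover u) (EuclideanSpace.single 1 1) = 0 := by
          rw [diffAt_ringProj hH.smooth, h0, hs, fderiv_ringLift, hs]
          ext i
          fin_cases i <;> simp
        have := hinj (hz.trans (map_zero _).symm)
        simpa using congrArg (fun p : R2 => p 1) this
      have hset : ringProj H ⁻¹' {ringProj H (torusCover u)} =
          {torusCover u, torusCover (flipPoint u)} := by
        ext q
        simp only [Set.mem_preimage, Set.mem_singleton_iff, Set.mem_insert_iff]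
        constructor
        · intro h
          exact (ringProj_eq_torusCover h).imp_right And.left
        · rintro (rfl | rfl)
          · rfl
          · exact ringProj_flip h0
      have hdH : fderiv ℝ H (ringLift u) ≠ 0 := by
        refine hH.transverse _ _ ?_ ?_ h0
        · have h1 := Real.cos_le_one (u 1)
          rcases h1.lt_or_eq with h | h
          · linarith
          · exact absurd (Real.sin_eq_zero_iff_cos_eq.2 (.inl h)) hs
        · have h1 := Real.neg_one_le_cos (u 1)
          rcases h1.lt_or_eq with h | h
          · linarith
          · exact absurd (Real.sin_eq_zero_iff_cos_eq.2 (.inr h.symm)) hs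
      set A := LinearMap.range (diffAt (ringProj H) (torusCover u) : R2 →ₗ[ℝ] R3) with hA
      set B := LinearMap.range (diffAt (ringProj H) (torusCover (flipPoint u)) : R2 →ₗ[ℝ] R3) with hB
      have hA2 : Module.finrank ℝ A = 2 := by
        rw [hA, LinearMap.finrank_range_of_inj (hp _ rfl)]; simp
      have hB2 : Module.finrank ℝ B = 2 := by
        rw [hB, LinearMap.finrank_range_of_inj (hp _ (ringProj_flip h0))]; simp
      -- Vectors of both planes with the same horizontal part `w` have third coordinates of opposite
      -- sign. If one plane contained the other, dH would vanish on every `w`.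
      have hBA : ¬ B ≤ A := by
        intro hle
        apply hdH
        ext w
        obtain ⟨v, rfl⟩ := surjective_fderiv_ringLift (u := flipPoint u) (by simpa [flipPoint] using hs) w
        obtain ⟨v', hv'⟩ := hle ⟨v, rfl⟩
        have h1 : diffAt (ringProj H) (torusCover u) v' =
          diffAt (ringProj H) (torusCover (flipPoint u)) v := hv'
        rw [diffAt_ringProj hH.smooth, diffAt_ringProj hH.smooth, ringLift_flip, h0] at h1
        have e0 := congrArg (fun p : R3 => p 0) h1
        have e1 := congrArg (fun p : R3 => p 1) h1
        have e2 := congrArg (fun p : R3 => p 2) h1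
        simp only [Fin.isValue, Matrix.cons_val] at e0 e1 e2
        have e3 : fderiv ℝ ringLift u v' = fderiv ℝ ringLift (flipPoint u) v := by
          ext i
          fin_cases i
          · exact e0
          · exact e1
        rw [e3] at e2
        have e4 : Real.sin (flipPoint u 1) = -Real.sin (u 1) := by simp [flipPoint]
        rw [e4] at e2
        have e5 : Real.sin (u 1) * fderiv ℝ H (ringLift u) (fderiv ℝ ringLift (flipPoint u) v) = 0 := by
          linarith
        simpa using (mul_eq_zero.1 e5).resolve_left hs
      have hsup : Module.finrank ℝ (A ⊔ B : Submodule ℝ R3) = 3 := by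
        have h1 : A < A ⊔ B := left_lt_sup.2 hBA
        have h2 := Submodule.finrank_lt_finrank_of_lt h1
        have h3 := Submodule.finrank_le (A ⊔ B)
        have h5 : Module.finrank ℝ R3 = 3 := by simp
        omega
      have h6 := Submodule.finrank_sup_add_finrank_inf_eq A B
      have h7 : (⨅ x ∈ ({torusCover u, torusCover (flipPoint u)} : Set (Circle × Circle)),
        LinearMap.range (diffAt (ringProj H) x : R2 →ₗ[ℝ] R3)) = A ⊓ B := by
        rw [iInf_pair]
      rw [hset, h7, Set.ncard_pair (torusCover_flip_ne hs).symm]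
      exact ⟨by simp, by omega⟩
    · have hset : ringProj H ⁻¹' {ringProj H (torusCover u)} = {torusCover u} := by
        ext q
        simp only [Set.mem_preimage, Set.mem_singleton_iff]
        refine ⟨fun h => ?_, fun h => by rw [h]⟩
        rcases ringProj_eq_torusCover h with h | ⟨rfl, h'⟩
        · exact h
        · have hs := (mul_eq_zero.1 h').resolve_right h0
          refine Prod.ext (by simp [torusCover, flipPoint]) (Circle.ext (Complex.ext ?_ ?_))
          · simp only [torusCover, coe_circleExp_re]
            simp [flipPoint]
          · simp only [torusCover, coe_circleExp_im]
            simp [flipPoint, hs]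
      have h7 : (⨅ x ∈ ({torusCover u} : Set (Circle × Circle)),
        LinearMap.range (diffAt (ringProj H) x : R2 →ₗ[ℝ] R3)) =
          LinearMap.range (diffAt (ringProj H) (torusCover u) : R2 →ₗ[ℝ] R3) := by
        rw [iInf_singleton]
      rw [hset, h7, LinearMap.finrank_range_of_inj (hp _ rfl)]
      simp

/-- The diagram of a sheared standard torus. -/
def ringDiagram (H : R2 → ℝ) (hH : IsRingHeight H) : SurfaceKnotDiagram (Circle × Circle) where
  knot := ringKnot H
  smooth := contMDiff_ringKnot hH.smooth
  injective := injective_ringKnot H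
  immersive := immersive_ringKnot hH.smooth
  generic := hH.isGeneric

/-! ## Polar coordinates -/

/-- Logarithmic polar coordinates as a map of the plane. -/
def polarMap (u : R2) : R2 := polar (u 0) (u 1)

theorem contDiff_polarMap : ContDiff ℝ ∞ polarMap := by
  unfold polarMap polar
  rw [contDiff_euclidean]
  intro i
  fin_cases i <;> simp <;> fun_prop

/-- A linear map of a finite-dimensional space with trivial kernel is bijective. -/
theorem bijective_of_ker {E : Type*} [NormedAddCommGroup E] [NormedSpace ℝ E]
    [FiniteDimensional ℝ E] {L : E →L[ℝ] E} (h : ∀ v, L v = 0 → v = 0) : Function.Bijective L := by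
  have hi : Function.Injective (L : E →ₗ[ℝ] E) :=
    LinearMap.ker_eq_bot.1 (LinearMap.ker_eq_bot'.2 h)
  exact ⟨hi, LinearMap.injective_iff_surjective.1 hi⟩

theorem hasFDerivAt_coord {ι : Type*} [Fintype ι] (i : ι) (u : EuclideanSpace ℝ ι) :
    HasFDerivAt (fun u : EuclideanSpace ℝ ι => u i)
      (EuclideanSpace.proj i : EuclideanSpace ℝ ι →L[ℝ] ℝ) u :=
  (EuclideanSpace.proj i : EuclideanSpace ℝ ι →L[ℝ] ℝ).hasFDerivAt

theorem coordProj_apply {ι : Type*} (i : ι) (v : EuclideanSpace ℝ ι) :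
    (EuclideanSpace.proj i : EuclideanSpace ℝ ι →L[ℝ] ℝ) v = v i := rfl

/-- The coordinates of a derivative are the derivatives of the coordinates. -/
theorem fderiv_coord {ι E : Type*} [Fintype ι] [NormedAddCommGroup E] [NormedSpace ℝ E]
    {f : E → EuclideanSpace ℝ ι} {u : E} (hf : DifferentiableAt ℝ f u) (i : ι) {L : E →L[ℝ] ℝ}
    (h : HasFDerivAt (fun x => f x i) L u) (v : E) : fderiv ℝ f u v i = L v := by
  have := ((hasFDerivAt_coord i (f u)).comp u hf.hasFDerivAt).unique h
  rw [← this]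
  rfl

theorem bijective_fderiv_polarMap (u : R2) : Function.Bijective (fderiv ℝ polarMap u) := by
  refine bijective_of_ker fun v hv => ?_
  have hd : DifferentiableAt ℝ polarMap u := contDiff_polarMap.differentiable (by simp) u
  have h0 := hasFDerivAt_coord (0 : Fin 2) u
  have h1 := hasFDerivAt_coord (1 : Fin 2) u
  have e0 := fderiv_coord hd 0 ((h1.exp.mul h0.cos).congr_of_eventuallyEq
    (.of_forall fun u => by simp [polarMap])) v
  have e1 := fderiv_coord hd 1 ((h1.exp.mul h0.sin).congr_of_eventuallyEq
    (.of_forall fun u => by simp [polarMap])) v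
  rw [hv] at e0 e1
  simp only [PiLp.zero_apply, add_apply, smul_apply, smul_eq_mul,
    coordProj_apply, neg_mul] at e0 e1
  have hs := Real.sin_sq_add_cos_sq (u 0)
  have hE := Real.exp_ne_zero (u 1)
  have k0 : Real.exp (u 1) * v 0 = 0 := by
    linear_combination Real.sin (u 0) * e0 - Real.cos (u 0) * e1 -
      Real.exp (u 1) * v 0 * hs
  have k1 : Real.exp (u 1) * v 1 = 0 := by
    linear_combination -Real.cos (u 0) * e0 - Real.sin (u 0) * e1 -
      Real.exp (u 1) * v 1 * hs
  ext i
  fin_cases i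
  · exact (mul_eq_zero.1 k0).resolve_left hE
  · exact (mul_eq_zero.1 k1).resolve_left hE

/-! ## Properties of sheared standard tori -/

section RingDiagram

variable {H : R2 → ℝ} (hH : IsRingHeight H)

theorem ringDiagram_proj : (ringDiagram H hH).proj = ringProj H := rfl

theorem ringDiagram_height (q : Circle × Circle) :
    (ringDiagram H hH).height q = (q.2 : ℂ).im := rfl

theorem ringDiagram_isRegular (h0 : ∀ θ, H (polar θ 0) ≠ 0) : (ringDiagram H hH).IsRegular := by
  intro q hq
  obtain ⟨u, rfl⟩ := surjective_torusCover q
  obtain ⟨h1, h2⟩ := not_injective_diffAt_ringProj hH.smooth hq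
  rw [ringLift] at h2
  rcases Real.sin_eq_zero_iff_cos_eq.1 h1 with h | h
  · rw [h, sub_self] at h2
    exact h0 _ h2
  · rw [h] at h2
    norm_num at h2
    exact hH.outer _ h2

/-- The double points of a sheared standard torus. -/
theorem ringDiagram_under_iff {u : R2} {q : Circle × Circle} :
    (ringDiagram H hH).Under (torusCover u) q ↔
      q = torusCover (flipPoint u) ∧ Real.sin (u 1) < 0 ∧ H (ringLift u) = 0 := by
  constructor
  · rintro ⟨h1, h2⟩
    rcases ringProj_eq_torusCover (H := H) h1.symm with rfl | ⟨rfl, h3⟩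
    · exact absurd h2 (lt_irrefl _)
    · rw [ringDiagram_height, ringDiagram_height] at h2
      simp only [torusCover, coe_circleExp_im] at h2
      have h4 : Real.sin (u 1) < 0 := by
        have : Real.sin (flipPoint u 1) = -Real.sin (u 1) := by simp [flipPoint]
        linarith
      exact ⟨rfl, h4, (mul_eq_zero.1 h3).resolve_left h4.ne⟩
  · rintro ⟨rfl, h1, h2⟩
    refine ⟨(ringProj_flip h2).symm, ?_⟩
    rw [ringDiagram_height, ringDiagram_height]
    simp only [torusCover, coe_circleExp_im]
    have : Real.sin (flipPoint u 1) = -Real.sin (u 1) := by simp [flipPoint]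
    linarith

/-- The formula of the knot is evaluated with the meridian coordinate `w` in the whole plane instead
of the circle. The logarithmic radius 1 - Re w, the angle and Im w are then independent coordinates,
and the shear by `H` does not affect injectivity. -/
theorem ringDiagram_boundsSolidTorus : (ringDiagram H hH).BoundsSolidTorus := by
  let ell : ℝ × ℂ → R2 := fun p => !₂[2 * Real.pi * p.1, 1 - p.2.re]
  let P : ℝ × ℂ → R2 := polarMap ∘ ell
  let G : ℝ × ℂ → R4 := fun p => (!₂[P p 0, P p 1, p.2.im * H (P p)], p.2.im)
  have hre : ∀ p, HasFDerivAt (fun p : ℝ × ℂ => p.2.re)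
      (Complex.reCLM.comp (ContinuousLinearMap.snd ℝ ℝ ℂ)) p := fun p =>
    (Complex.reCLM.comp (ContinuousLinearMap.snd ℝ ℝ ℂ)).hasFDerivAt
  have him : ∀ p, HasFDerivAt (fun p : ℝ × ℂ => p.2.im)
      (Complex.imCLM.comp (ContinuousLinearMap.snd ℝ ℝ ℂ)) p := fun p =>
    (Complex.imCLM.comp (ContinuousLinearMap.snd ℝ ℝ ℂ)).hasFDerivAt
  have hrec : ContDiff ℝ ∞ (fun p : ℝ × ℂ => p.2.re) :=
    (Complex.reCLM.comp (ContinuousLinearMap.snd ℝ ℝ ℂ)).contDiff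
  have himc : ContDiff ℝ ∞ (fun p : ℝ × ℂ => p.2.im) :=
    (Complex.imCLM.comp (ContinuousLinearMap.snd ℝ ℝ ℂ)).contDiff
  have hell : ContDiff ℝ ∞ ell := by
    rw [contDiff_euclidean]
    intro i
    fin_cases i <;> simp [ell] <;> fun_prop
  have hP : ContDiff ℝ ∞ P := contDiff_polarMap.comp hell
  have hP0 : ∀ p, P p ≠ 0 := fun p => polar_ne_zero _ _
  have hHP : ContDiff ℝ ∞ (fun p => H (P p)) := by
    rw [contDiff_iff_contDiffAt]
    exact fun p => (hH.smooth _ (hP0 p)).comp p hP.contDiffAt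
  have hPc := contDiff_euclidean.1 hP
  have hG1 : ContDiff ℝ ∞ (fun p => (G p).1) := by
    rw [contDiff_euclidean]
    intro i
    fin_cases i
    · exact hPc 0
    · exact hPc 1
    · exact himc.mul hHP
  have hG : ContDiff ℝ ∞ G := hG1.prodMk himc
  have hPp : ∀ t w, P (t, w) = polar (2 * Real.pi * t) (1 - w.re) := fun t w => by
    simp [P, ell, polarMap]
  refine ⟨G, hG, fun t w => ?_, fun p _ => ?_, fun p q _ _ hpq => ?_, ?_⟩
  · have : P (t + 1, w) = P (t, w) := by
      rw [hPp, hPp, polar_eq_polar_iff, Circle.exp_eq_exp]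
      exact ⟨⟨1, by push_cast; ring⟩, rfl⟩
    simp only [G, this]
  · have hker : ∀ v, fderiv ℝ G p v = 0 → v = 0 := by
      intro v hv
      have hGd := (hG.differentiable (by simp) p).hasFDerivAt
      have h1 := congrArg (fun L : ℝ × ℂ →L[ℝ] ℝ => L v)
        ((((ContinuousLinearMap.snd ℝ R3 ℝ).hasFDerivAt).comp p hGd).unique (him p))
      have hfst : ∀ i : Fin 3, HasFDerivAt (fun p => (G p).1 i)
          ((EuclideanSpace.proj i : R3 →L[ℝ] ℝ).comp
            ((ContinuousLinearMap.fst ℝ R3 ℝ).comp (fderiv ℝ G p))) p := fun i =>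
        (EuclideanSpace.proj i : R3 →L[ℝ] ℝ).hasFDerivAt.comp p
          ((ContinuousLinearMap.fst ℝ R3 ℝ).hasFDerivAt.comp p hGd)
      have hPd : DifferentiableAt ℝ P p := hP.differentiable (by simp) p
      have h2 : fderiv ℝ P p v = 0 := by
        ext i
        fin_cases i
        · exact (fderiv_coord hPd 0 (hfst 0) v).trans (by simp [hv])
        · exact (fderiv_coord hPd 1 (hfst 1) v).trans (by simp [hv])
      have hed : DifferentiableAt ℝ ell p := hell.differentiable (by simp) p
      have h3 : fderiv ℝ ell p v = 0 := by
        apply (bijective_fderiv_polarMap (ell p)).1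
        rw [map_zero, ← h2]
        simp only [P]
        rw [fderiv_comp p (contDiff_polarMap.differentiable (by simp) _) hed]
        rfl
      have hf : HasFDerivAt (fun p : ℝ × ℂ => p.1) (ContinuousLinearMap.fst ℝ ℝ ℂ) p :=
        hasFDerivAt_fst
      have e0 := fderiv_coord hed 0 ((hf.const_mul (2 * Real.pi)).congr_of_eventuallyEq
        (.of_forall fun u => by simp [ell])) v
      have e1 := fderiv_coord hed 1 (((hre p).const_sub 1).congr_of_eventuallyEq
        (.of_forall fun u => by simp [ell])) v
      rw [h3] at e0 e1
      simp [hv, Real.pi_ne_zero] at e0 e1 h1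
      exact Prod.ext e0 (Complex.ext e1 h1.symm)
    exact LinearMap.ker_eq_bot.1 (LinearMap.ker_eq_bot'.2 hker :
      LinearMap.ker (fderiv ℝ G p : ℝ × ℂ →ₗ[ℝ] R4) = ⊥)
  · have h1 : (G p).1 = (G q).1 := congrArg Prod.fst hpq
    have h2 : p.2.im = q.2.im := congrArg Prod.snd hpq
    have h3 : P p = P q := by
      ext i
      fin_cases i
      · simpa [G] using congrArg (fun p : R3 => p 0) h1
      · simpa [G] using congrArg (fun p : R3 => p 1) h1
    obtain ⟨t, w⟩ := p
    obtain ⟨t', w'⟩ := q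
    rw [hPp, hPp, polar_eq_polar_iff, Circle.exp_eq_exp] at h3
    obtain ⟨⟨m, hm⟩, h4⟩ := h3
    refine ⟨Complex.ext (by simpa using h4) h2, m, ?_⟩
    have hpi := Real.pi_ne_zero
    have : 2 * Real.pi * (t - t' - m) = 0 := by linear_combination hm
    have := (mul_eq_zero.1 this).resolve_left (by positivity)
    simp only
    linarith
  · have hknot : ∀ (t : ℝ) (w : Circle),
        G (t, w) = ringKnot H (Circle.exp (2 * Real.pi * t), w) := by
      intro t w
      have h1 : P (t, w) = ringPoint (Circle.exp (2 * Real.pi * t), w) := by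
        rw [hPp]
        simp only [polar, ringPoint, coe_circleExp_re, coe_circleExp_im]
      simp only [G, ringKnot, ringProj, h1]
    ext x
    constructor
    · rintro ⟨⟨z, w⟩, rfl⟩
      refine ⟨(Complex.arg z / (2 * Real.pi), w), Circle.norm_coe w, ?_⟩
      rw [hknot]
      have : 2 * Real.pi * (Complex.arg z / (2 * Real.pi)) = Complex.arg z := by
        field_simp
      rw [this, Circle.exp_arg]
      rfl
    · rintro ⟨⟨t, w⟩, hw, rfl⟩
      refine ⟨(Circle.exp (2 * Real.pi * t), ⟨w, mem_sphere_zero_iff_norm.2 hw⟩), ?_⟩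
      exact (hknot t ⟨w, mem_sphere_zero_iff_norm.2 hw⟩).symm

end RingDiagram

/-! ## Local coordinates around the inner circle of a sheared torus -/

/-- Coordinates on an open set of the plane: the point `(x, Y)` has argument `arg` and logarithmic
radius `radius Y = Y * slope Y`, which depends on `Y` only. -/
structure ColumnChart where
  arg : R2 → ℝ
  radius : ℝ → ℝ
  slope : ℝ → ℝ
  center : ℝ
  contDiff_arg : ContDiff ℝ ∞ arg
  contDiff_radius : ContDiff ℝ ∞ radius
  contDiff_slope : ContDiff ℝ ∞ slope
  slope_pos : ∀ Y, 0 < slope Y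
  radius_eq : ∀ Y, radius Y = Y * slope Y
  radius_lt : ∀ Y, radius Y < 2
  deriv_radius_pos : ∀ Y, 0 < deriv radius Y
  arg_injective : ∀ u v : R2, u 1 = v 1 → arg u = arg v → u 0 = v 0
  fderiv_arg_ne_zero : ∀ u, fderiv ℝ arg u (EuclideanSpace.single 0 1) ≠ 0
  abs_arg_sub_lt : ∀ u, |arg u - center| < Real.pi

/-- The sheet `(x, y) ↦ (x, y², y M(x, y²))`. -/
def oddSheet (M : R2 → ℝ) (u : R2) : R3 := !₂[u 0, u 1 ^ 2, u 1 * M !₂[u 0, u 1 ^ 2]]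

theorem eq_smul_single_add (v : R2) : v = v 0 • EuclideanSpace.single 0 1 +
    v 1 • EuclideanSpace.single 1 1 := by
  ext i
  fin_cases i <;> simp

namespace ColumnChart

variable (C : ColumnChart)

/-- The coordinates `(x, Y)` as a map to the plane. -/
def base (u : R2) : R2 := polarMap !₂[C.arg u, C.radius (u 1)]

theorem base_eq (u : R2) : C.base u = polar (C.arg u) (C.radius (u 1)) := by
  simp [base, polarMap]

theorem strictMono_radius : StrictMono C.radius := strictMono_of_deriv_pos C.deriv_radius_pos

theorem contDiff_argRadius : ContDiff ℝ ∞ fun u : R2 => (!₂[C.arg u, C.radius (u 1)] : R2) := by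
  have h1 := C.contDiff_arg
  have h2 := C.contDiff_radius
  rw [contDiff_euclidean]
  intro i
  fin_cases i <;> simp <;> fun_prop

theorem contDiff_base : ContDiff ℝ ∞ C.base := contDiff_polarMap.comp C.contDiff_argRadius

/-- Both angles lie in an open interval of length 2π, so they cannot differ by a nonzero multiple of
2π. -/
theorem arg_eq_of_exp_eq {u v : R2} (h : Circle.exp (C.arg u) = Circle.exp (C.arg v)) :
    C.arg u = C.arg v := by
  obtain ⟨m, hm⟩ := Circle.exp_eq_exp.1 h
  have h1 := abs_lt.1 (C.abs_arg_sub_lt u)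
  have h2 := abs_lt.1 (C.abs_arg_sub_lt v)
  have hpi := Real.pi_pos
  have h3 : m < 1 := by
    by_contra h
    have : (1 : ℝ) ≤ m := by exact_mod_cast not_lt.1 h
    nlinarith
  have h4 : -1 < m := by
    by_contra h
    have : (m : ℝ) ≤ -1 := by exact_mod_cast not_lt.1 h
    nlinarith
  have h5 : m = 0 := by omega
  simpa [h5] using hm

theorem base_injective : Function.Injective C.base := by
  intro u v h
  rw [C.base_eq, C.base_eq, polar_eq_polar_iff] at h
  have h1 := C.strictMono_radius.injective h.2
  ext i
  fin_cases i
  · exact C.arg_injective u v h1 (C.arg_eq_of_exp_eq h.1)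
  · exact h1

theorem bijective_fderiv_base (u : R2) : Function.Bijective (fderiv ℝ C.base u) := by
  refine bijective_of_ker fun v hv => ?_
  have hd : DifferentiableAt ℝ (fun u : R2 => (!₂[C.arg u, C.radius (u 1)] : R2)) u :=
    C.contDiff_argRadius.differentiable (by simp) u
  have h1 : fderiv ℝ (fun u : R2 => (!₂[C.arg u, C.radius (u 1)] : R2)) u v = 0 := by
    apply (bijective_fderiv_polarMap (!₂[C.arg u, C.radius (u 1)])).1
    rw [map_zero, ← hv]
    have : C.base = polarMap ∘ fun u : R2 => (!₂[C.arg u, C.radius (u 1)] : R2) := rfl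
    rw [this, fderiv_comp u (contDiff_polarMap.differentiable (by simp) _) hd]
    rfl
  have ha := (C.contDiff_arg.differentiable (by simp) u).hasFDerivAt
  have hr := ((C.contDiff_radius.differentiable (by simp) (u 1)).hasDerivAt).comp_hasFDerivAt u
    (hasFDerivAt_coord (1 : Fin 2) u)
  have e0 := fderiv_coord hd 0 (ha.congr_of_eventuallyEq (.of_forall fun u => by simp)) v
  have e1 := fderiv_coord hd 1 (hr.congr_of_eventuallyEq (.of_forall fun u => by simp)) v
  rw [h1] at e0 e1
  have hv1 : v 1 = 0 := by
    have h2 : 0 = deriv C.radius (u 1) * v 1 := e1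
    exact (mul_eq_zero.1 h2.symm).resolve_left (C.deriv_radius_pos _).ne'
  have hv0 : v 0 = 0 := by
    rw [eq_smul_single_add v, hv1, zero_smul, add_zero, map_smul] at e0
    have h2 : 0 = v 0 * fderiv ℝ C.arg u (EuclideanSpace.single 0 1) := e0
    exact (mul_eq_zero.1 h2.symm).resolve_right (C.fderiv_arg_ne_zero u)
  ext i
  fin_cases i
  · exact hv0
  · exact hv1

/-! ### Columns over coordinate patches -/

/-- The column over the coordinate patch, with the vertical coordinate scaled by `k`. -/
def column (k : R2 → ℝ) (q : R3) : R3 :=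
  !₂[C.base (planePart q) 0, C.base (planePart q) 1, q 2 * k (planePart q)]

variable {C} in
theorem isSpaceChart_column {k : R2 → ℝ} (hk : ContDiff ℝ ∞ k) (hk0 : ∀ u, 0 < k u) :
    IsSpaceChart (C.column k) := by
  have hb : ContDiff ℝ ∞ (fun q => C.base (planePart q)) := C.contDiff_base.comp contDiff_planePart
  have hbc := contDiff_euclidean.1 hb
  have hkc : ContDiff ℝ ∞ (fun q => k (planePart q)) := hk.comp contDiff_planePart
  have hc : ContDiff ℝ ∞ (C.column k) := by
    rw [contDiff_euclidean]
    intro i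
    fin_cases i
    · exact hbc 0
    · exact hbc 1
    · exact ContDiff.mul (by fun_prop) hkc
  refine ⟨hc, fun q q' h => ?_, fun q => bijective_of_ker fun v hv => ?_⟩
  · have h0 := congrArg (fun p : R3 => p 0) h
    have h1 := congrArg (fun p : R3 => p 1) h
    have h2 := congrArg (fun p : R3 => p 2) h
    simp only [column, Fin.isValue, Matrix.cons_val] at h0 h1 h2
    have h3 : planePart q = planePart q' := by
      apply C.base_injective
      ext i
      fin_cases i
      · exact h0
      · exact h1
    rw [h3] at h2
    have h4 := mul_right_cancel₀ (hk0 _).ne' h2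
    ext i
    fin_cases i
    · simpa [planePart] using congrArg (fun p : R2 => p 0) h3
    · simpa [planePart] using congrArg (fun p : R2 => p 1) h3
    · exact h4
  · have hd : DifferentiableAt ℝ (C.column k) q := hc.differentiable (by simp) q
    have hbd : DifferentiableAt ℝ (fun q => C.base (planePart q)) q := hb.differentiable (by simp) q
    have hpd : DifferentiableAt ℝ planePart q := contDiff_planePart.differentiable (by simp) q
    have e : ∀ i : Fin 2, HasFDerivAt (fun q => C.base (planePart q) i)
        ((EuclideanSpace.proj i : R2 →L[ℝ] ℝ).comp
          (fderiv ℝ (fun q => C.base (planePart q)) q)) q := fun i =>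
      (hasFDerivAt_coord i _).comp q hbd.hasFDerivAt
    have e0 := fderiv_coord hd 0 ((e 0).congr_of_eventuallyEq
      (.of_forall fun u => by simp [column])) v
    have e1 := fderiv_coord hd 1 ((e 1).congr_of_eventuallyEq
      (.of_forall fun u => by simp [column])) v
    have h1 : fderiv ℝ (fun q => C.base (planePart q)) q v = 0 := by
      rw [hv] at e0 e1
      ext i
      fin_cases i
      · exact e0.symm
      · exact e1.symm
    have h2 : fderiv ℝ planePart q v = 0 := by
      apply (C.bijective_fderiv_base (planePart q)).1
      rw [map_zero, ← h1]
      have : (fun q => C.base (planePart q)) = C.base ∘ planePart := rfl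
      rw [this, fderiv_comp q (C.contDiff_base.differentiable (by simp) _) hpd]
      rfl
    have p0 := fderiv_coord hpd 0 ((hasFDerivAt_coord (0 : Fin 3) q).congr_of_eventuallyEq
      (.of_forall fun u => by simp [planePart])) v
    have p1 := fderiv_coord hpd 1 ((hasFDerivAt_coord (1 : Fin 3) q).congr_of_eventuallyEq
      (.of_forall fun u => by simp [planePart])) v
    have hkd := (hk.differentiable (by simp) (planePart q)).hasFDerivAt.comp q hpd.hasFDerivAt
    have e2 := fderiv_coord hd 2 (((hasFDerivAt_coord (2 : Fin 3) q).mul hkd).congr_of_eventuallyEq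
      (.of_forall fun u => by simp [column])) v
    rw [h2] at p0 p1
    rw [hv] at e2
    simp [h2, (hk0 _).ne'] at p0 p1 e2
    ext i
    fin_cases i
    · exact p0.symm
    · exact p1.symm
    · exact e2

/-! ### The disc on the torus -/

/-- The sine of half the meridian angle. -/
def halfSine (y : ℝ) : ℝ := y * √(C.slope (y ^ 2) / 2)

/-- The meridian angle. -/
def meridian (y : ℝ) : ℝ := 2 * Real.arcsin (C.halfSine y)

/-- The quotient of the sine of the meridian angle by the coordinate `y`. -/
def sineSlope (Y : ℝ) : ℝ := 2 * √(C.slope Y / 2) * √(1 - C.radius Y / 2)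

/-- The logarithmic radius on the torus is 1 - cos φ = 2 sin²(φ/2). Setting it equal to `radius (y ^
2)` gives a smooth square root through y = 0 because `radius Y` is `Y` times a positive smooth
function. Thus the disc with coordinates (x, y) lies over the half Y ≥ 0 of the patch by the fold Y
= y². -/
theorem halfSine_sq (y : ℝ) : C.halfSine y ^ 2 = C.radius (y ^ 2) / 2 := by
  have h := (C.slope_pos (y ^ 2)).le
  rw [halfSine, mul_pow, Real.sq_sqrt (by positivity), C.radius_eq]
  ring

theorem abs_halfSine_lt (y : ℝ) : |C.halfSine y| < 1 := by
  have h := C.halfSine_sq y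
  have h2 := C.radius_lt (y ^ 2)
  rw [abs_lt]
  constructor <;> nlinarith

theorem contDiff_halfSine : ContDiff ℝ ∞ C.halfSine := by
  have h1 := C.contDiff_slope
  have h2 : ContDiff ℝ ∞ fun y : ℝ => √(C.slope (y ^ 2) / 2) :=
    ContDiff.sqrt (by fun_prop) fun y => by
      have := C.slope_pos (y ^ 2)
      positivity
  unfold halfSine
  fun_prop

theorem contDiff_meridian : ContDiff ℝ ∞ C.meridian := by
  rw [contDiff_iff_contDiffAt]
  intro y
  have h := abs_lt.1 (C.abs_halfSine_lt y)
  exact contDiffAt_const.mul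
    ((Real.contDiffAt_arcsin h.1.ne' h.2.ne).comp y C.contDiff_halfSine.contDiffAt)

theorem contDiff_sineSlope : ContDiff ℝ ∞ C.sineSlope := by
  have h1 := C.contDiff_slope
  have h2 := C.contDiff_radius
  have h3 : ContDiff ℝ ∞ fun Y : ℝ => √(C.slope Y / 2) :=
    ContDiff.sqrt (by fun_prop) fun y => by
      have := C.slope_pos y
      positivity
  have h4 : ContDiff ℝ ∞ fun Y : ℝ => √(1 - C.radius Y / 2) :=
    ContDiff.sqrt (by fun_prop) fun y => by
      have := C.radius_lt y
      linarith
  unfold sineSlope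
  fun_prop

theorem sineSlope_pos (Y : ℝ) : 0 < C.sineSlope Y := by
  have h1 := C.slope_pos Y
  have h2 := C.radius_lt Y
  have h3 : 0 < 1 - C.radius Y / 2 := by linarith
  unfold sineSlope
  positivity

theorem cos_meridian (y : ℝ) : Real.cos (C.meridian y) = 1 - C.radius (y ^ 2) := by
  have h := abs_lt.1 (C.abs_halfSine_lt y)
  rw [meridian, Real.cos_two_mul, Real.cos_arcsin, Real.sq_sqrt, C.halfSine_sq]
  · ring
  · nlinarith

theorem sin_meridian (y : ℝ) : Real.sin (C.meridian y) = y * C.sineSlope (y ^ 2) := by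
  have h := abs_lt.1 (C.abs_halfSine_lt y)
  rw [meridian, Real.sin_two_mul, Real.cos_arcsin, Real.sin_arcsin h.1.le h.2.le, C.halfSine_sq,
    halfSine, sineSlope]
  ring

/-- The formula for the sine settles y = 0, where the derivative of the cosine vanishes; the formula
for the cosine settles y ≠ 0. -/
theorem deriv_meridian_ne_zero (y : ℝ) : deriv C.meridian y ≠ 0 := by
  intro h0
  have hm := (C.contDiff_meridian.differentiable (by simp) y).hasDerivAt
  rw [h0] at hm
  by_cases hy : y = 0
  · have hs := (C.contDiff_sineSlope.differentiable (by simp) (y ^ 2)).hasDerivAt.comp y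
      (hasDerivAt_pow 2 y)
    have h1 := hm.sin.unique (((hasDerivAt_id y).mul hs).congr_of_eventuallyEq
      (.of_forall fun y => by simp [C.sin_meridian]))
    simp [hy] at h1
    exact (C.sineSlope_pos 0).ne h1
  · have hs := (C.contDiff_radius.differentiable (by simp) (y ^ 2)).hasDerivAt.comp y
      (hasDerivAt_pow 2 y)
    have h1 := hm.cos.unique ((hs.const_sub 1).congr_of_eventuallyEq
      (.of_forall fun y => by simp [C.cos_meridian]))
    simp [hy, (C.deriv_radius_pos _).ne'] at h1

/-- The lift of the disc to the plane. -/
def discLift (u : R2) : R2 := !₂[C.arg !₂[u 0, u 1 ^ 2], C.meridian (u 1)]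

/-- The disc on the torus. -/
def disc : Fin 1 → R2 → Circle × Circle := fun _ => torusCover ∘ C.discLift

/-- The folding map. -/
def fold (u : R2) : R2 := !₂[u 0, u 1 ^ 2]

theorem ringLift_discLift (u : R2) : ringLift (C.discLift u) = C.base (fold u) := by
  simp [ringLift, discLift, C.base_eq, fold, C.cos_meridian]

theorem contDiff_fold : ContDiff ℝ ∞ fold := by
  unfold fold
  rw [contDiff_euclidean]
  intro i
  fin_cases i <;> simp <;> fun_prop

theorem contDiff_discLift : ContDiff ℝ ∞ C.discLift := by
  rw [contDiff_euclidean]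
  intro i
  fin_cases i
  · exact C.contDiff_arg.comp contDiff_fold
  · exact C.contDiff_meridian.comp (by fun_prop)

theorem isDiscChart_disc : IsDiscChart C.disc := by
  refine isDiscChart_torusCover_comp C.contDiff_discLift (fun u => ?_) fun u v h => ?_
  · refine bijective_of_ker fun v hv => ?_
    have hd : DifferentiableAt ℝ C.discLift u := C.contDiff_discLift.differentiable (by simp) u
    have hm := ((C.contDiff_meridian.differentiable (by simp) (u 1)).hasDerivAt).comp_hasFDerivAt u
      (hasFDerivAt_coord (1 : Fin 2) u)
    have hfd : DifferentiableAt ℝ fold u := contDiff_fold.differentiable (by simp) u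
    have ha := ((C.contDiff_arg.differentiable (by simp) (fold u)).hasFDerivAt).comp u
      hfd.hasFDerivAt
    have e0 := fderiv_coord hd 0 (ha.congr_of_eventuallyEq
      (.of_forall fun u => by simp [discLift, fold])) v
    have e1 := fderiv_coord hd 1 (hm.congr_of_eventuallyEq
      (.of_forall fun u => by simp [discLift])) v
    rw [hv] at e0 e1
    have hv1 : v 1 = 0 := by
      have h2 : 0 = deriv C.meridian (u 1) * v 1 := e1
      exact (mul_eq_zero.1 h2.symm).resolve_left (C.deriv_meridian_ne_zero _)
    have f0 := fderiv_coord hfd 0 ((hasFDerivAt_coord (0 : Fin 2) u).congr_of_eventuallyEq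
      (.of_forall fun u => by simp [fold])) v
    have f1 := fderiv_coord hfd 1 (((hasFDerivAt_coord (1 : Fin 2) u).pow 2).congr_of_eventuallyEq
      (.of_forall fun u => by simp [fold])) v
    have hf : fderiv ℝ fold u v = v 0 • EuclideanSpace.single 0 1 := by
      ext i
      fin_cases i
      · simpa [coordProj_apply] using f0
      · simpa [coordProj_apply, hv1] using f1
    have h3 : 0 = v 0 * fderiv ℝ C.arg (fold u) (EuclideanSpace.single 0 1) := by
      have : 0 = fderiv ℝ C.arg (fold u) (fderiv ℝ fold u v) := e0
      rw [hf, map_smul] at this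
      exact this
    have hv0 := (mul_eq_zero.1 h3.symm).resolve_right (C.fderiv_arg_ne_zero _)
    ext i
    fin_cases i
    · exact hv0
    · exact hv1
  · have h1 : Circle.exp (C.arg (fold u)) = Circle.exp (C.arg (fold v)) := by
      simpa [torusCover, discLift, fold] using congrArg Prod.fst h
    have h2 : Circle.exp (C.meridian (u 1)) = Circle.exp (C.meridian (v 1)) := by
      simpa [torusCover, discLift] using congrArg Prod.snd h
    have h3 : Real.cos (C.meridian (u 1)) = Real.cos (C.meridian (v 1)) := by
      rw [← coe_circleExp_re, h2, coe_circleExp_re]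
    have h4 : Real.sin (C.meridian (u 1)) = Real.sin (C.meridian (v 1)) := by
      rw [← coe_circleExp_im, h2, coe_circleExp_im]
    rw [C.cos_meridian, C.cos_meridian] at h3
    have h5 : u 1 ^ 2 = v 1 ^ 2 := C.strictMono_radius.injective (by linarith)
    rw [C.sin_meridian, C.sin_meridian, h5] at h4
    have h6 := mul_right_cancel₀ (C.sineSlope_pos _).ne' h4
    have h7 : fold u 1 = fold v 1 := by simpa [fold] using h5
    have h8 := C.arg_injective _ _ h7 (C.arg_eq_of_exp_eq h1)
    ext i
    fin_cases i
    · simpa [fold] using h8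
    · exact h6

/-! ### Sheared tori in patch coordinates -/

/-- The vertical scaling of the column that fits the disc. -/
def scale (k : R2 → ℝ) (u : R2) : ℝ := C.sineSlope (u 1) * k u

variable {C}

theorem isSpaceChart_column_scale {k : R2 → ℝ} (hk : ContDiff ℝ ∞ k) (hk0 : ∀ u, 0 < k u) :
    IsSpaceChart (C.column (C.scale k)) := by
  refine isSpaceChart_column ?_ fun u => mul_pos (C.sineSlope_pos _) (hk0 u)
  have h := C.contDiff_sineSlope
  unfold scale
  fun_prop

/-- The third coordinate is sin φ · H, with sin φ = y · `sineSlope (y ^ 2)` and H = k · M. Dividing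
by the positive scale leaves y · M(x, y²). The identity is needed only for Y ≥ 0, since Y = y². -/
theorem ringProj_disc {H k M : R2 → ℝ}
    (hM : ∀ u : R2, 0 ≤ u 1 → k u * M u = H (C.base u)) (u : R2) (i : Fin 1) :
    ringProj H (C.disc i u) = C.column (C.scale k) (oddSheet M u) := by
  have h1 : planePart (oddSheet M u) = fold u := by
    ext i
    fin_cases i <;> simp [planePart, oddSheet, fold]
  have h2 := hM (fold u) (by simp [fold]; positivity)
  have h3 : Real.sin (C.discLift u 1) = u 1 * C.sineSlope (u 1 ^ 2) := by
    simp [discLift, C.sin_meridian]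
  have h4 : fold u 1 = u 1 ^ 2 := by simp [fold]
  have h5 : oddSheet M u 2 = u 1 * M (fold u) := by simp [oddSheet, fold]
  rw [disc, Function.comp_apply, ringProj_torusCover, ringLift_discLift, column, h1, h3, h5,
    ← h2, scale, h4]
  congr 4
  ring

/-- A point of the torus over the coordinate patch lies in the disc. -/
theorem mem_disc_of_ringPoint_mem {q : Circle × Circle} {u : R2} (h : ringPoint q = C.base u) :
    ∃ v, torusCover (C.discLift v) = q := by
  obtain ⟨w, rfl⟩ := surjective_torusCover q
  rw [ringPoint_torusCover, C.base_eq, polar_eq_polar_iff] at h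
  obtain ⟨h1, h2⟩ := h
  have hs := C.slope_pos (u 1)
  have hu : 0 ≤ u 1 := by
    have h3 := Real.cos_le_one (w 1)
    have h4 := C.radius_eq (u 1)
    by_contra hneg
    nlinarith
  have hS := C.sineSlope_pos (u 1)
  -- Forced by `sin_meridian`. Its square is `u 1` because sin² φ = X (2 - X) with X = `radius (u
  -- 1)`.
  set y := Real.sin (w 1) / C.sineSlope (u 1) with hy
  have hsin : Real.sin (w 1) = y * C.sineSlope (u 1) := by
    rw [hy]; field_simp
  have hSsq : C.sineSlope (u 1) ^ 2 = C.slope (u 1) * (2 - C.radius (u 1)) := by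
    have h5 := C.radius_lt (u 1)
    rw [sineSlope, mul_pow, mul_pow, Real.sq_sqrt (by positivity), Real.sq_sqrt (by linarith)]
    ring
  have hysq : y ^ 2 = u 1 := by
    have h3 := Real.sin_sq_add_cos_sq (w 1)
    have h4 : y ^ 2 * C.sineSlope (u 1) ^ 2 = u 1 * C.sineSlope (u 1) ^ 2 := by
      rw [← mul_pow, ← hsin, hSsq]
      have h5 : Real.cos (w 1) = 1 - C.radius (u 1) := by linarith
      rw [h5] at h3
      have h6 := C.radius_eq (u 1)
      linear_combination h3 + (2 - C.radius (u 1)) * h6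
    exact mul_right_cancel₀ (by positivity) h4
  refine ⟨!₂[u 0, y], ?_⟩
  have hfold : (!₂[u 0, y ^ 2] : R2) = u := by
    ext i
    fin_cases i
    · simp
    · simpa using hysq
  refine Prod.ext ?_ (Circle.ext (Complex.ext ?_ ?_))
  · simp [torusCover, discLift, hfold, h1]
  · simp only [torusCover, coe_circleExp_re]
    simp [discLift, C.cos_meridian, hysq]
    linarith
  · simp only [torusCover, coe_circleExp_im]
    simp [discLift, C.sin_meridian, hysq, hsin]

theorem ringProj_mem_range_column_iff {H k : R2 → ℝ} (hk0 : ∀ u, 0 < k u)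
    {q : Circle × Circle} :
    ringProj H q ∈ Set.range (C.column (C.scale k)) ↔ ringPoint q ∈ Set.range C.base := by
  constructor
  · rintro ⟨p, hp⟩
    refine ⟨planePart p, ?_⟩
    ext i
    fin_cases i
    · simpa [column, ringProj] using congrArg (fun p : R3 => p 0) hp
    · simpa [column, ringProj] using congrArg (fun p : R3 => p 1) hp
  · rintro ⟨u, hu⟩
    have hs : C.scale k u ≠ 0 := (mul_pos (C.sineSlope_pos _) (hk0 u)).ne'
    refine ⟨!₂[u 0, u 1, (q.2 : ℂ).im * H (ringPoint q) / C.scale k u], ?_⟩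
    have h1 : planePart !₂[u 0, u 1, (q.2 : ℂ).im * H (ringPoint q) / C.scale k u] = u := by
      ext i
      fin_cases i <;> simp [planePart]
    rw [column, h1, hu, ringProj]
    congr 4
    simp
    field_simp

theorem matchesOver {H k M : R2 → ℝ} (hk0 : ∀ u, 0 < k u)
    (hM : ∀ u : R2, 0 ≤ u 1 → k u * M u = H (C.base u)) :
    MatchesOver (ringProj H) (C.column (C.scale k)) C.disc (fun _ => oddSheet M) := by
  refine ⟨fun i u => ringProj_disc hM u i, fun q => ?_⟩
  rw [ringProj_mem_range_column_iff hk0]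
  constructor
  · rintro ⟨u, hu⟩
    obtain ⟨v, hv⟩ := mem_disc_of_ringPoint_mem hu.symm
    exact ⟨0, v, hv⟩
  · rintro ⟨i, u, rfl⟩
    refine ⟨fold u, ?_⟩
    rw [disc, Function.comp_apply, ringPoint_torusCover, ← ringLift_discLift]
    rfl

/-- The height is sin φ, a positive factor depending on y² times y. For double points, which have
equal y², lower means smaller y; this is the sign ε = 1. -/
theorem looksLike {H k M : R2 → ℝ} (hH : IsRingHeight H) (hk0 : ∀ u, 0 < k u)
    (hM : ∀ u : R2, 0 ≤ u 1 → k u * M u = H (C.base u)) :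
    (ringDiagram H hH).LooksLike (C.column (C.scale k)) C.disc (fun _ => oddSheet M) 1 1 := by
  refine ⟨matchesOver hk0 hM, fun i u j v huv => ?_⟩
  have hij : i = j := Subsingleton.elim _ _
  have h1 : u 1 ^ 2 = v 1 ^ 2 := by
    simpa [oddSheet] using congrArg (fun p : R3 => p 1) huv
  have hproj : ringProj H (C.disc i u) = ringProj H (C.disc j v) := by
    have huv' : oddSheet M u = oddSheet M v := huv
    rw [ringProj_disc hM, ringProj_disc hM, huv']
  have hheight : ∀ w, (ringDiagram H hH).height (C.disc i w) = w 1 * C.sineSlope (w 1 ^ 2) := by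
    intro w
    rw [ringDiagram_height]
    simp only [disc, Function.comp_apply, torusCover, coe_circleExp_im]
    simp [discLift, C.sin_meridian]
  have hunder : (ringDiagram H hH).Under (C.disc i u) (C.disc j v) ↔
      (ringDiagram H hH).height (C.disc i u) < (ringDiagram H hH).height (C.disc i v) :=
    ⟨fun h => h.2, fun h => ⟨hproj, h⟩⟩
  rw [hunder, hheight, hheight, h1, mul_lt_mul_iff_left₀ (C.sineSlope_pos _)]
  simp [LocalUnder, hij]

/-- The family of odd sheets with slopes `M t` as a local picture. -/
def oddPicture (M : ℝ → R2 → ℝ) : LocalPicture where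
  n := 1
  sheet t := fun _ => oddSheet (M t)

/-- Changing the slope function in a coordinate patch is a move. -/
theorem moved {H H' k : R2 → ℝ} {M : ℝ → R2 → ℝ} (hH : IsRingHeight H) (hH' : IsRingHeight H')
    (hk : ContDiff ℝ ∞ k) (hk0 : ∀ u, 0 < k u)
    (hM : ∀ u : R2, 0 ≤ u 1 → k u * M 1 u = H (C.base u))
    (hM' : ∀ u : R2, 0 ≤ u 1 → k u * M (-1) u = H' (C.base u))
    (hout : ∀ p, p ∉ Set.range C.base → H' p = H p) :
    SurfaceKnotDiagram.Moved (oddPicture M) (ringDiagram H hH) (ringDiagram H' hH') := by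
  have hproj : ∀ q, (ringDiagram H hH).proj q ∉ Set.range (C.column (C.scale k)) →
      (ringDiagram H' hH').proj q = (ringDiagram H hH).proj q := by
    intro q hq
    rw [ringDiagram_proj, ringProj_mem_range_column_iff hk0] at hq
    rw [ringDiagram_proj, ringDiagram_proj, ringProj, ringProj, hout _ hq]
  refine ⟨C.column (C.scale k), C.disc, 1, 1, isSpaceChart_column_scale hk hk0,
    C.isDiscChart_disc, .inl rfl, looksLike hH hk0 hM, looksLike hH' hk0 hM', hproj,
    fun x y hx hy => ?_⟩
  unfold SurfaceKnotDiagram.Under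
  rw [hproj x hx, hproj y hy]
  rfl

/-- A coordinate patch in which the slope function is the first coordinate is an umbrella. -/
theorem isWhitneyUmbrellaAt {H k : R2 → ℝ} (hk : ContDiff ℝ ∞ k) (hk0 : ∀ u, 0 < k u)
    (hM : ∀ u : R2, 0 ≤ u 1 → k u * u 0 = H (C.base u)) :
    IsWhitneyUmbrellaAt (ringProj H) (torusCover !₂[C.arg 0, 0]) := by
  refine ⟨C.column (C.scale k), C.disc, isSpaceChart_column_scale hk hk0, C.isDiscChart_disc,
    ?_, ?_⟩
  · have h1 : (!₂[0, 0] : R2) = 0 := by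
      ext i
      fin_cases i <;> simp
    simp [disc, discLift, meridian, halfSine, h1]
  · have h1 : whitneyUmbrella = oddSheet (fun u => u 0) := by
      ext1 u
      simp [whitneyUmbrella, oddSheet, mul_comm]
    rw [h1]
    exact matchesOver hk0 hM

end ColumnChart

/-! ## Auxiliary functions of one variable -/

theorem Monotone.hasDerivAt_nonneg {f : ℝ → ℝ} (hf : Monotone f) {c x : ℝ}
    (h : HasDerivAt f c x) : 0 ≤ c := by
  rw [← h.deriv, ← derivWithin_univ]
  exact (hf.monotoneOn Set.univ).derivWithin_nonneg

/-! ### A diffeomorphism from the line onto an interval -/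

/-- A smooth increasing odd function from the line onto the interval `(-1, 1)`, the inverse
function of `s ↦ 3 s / (16 (1 - s²))`. -/
def squeeze (t : ℝ) : ℝ := 2 * t / (3 / 16 + √((3 / 16) ^ 2 + 4 * t ^ 2))

theorem squeeze_denom_pos (t : ℝ) : 0 < 3 / 16 + √((3 / 16) ^ 2 + 4 * t ^ 2) := by positivity

theorem contDiff_squeeze : ContDiff ℝ ∞ squeeze := by
  have h : ContDiff ℝ ∞ fun t : ℝ => √((3 / 16) ^ 2 + 4 * t ^ 2) :=
    ContDiff.sqrt (by fun_prop) fun t => by positivity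
  unfold squeeze
  exact ContDiff.div (by fun_prop) (by fun_prop) fun t => (squeeze_denom_pos t).ne'

theorem squeeze_eq (t : ℝ) : 3 / 16 * squeeze t = t * (1 - squeeze t ^ 2) := by
  have h := Real.sq_sqrt (show 0 ≤ (3 / 16 : ℝ) ^ 2 + 4 * t ^ 2 by positivity)
  have h0 := squeeze_denom_pos t
  rw [squeeze]
  generalize √((3 / 16 : ℝ) ^ 2 + 4 * t ^ 2) = s at h h0
  have h1 : 3 / 16 + s ≠ 0 := h0.ne'
  have h2 : 2 * t / (3 / 16 + s) * (3 / 16 + s) = 2 * t := div_mul_cancel₀ _ h1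
  generalize 2 * t / (3 / 16 + s) = q at h2
  have h3 : (3 / 16 * q - t * (1 - q ^ 2)) * (3 / 16 + s) ^ 2 = 0 := by
    linear_combination (3 / 16 * (3 / 16 + s) + t * (q * (3 / 16 + s) + 2 * t)) * h2 - t * h
  exact sub_eq_zero.1 ((mul_eq_zero.1 h3).resolve_right (pow_ne_zero 2 h1))

theorem squeeze_sq_lt (t : ℝ) : squeeze t ^ 2 < 1 := by
  have h := Real.sq_sqrt (show 0 ≤ (3 / 16 : ℝ) ^ 2 + 4 * t ^ 2 by positivity)
  have h0 := squeeze_denom_pos t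
  have h1 := Real.sqrt_nonneg ((3 / 16 : ℝ) ^ 2 + 4 * t ^ 2)
  rw [squeeze, div_pow, div_lt_one (by positivity)]
  nlinarith

theorem abs_squeeze_lt (t : ℝ) : |squeeze t| < 1 := by
  rw [← sq_lt_one_iff_abs_lt_one]
  exact squeeze_sq_lt t

theorem squeeze_origin : squeeze 0 = 0 := by simp [squeeze]

theorem squeeze_neg (t : ℝ) : squeeze (-t) = -squeeze t := by simp [squeeze]; ring

/-- The constant 3/16 is chosen for this value: it matches the plateau 1/8 of the bump with the
amplitude 1/2 of cos θ / 2 in `middleHeight`. -/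
theorem squeeze_eighth : squeeze (1 / 8) = 1 / 2 := by
  have h : √((3 / 16 : ℝ) ^ 2 + 4 * (1 / 8) ^ 2) = 5 / 16 := by
    rw [show (3 / 16 : ℝ) ^ 2 + 4 * (1 / 8) ^ 2 = (5 / 16) ^ 2 by norm_num]
    exact Real.sqrt_sq (by norm_num)
  rw [squeeze, h]
  norm_num

/-- The difference quotient of `squeeze`. -/
def squeezeSlope (a b : ℝ) : ℝ := (1 - squeeze a ^ 2) * (1 - squeeze b ^ 2) /
  (3 / 16 * (1 + squeeze a * squeeze b))

theorem one_add_squeeze_mul_pos (a b : ℝ) : 0 < 1 + squeeze a * squeeze b := by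
  nlinarith [squeeze_sq_lt a, squeeze_sq_lt b, sq_nonneg (squeeze a + squeeze b)]

theorem squeezeSlope_pos (a b : ℝ) : 0 < squeezeSlope a b := by
  have h1 := squeeze_sq_lt a
  have h2 := squeeze_sq_lt b
  have h3 := one_add_squeeze_mul_pos a b
  have h4 : 0 < 1 - squeeze a ^ 2 := by linarith
  have h5 : 0 < 1 - squeeze b ^ 2 := by linarith
  unfold squeezeSlope
  positivity

/-- The inverse function is rational, so its difference quotient is explicit. This writes a
difference of two squeezed quantities as their difference times a smooth positive factor, the form
required of the vertical scales. -/
theorem squeeze_sub (a b : ℝ) : squeeze a - squeeze b = (a - b) * squeezeSlope a b := by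
  have h1 := squeeze_eq a
  have h2 := squeeze_eq b
  have h3 := one_add_squeeze_mul_pos a b
  rw [squeezeSlope, ← mul_div_assoc, eq_div_iff (by positivity)]
  linear_combination (1 - squeeze b ^ 2) * h1 - (1 - squeeze a ^ 2) * h2

theorem contDiff_squeezeSlope {E : Type*} [NormedAddCommGroup E] [NormedSpace ℝ E] {f g : E → ℝ}
    (hf : ContDiff ℝ ∞ f) (hg : ContDiff ℝ ∞ g) :
    ContDiff ℝ ∞ fun x => squeezeSlope (f x) (g x) := by
  have h1 := contDiff_squeeze.comp hf
  have h2 := contDiff_squeeze.comp hg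
  unfold squeezeSlope
  exact ContDiff.div (by fun_prop) (by fun_prop) fun x => by
    have := one_add_squeeze_mul_pos (f x) (g x)
    positivity

theorem squeeze_eq_mul (t : ℝ) : squeeze t = t * squeezeSlope t 0 := by
  simpa [squeeze_origin] using squeeze_sub t 0

theorem hasDerivAt_squeeze (t : ℝ) : HasDerivAt squeeze (squeezeSlope t t) t := by
  have h : ContDiff ℝ ∞ fun s => squeezeSlope s t := contDiff_squeezeSlope contDiff_id contDiff_const
  have h1 := (h.differentiable (by simp) t).hasDerivAt
  have h2 := (((hasDerivAt_id t).sub_const t).mul h1).const_add (squeeze t)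
  simp only [id, sub_self, zero_mul, add_zero, one_mul] at h2
  refine h2.congr_of_eventuallyEq (.of_forall fun s => ?_)
  have := squeeze_sub s t
  simp only [Pi.mul_apply]
  linarith

theorem strictMono_squeeze : StrictMono squeeze :=
  strictMono_of_deriv_pos fun t => by
    rw [(hasDerivAt_squeeze t).deriv]
    exact squeezeSlope_pos t t

theorem exists_squeeze_eq {s : ℝ} (hs : |s| < 1) : ∃ t, squeeze t = s := by
  have hs2 : 0 < 1 - s ^ 2 := by
    have := (sq_lt_one_iff_abs_lt_one s).2 hs
    linarith
  refine ⟨3 / 16 * s / (1 - s ^ 2), ?_⟩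
  set t := 3 / 16 * s / (1 - s ^ 2) with ht
  have h1 := squeeze_eq t
  have h2 : t * (1 - s ^ 2) = 3 / 16 * s := by rw [ht]; field_simp
  have h3 := squeeze_sq_lt t
  have h4 : (squeeze t - s) * (1 + squeeze t * s) = 0 := by
    have h5 : 3 / 16 * ((squeeze t - s) * (1 + squeeze t * s)) = 0 := by
      clear_value t
      linear_combination (1 - s ^ 2) * h1 + (1 - squeeze t ^ 2) * h2
    linarith
  have h5 : 0 < 1 + squeeze t * s := by nlinarith [sq_nonneg (squeeze t + s)]
  exact sub_eq_zero.1 ((mul_eq_zero.1 h4).resolve_right h5.ne')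

/-! ### A diffeomorphism from the line onto the angles in (-π, π) -/

/-- A smooth odd function whose square is `squeeze (z²)`. -/
def sineHalf (z : ℝ) : ℝ := z * √(squeezeSlope (z ^ 2) 0)

theorem sineHalf_sq (z : ℝ) : sineHalf z ^ 2 = squeeze (z ^ 2) := by
  rw [sineHalf, mul_pow, Real.sq_sqrt (squeezeSlope_pos _ _).le, ← squeeze_eq_mul]

theorem abs_sineHalf_lt (z : ℝ) : |sineHalf z| < 1 := by
  rw [← sq_lt_one_iff_abs_lt_one, sineHalf_sq]
  exact (abs_lt.1 (abs_squeeze_lt _)).2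

theorem contDiff_sineHalf : ContDiff ℝ ∞ sineHalf := by
  have h : ContDiff ℝ ∞ fun z : ℝ => √(squeezeSlope (z ^ 2) 0) :=
    (contDiff_squeezeSlope (by fun_prop) (by fun_prop)).sqrt fun z => (squeezeSlope_pos _ _).ne'
  unfold sineHalf
  fun_prop

/-- A diffeomorphism of the line onto the interval `(-π, π)`. -/
def angle (z : ℝ) : ℝ := 2 * Real.arcsin (sineHalf z)

/-- The angle is built so that its cosine is affine in `squeeze (z ^ 2)`; then `middleHeight`
becomes a difference of two values of `squeeze`. -/
theorem cos_angle (z : ℝ) : Real.cos (angle z) = 1 - 2 * squeeze (z ^ 2) := by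
  have h := abs_lt.1 (abs_sineHalf_lt z)
  rw [angle, Real.cos_two_mul, Real.cos_arcsin, Real.sq_sqrt, sineHalf_sq]
  · ring
  · nlinarith

theorem contDiff_angle : ContDiff ℝ ∞ angle := by
  rw [contDiff_iff_contDiffAt]
  intro z
  have h := abs_lt.1 (abs_sineHalf_lt z)
  exact contDiffAt_const.mul
    ((Real.contDiffAt_arcsin h.1.ne' h.2.ne).comp z contDiff_sineHalf.contDiffAt)

theorem abs_two_mul_arcsin_lt {s : ℝ} (hs : |s| < 1) : |2 * Real.arcsin s| < Real.pi := by
  have h1 := Real.neg_pi_div_two_lt_arcsin.2 (abs_lt.1 hs).1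
  have h2 := Real.arcsin_lt_pi_div_two.2 (abs_lt.1 hs).2
  rw [abs_lt]
  constructor <;> linarith

theorem abs_angle_lt (z : ℝ) : |angle z| < Real.pi := abs_two_mul_arcsin_lt (abs_sineHalf_lt z)

theorem angle_zero : angle 0 = 0 := by simp [angle, sineHalf]

theorem angle_neg (z : ℝ) : angle (-z) = -angle z := by simp [angle, sineHalf]

/-- At 0 the product rule leaves the positive square root. Elsewhere the square is differentiated
and the common factor `z` cancelled. -/
theorem deriv_sineHalf_pos (z : ℝ) : 0 < deriv sineHalf z := by
  have h1 := (contDiff_sineHalf.differentiable (by simp) z).hasDerivAt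
  by_cases hz : z = 0
  · subst hz
    have h2 : ContDiff ℝ ∞ fun z : ℝ => √(squeezeSlope (z ^ 2) 0) :=
      (contDiff_squeezeSlope (by fun_prop) (by fun_prop)).sqrt fun z => (squeezeSlope_pos _ _).ne'
    have h3 := (hasDerivAt_id (0 : ℝ)).mul (h2.differentiable (by simp) 0).hasDerivAt
    have h4 := h1.unique (h3.congr_of_eventuallyEq (.of_forall fun z => rfl))
    rw [h4]
    simpa using squeezeSlope_pos 0 0
  · have h2 := (hasDerivAt_squeeze (z ^ 2)).comp z (hasDerivAt_pow 2 z)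
    have h3 := (h1.pow 2).unique (h2.congr_of_eventuallyEq (.of_forall fun z => sineHalf_sq z))
    have h4 := squeezeSlope_pos (z ^ 2) (z ^ 2)
    have h5 := squeezeSlope_pos (z ^ 2) 0
    have h6 : 0 < √(squeezeSlope (z ^ 2) 0) := Real.sqrt_pos.2 h5
    simp [sineHalf] at h3
    have h7 : z * (√(squeezeSlope (z ^ 2) 0) * deriv sineHalf z) =
        z * squeezeSlope (z ^ 2) (z ^ 2) := by linarith
    have h8 := mul_left_cancel₀ hz h7
    by_contra hneg
    nlinarith

theorem deriv_angle_pos (z : ℝ) : 0 < deriv angle z := by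
  have h := abs_lt.1 (abs_sineHalf_lt z)
  have h1 := (contDiff_sineHalf.differentiable (by simp) z).hasDerivAt
  have h2 := ((Real.hasDerivAt_arcsin h.1.ne' h.2.ne).comp z h1).const_mul 2
  have h3 : deriv angle z = _ := h2.deriv
  rw [h3]
  have h4 := deriv_sineHalf_pos z
  have h5 : 0 < 1 - sineHalf z ^ 2 := by nlinarith
  positivity

theorem strictMono_angle : StrictMono angle := strictMono_of_deriv_pos deriv_angle_pos

theorem exists_angle_eq {θ : ℝ} (h : |θ| < Real.pi) : ∃ z, angle z = θ := by
  obtain ⟨hl, hr⟩ := abs_lt.1 h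
  have hs : Real.sin (θ / 2) ^ 2 < 1 := by
    have h1 := Real.cos_pos_of_mem_Ioo (x := θ / 2) ⟨by linarith, by linarith⟩
    nlinarith [Real.sin_sq_add_cos_sq (θ / 2)]
  obtain ⟨t, ht⟩ := exists_squeeze_eq (s := Real.sin (θ / 2) ^ 2)
    (by rw [abs_of_nonneg (sq_nonneg _)]; exact hs)
  have ht0 : 0 ≤ t := by
    rw [← strictMono_squeeze.le_iff_le, squeeze_origin, ht]
    positivity
  have hcos : Real.cos (angle (√t)) = Real.cos θ := by
    rw [cos_angle, Real.sq_sqrt ht0, ht, show θ = 2 * (θ / 2) by ring, Real.cos_two_mul]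
    have := Real.sin_sq_add_cos_sq (θ / 2)
    rw [show 2 * (θ / 2) / 2 = θ / 2 by ring]
    linarith
  have h0 : 0 ≤ angle (√t) := by
    rw [← angle_zero]
    exact strictMono_angle.monotone (Real.sqrt_nonneg t)
  have h1 : angle (√t) = |θ| := by
    refine Real.injOn_cos ⟨h0, ((abs_lt.1 (abs_angle_lt _)).2).le⟩ ⟨abs_nonneg _, h.le⟩ ?_
    rw [hcos, Real.cos_abs]
  rcases le_or_gt 0 θ with h2 | h2
  · exact ⟨√t, by rw [h1, abs_of_nonneg h2]⟩
  · exact ⟨-√t, by rw [angle_neg, h1, abs_of_neg h2, neg_neg]⟩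

/-! ### Bumps and cutoffs -/

/-- The bump function in terms of the squared radius. -/
def radialBump (r : ℝ) : ℝ := Real.smoothTransition (2 - r) / 8

theorem contDiff_radialBump : ContDiff ℝ ∞ radialBump := by
  unfold radialBump
  exact (Real.smoothTransition.contDiff.comp (by fun_prop)).div_const _

theorem radialBump_of_le {r : ℝ} (h : r ≤ 1) : radialBump r = 1 / 8 := by
  rw [radialBump, Real.smoothTransition.one_of_one_le (by linarith)]

theorem radialBump_of_ge {r : ℝ} (h : 2 ≤ r) : radialBump r = 0 := by
  rw [radialBump, Real.smoothTransition.zero_of_nonpos (by linarith), zero_div]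

theorem radialBump_nonneg (r : ℝ) : 0 ≤ radialBump r :=
  div_nonneg (Real.smoothTransition.nonneg _) (by norm_num)

theorem radialBump_le (r : ℝ) : radialBump r ≤ 1 / 8 :=
  div_le_div_of_nonneg_right (Real.smoothTransition.le_one _) (by norm_num)

theorem antitone_radialBump : Antitone radialBump := fun r s h =>
  div_le_div_of_nonneg_right (Real.smoothTransition.monotone (by linarith)) (by norm_num)

/-- A smooth function that is `1` on nonnegative numbers and `0` on numbers below `-1`. -/
def cutoff (Y : ℝ) : ℝ := Real.smoothTransition (1 + Y)

theorem contDiff_cutoff : ContDiff ℝ ∞ cutoff := by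
  unfold cutoff
  exact Real.smoothTransition.contDiff.comp (by fun_prop)

theorem cutoff_of_nonneg {Y : ℝ} (h : 0 ≤ Y) : cutoff Y = 1 :=
  Real.smoothTransition.one_of_one_le (by linarith)

theorem cutoff_of_le {Y : ℝ} (h : Y ≤ -1) : cutoff Y = 0 :=
  Real.smoothTransition.zero_of_nonpos (by linarith)

/-! ## Quotients and extensions of smooth functions -/

section Quotient

variable {E : Type*} [NormedAddCommGroup E]

open Classical in
/-- The quotient of two functions, with value `1` where the denominator vanishes. -/
def ratio (f g : E → ℝ) (u : E) : ℝ := if g u = 0 then 1 else f u / g u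

variable {f g : E → ℝ}

/-- Where the functions agree locally the quotient is 1, even across zeros of the denominator;
elsewhere both are nonzero with the same sign. So only the zero sets and their neighborhoods have to
match for a smooth positive quotient to exist. -/
theorem contDiff_ratio [NormedSpace ℝ E] (hf : ContDiff ℝ ∞ f) (hg : ContDiff ℝ ∞ g)
    (h : ∀ u, f =ᶠ[𝓝 u] g ∨ 0 < f u * g u) : ContDiff ℝ ∞ (ratio f g) := by
  rw [contDiff_iff_contDiffAt]
  intro u
  rcases h u with h | h
  · refine (contDiffAt_const (c := (1 : ℝ))).congr_of_eventuallyEq ?_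
    filter_upwards [h] with v hv
    by_cases h0 : g v = 0
    · simp [ratio, h0]
    · simp [ratio, h0, hv]
  · have h0 : g u ≠ 0 := right_ne_zero_of_mul h.ne'
    refine (hf.contDiffAt.div hg.contDiffAt h0).congr_of_eventuallyEq ?_
    filter_upwards [hg.continuous.continuousAt.eventually_ne h0] with v hv
    simp [ratio, hv]

theorem ratio_pos (h : ∀ u, f =ᶠ[𝓝 u] g ∨ 0 < f u * g u) (u : E) : 0 < ratio f g u := by
  rw [ratio]
  split_ifs with h0
  · exact one_pos
  · rcases h u with h | h
    · rw [h.self_of_nhds, div_self h0]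
      exact one_pos
    · rwa [div_pos_iff, ← mul_pos_iff]

theorem ratio_mul (h : ∀ u, f =ᶠ[𝓝 u] g ∨ 0 < f u * g u) (u : E) : ratio f g u * g u = f u := by
  rw [ratio]
  split_ifs with h0
  · rcases h u with h | h
    · rw [h.self_of_nhds, one_mul]
    · simp [h0] at h
  · field_simp

end Quotient

section Extension

variable {E : Type*} [NormedAddCommGroup E] {β : E → E} {F : E → ℝ}

theorem extend_eventuallyEq_zero (hβ : Continuous β) (hi : Function.Injective β)
    (hF : HasCompactSupport F) {p : E} (hp : p ∉ Set.range β) :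
    Function.extend β F 0 =ᶠ[𝓝 p] 0 := by
  have hK : IsClosed (β '' tsupport F) := (hF.isCompact.image hβ).isClosed
  have hpK : p ∉ β '' tsupport F := fun ⟨u, _, hu⟩ => hp ⟨u, hu⟩
  filter_upwards [hK.isOpen_compl.mem_nhds hpK] with q hq
  by_cases h : ∃ u, β u = q
  · obtain ⟨u, rfl⟩ := h
    rw [hi.extend_apply]
    exact image_eq_zero_of_notMem_tsupport fun hu => hq ⟨u, hu, rfl⟩
  · simp [Function.extend_apply' _ _ _ h]

/-- A compactly supported smooth function extends by zero along a smooth open embedding. -/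
theorem contDiff_extend [NormedSpace ℝ E] [FiniteDimensional ℝ E] (hβ : ContDiff ℝ ∞ β) (hi : Function.Injective β)
    (hb : ∀ p, Function.Bijective (fderiv ℝ β p)) (hF : ContDiff ℝ ∞ F)
    (hc : HasCompactSupport F) : ContDiff ℝ ∞ (Function.extend β F 0) := by
  rw [contDiff_iff_contDiffAt]
  intro p
  by_cases hp : p ∈ Set.range β
  · obtain ⟨u, rfl⟩ := hp
    refine (hF.contDiffAt.comp (β u) (contDiffAt_invFun hβ hi hb u)).congr_of_eventuallyEq ?_
    filter_upwards [(isOpenEmbedding_of_fderiv_bijective hβ hi hb).isOpen_range.mem_nhds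
      ⟨u, rfl⟩] with q hq
    obtain ⟨v, rfl⟩ := hq
    simp [hi.extend_apply, Function.leftInverse_invFun hi v]
  · exact (contDiffAt_const (c := (0 : ℝ))).congr_of_eventuallyEq
      (extend_eventuallyEq_zero hβ.continuous hi hc hp)

end Extension

/-! ## The coordinate patches -/

theorem hasDerivAt_slice_zero {V : Type*} [NormedAddCommGroup V] [NormedSpace ℝ V] {f : R2 → V}
    (hf : ContDiff ℝ ∞ f) (u : R2) :
    HasDerivAt (fun x => f !₂[x, u 1]) (fderiv ℝ f u (EuclideanSpace.single 0 1)) (u 0) := by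
  have h1 : HasDerivAt (fun x : ℝ => u + (x - u 0) • (EuclideanSpace.single 0 1 : R2))
      (EuclideanSpace.single 0 1) (u 0) := by
    simpa using (((hasDerivAt_id (u 0)).sub_const (u 0)).smul_const
      (EuclideanSpace.single 0 1 : R2)).const_add u
  have h2 : HasFDerivAt f (fderiv ℝ f u) (u + (u 0 - u 0) • (EuclideanSpace.single 0 1 : R2)) := by
    simpa using (hf.differentiable (by simp) u).hasFDerivAt
  refine (h2.comp_hasDerivAt (u 0) h1).congr_of_eventuallyEq (.of_forall fun x => ?_)
  simp only [Function.comp_apply]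
  congr 1
  ext i
  fin_cases i <;> simp

theorem hasDerivAt_slice_one {V : Type*} [NormedAddCommGroup V] [NormedSpace ℝ V] {f : R2 → V}
    {L : R2 →L[ℝ] V} {u : R2} (hf : HasFDerivAt f L u) :
    HasDerivAt (fun Y => f !₂[u 0, Y]) (L (EuclideanSpace.single 1 1)) (u 1) := by
  have h1 : HasDerivAt (fun x : ℝ => u + (x - u 1) • (EuclideanSpace.single 1 1 : R2))
      (EuclideanSpace.single 1 1) (u 1) := by
    simpa using (((hasDerivAt_id (u 1)).sub_const (u 1)).smul_const
      (EuclideanSpace.single 1 1 : R2)).const_add u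
  have h2 : HasFDerivAt f L (u + (u 1 - u 1) • (EuclideanSpace.single 1 1 : R2)) := by
    simpa using hf
  refine (h2.comp_hasDerivAt (u 1) h1).congr_of_eventuallyEq (.of_forall fun x => ?_)
  simp only [Function.comp_apply]
  congr 1
  ext i
  fin_cases i <;> simp

/-- A coordinate patch given by a function `Z` that is increasing in the first coordinate. -/
def squeezeChart (c center : ℝ) {Z : R2 → ℝ} (hZ : ContDiff ℝ ∞ Z)
    (hder : ∀ u, 0 < fderiv ℝ Z u (EuclideanSpace.single 0 1)) : ColumnChart where
  arg u := center + angle (Z u)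
  radius Y := squeeze (Y + c) - squeeze c
  slope Y := squeezeSlope (Y + c) c
  center := center
  contDiff_arg := contDiff_const.add (contDiff_angle.comp hZ)
  contDiff_radius := (contDiff_squeeze.comp (by fun_prop)).sub contDiff_const
  contDiff_slope := contDiff_squeezeSlope (by fun_prop) (by fun_prop)
  slope_pos Y := squeezeSlope_pos _ _
  radius_eq Y := by rw [squeeze_sub]; ring
  radius_lt Y := by
    have h1 := abs_lt.1 (abs_squeeze_lt (Y + c))
    have h2 := abs_lt.1 (abs_squeeze_lt c)
    linarith
  deriv_radius_pos Y := by
    have h := ((hasDerivAt_squeeze (Y + c)).comp_add_const Y c).sub_const (squeeze c)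
    rw [h.deriv]
    exact squeezeSlope_pos _ _
  arg_injective u v h1 h2 := by
    have h3 : Z u = Z v := strictMono_angle.injective (by linarith)
    have h4 : StrictMono fun x => Z !₂[x, u 1] := strictMono_of_deriv_pos fun x => by
      have := hasDerivAt_slice_zero hZ !₂[x, u 1]
      simp only [Matrix.cons_val_one, Matrix.cons_val_zero] at this
      rw [this.deriv]
      exact hder _
    apply h4.injective
    have e : ∀ w : R2, (!₂[w 0, w 1] : R2) = w := fun w => by
      ext i
      fin_cases i <;> simp
    change Z !₂[u 0, u 1] = Z !₂[v 0, u 1]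
    rw [e, h1, e, h3]
  fderiv_arg_ne_zero u := by
    have h1 := (hZ.differentiable (by simp) u).hasFDerivAt
    have h2 := (contDiff_angle.differentiable (by simp) (Z u)).hasDerivAt.comp_hasFDerivAt u h1
    have h3 : HasFDerivAt (fun u => center + angle (Z u)) _ u := h2.const_add center
    rw [h3.fderiv]
    exact (mul_pos (deriv_angle_pos (Z u)) (hder u)).ne'
  abs_arg_sub_lt u := by simpa using abs_angle_lt (Z u)

theorem exists_abs_lt_pi {θ : ℝ} (h : Real.cos θ ≠ -1) :
    ∃ θ', |θ'| < Real.pi ∧ Circle.exp θ' = Circle.exp θ := by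
  obtain ⟨h1, h2⟩ := toIocMod_mem_Ioc Real.two_pi_pos (-Real.pi) θ
  set θ' := toIocMod Real.two_pi_pos (-Real.pi) θ with hθ'
  have h3 : Circle.exp θ' = Circle.exp θ := by
    rw [Circle.exp_eq_exp]
    refine ⟨-toIocDiv Real.two_pi_pos (-Real.pi) θ, ?_⟩
    rw [hθ', toIocMod, zsmul_eq_mul]
    push_cast
    ring
  refine ⟨θ', abs_lt.2 ⟨h1, lt_of_le_of_ne (by linarith) fun h4 => h ?_⟩, h3⟩
  rw [← coe_circleExp_re, ← h3, h4, coe_circleExp_re, Real.cos_pi]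

/-- Such a patch is a full sector: all angles except the one opposite to `center`, and all
logarithmic radii in an interval of length 2 around `-squeeze c`. -/
theorem mem_range_squeezeChart {c center : ℝ} {Z : R2 → ℝ} (hZ : ContDiff ℝ ∞ Z)
    (hder : ∀ u, 0 < fderiv ℝ Z u (EuclideanSpace.single 0 1))
    (hsurj : ∀ Y z, ∃ x, Z !₂[x, Y] = z) {θ X : ℝ} (hθ : Real.cos (θ - center) ≠ -1)
    (hX : |X + squeeze c| < 1) :
    polar θ X ∈ Set.range (squeezeChart c center hZ hder).base := by
  obtain ⟨θ', h1, h2⟩ := exists_abs_lt_pi hθ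
  obtain ⟨z, hz⟩ := exists_angle_eq h1
  obtain ⟨t, ht⟩ := exists_squeeze_eq hX
  obtain ⟨x, hx⟩ := hsurj (t - c) z
  refine ⟨!₂[x, t - c], ?_⟩
  rw [ColumnChart.base_eq, polar_eq_polar_iff]
  constructor
  · change Circle.exp (center + angle (Z !₂[x, t - c])) = _
    rw [hx, hz, Circle.exp_add, h2, ← Circle.exp_add]
    congr 1
    ring
  · change squeeze ((!₂[x, t - c] : R2) 1 + c) - squeeze c = X
    simp [ht]

/-! ## The height functions -/

theorem norm_polar (θ X : ℝ) : ‖polar θ X‖ = Real.exp X := by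
  have h := polar_sq θ X
  rw [EuclideanSpace.norm_eq, Fin.sum_univ_two, Real.norm_eq_abs, Real.norm_eq_abs, sq_abs, sq_abs,
    h, Real.sqrt_sq (Real.exp_pos X).le]

/-- The function `X - cos θ / 2` in logarithmic polar coordinates. -/
def middleHeight (p : R2) : ℝ := Real.log ‖p‖ - p 0 / (2 * ‖p‖)

theorem middleHeight_polar (θ X : ℝ) : middleHeight (polar θ X) = X - Real.cos θ / 2 := by
  rw [middleHeight, norm_polar, Real.log_exp, polar_zero]
  have := Real.exp_pos X
  field_simp

theorem contDiffAt_middleHeight {p : R2} (hp : p ≠ 0) : ContDiffAt ℝ ∞ middleHeight p := by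
  have h1 : ContDiffAt ℝ ∞ (fun p : R2 => ‖p‖) p := contDiffAt_norm ℝ hp
  have h2 : ‖p‖ ≠ 0 := norm_ne_zero_iff.2 hp
  unfold middleHeight
  exact (h1.log h2).sub (ContDiffAt.div (by fun_prop) (by fun_prop) (by positivity))

/-- Along a ray the function is X plus a constant. -/
theorem fderiv_middleHeight_ne_zero (θ X : ℝ) : fderiv ℝ middleHeight (polar θ X) ≠ 0 := by
  intro h0
  have h1 := ((contDiffAt_middleHeight (polar_ne_zero θ X)).differentiableAt (by simp)).hasFDerivAt
  have h2 : DifferentiableAt ℝ (fun X => polar θ X) X := by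
    have := contDiff_polarMap.comp (f := fun X : ℝ => (!₂[θ, X] : R2)) (by
      rw [contDiff_euclidean]
      intro i
      fin_cases i <;> simp <;> fun_prop)
    exact (this.differentiable (by simp) X).congr_of_eventuallyEq
      (.of_forall fun X => by simp [polarMap])
  have h3 := h1.comp_hasDerivAt X h2.hasDerivAt
  rw [h0] at h3
  have h4 := h3.unique (((hasDerivAt_id X).sub_const (Real.cos θ / 2)).congr_of_eventuallyEq
    (.of_forall fun X => by simp [middleHeight_polar]))
  simp at h4

/-- The middle height function, changed in a coordinate patch. -/
def bumpedHeight (C : ColumnChart) (k : R2 → ℝ) (s : ℝ) (p : R2) : ℝ := middleHeight p +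
  Function.extend C.base
    (fun u => s * k u * radialBump (u 0 ^ 2 + u 1) * cutoff (u 1)) 0 p

section Bumped

variable {C : ColumnChart} {k : R2 → ℝ} {s : ℝ}

theorem contDiff_bumpTerm (hk : ContDiff ℝ ∞ k) :
    ContDiff ℝ ∞ fun u : R2 => s * k u * radialBump (u 0 ^ 2 + u 1) * cutoff (u 1) := by
  have h1 := contDiff_radialBump
  have h2 := contDiff_cutoff
  fun_prop

/-- The bump depends on x² + Y, which is bounded above on an unbounded region with Y negative. The
cutoff removes that region without changing anything over the annulus, where Y ≥ 0. -/
theorem hasCompactSupport_bumpTerm :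
    HasCompactSupport fun u : R2 => s * k u * radialBump (u 0 ^ 2 + u 1) * cutoff (u 1) := by
  refine HasCompactSupport.intro (isCompact_closedBall 0 3) fun u hu => ?_
  have h1 : 9 < u 0 ^ 2 + u 1 ^ 2 := by
    rw [mem_closedBall_zero_iff, not_le, EuclideanSpace.norm_eq, Fin.sum_univ_two,
      Real.norm_eq_abs, Real.norm_eq_abs, sq_abs, sq_abs, Real.lt_sqrt (by norm_num)] at hu
    linarith
  rcases le_or_gt (u 1) (-1) with h2 | h2
  · simp [cutoff_of_le h2]
  · have h3 : 2 ≤ u 0 ^ 2 + u 1 := by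
      by_contra h4
      nlinarith [sq_nonneg (u 0)]
    simp [radialBump_of_ge h3]

theorem contDiffAt_bumpedHeight (hk : ContDiff ℝ ∞ k) {p : R2} (hp : p ≠ 0) :
    ContDiffAt ℝ ∞ (bumpedHeight C k s) p :=
  (contDiffAt_middleHeight hp).add (contDiff_extend C.contDiff_base C.base_injective
    C.bijective_fderiv_base (contDiff_bumpTerm hk) hasCompactSupport_bumpTerm).contDiffAt

theorem bumpedHeight_base {u : R2} (hu : 0 ≤ u 1) : bumpedHeight C k s (C.base u) =
    middleHeight (C.base u) + s * k u * radialBump (u 0 ^ 2 + u 1) := by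
  rw [bumpedHeight, C.base_injective.extend_apply, cutoff_of_nonneg hu, mul_one]

theorem bumpedHeight_eventuallyEq {p : R2} (hp : p ∉ Set.range C.base) :
    bumpedHeight C k s =ᶠ[𝓝 p] middleHeight := by
  filter_upwards [extend_eventuallyEq_zero C.contDiff_base.continuous C.base_injective
    (hasCompactSupport_bumpTerm (k := k) (s := s)) hp] with q hq
  simp [bumpedHeight, hq]

theorem bumpedHeight_of_notMem {p : R2} (hp : p ∉ Set.range C.base) :
    bumpedHeight C k s p = middleHeight p := (bumpedHeight_eventuallyEq hp).self_of_nhds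

end Bumped

/-! ### The patch in which a double arc is created -/

/-- The patch in which a double arc is created. -/
def arcChart : ColumnChart := squeezeChart (-(1 / 8)) 0 (Z := fun u : R2 => u 0) (by fun_prop)
  fun u => by
    have h : HasFDerivAt (fun u : R2 => u 0) _ u := hasFDerivAt_coord 0 u
    rw [h.fderiv, coordProj_apply]
    simp

theorem arcChart_base (u : R2) :
    arcChart.base u = polar (angle (u 0)) (squeeze (u 1 - 1 / 8) + 1 / 2) := by
  rw [ColumnChart.base_eq]
  congr 1
  · simp [arcChart, squeezeChart]
  · simp only [arcChart, squeezeChart, squeeze_neg, squeeze_eighth]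
    ring_nf

theorem mem_range_arcChart {θ X : ℝ} (hθ : Real.cos θ ≠ -1) (h1 : -1 / 2 < X) (h2 : X < 3 / 2) :
    polar θ X ∈ Set.range arcChart.base := by
  refine mem_range_squeezeChart _ _ (fun Y z => ⟨z, by simp⟩) (by simpa using hθ) ?_
  rw [squeeze_neg, squeeze_eighth, abs_lt]
  constructor <;> linarith

/-- The bump equals its plateau 1/8 while x² + Y < 1; beyond, both functions are positive. -/
theorem arcRatio_aux (u : R2) :
    (fun u : R2 => u 0 ^ 2 + u 1 - 1 / 8) =ᶠ[𝓝 u]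
      (fun u : R2 => u 0 ^ 2 + u 1 - radialBump (u 0 ^ 2 + u 1)) ∨
    0 < (u 0 ^ 2 + u 1 - 1 / 8) * (u 0 ^ 2 + u 1 - radialBump (u 0 ^ 2 + u 1)) := by
  rcases lt_or_ge (u 0 ^ 2 + u 1) 1 with h | h
  · left
    have hc : Continuous fun u : R2 => u 0 ^ 2 + u 1 := by fun_prop
    filter_upwards [hc.continuousAt.eventually_lt_const h] with v hv
    rw [radialBump_of_le hv.le]
  · right
    have := radialBump_le (u 0 ^ 2 + u 1)
    exact mul_pos (by linarith) (by linarith)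

/-- The vertical scale in the patch `arcChart`. -/
def arcScale (u : R2) : ℝ := squeezeSlope (u 0 ^ 2) (1 / 8 - u 1) *
  ratio (fun u : R2 => u 0 ^ 2 + u 1 - 1 / 8)
    (fun u : R2 => u 0 ^ 2 + u 1 - radialBump (u 0 ^ 2 + u 1)) u

theorem contDiff_arcScale : ContDiff ℝ ∞ arcScale := by
  have h := contDiff_radialBump
  exact (contDiff_squeezeSlope (by fun_prop) (by fun_prop)).mul
    (contDiff_ratio (by fun_prop) (by fun_prop) arcRatio_aux)

theorem arcScale_pos (u : R2) : 0 < arcScale u :=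
  mul_pos (squeezeSlope_pos _ _) (ratio_pos arcRatio_aux u)

/-- In this patch X - cos θ / 2 is squeeze(Y - 1/8) + squeeze(x²), that is, squeeze(x²) -
squeeze(1/8 - Y), a positive multiple of x² + Y - 1/8. -/
theorem middleHeight_arcChart (u : R2) : middleHeight (arcChart.base u) =
    arcScale u * (u 0 ^ 2 + u 1 - radialBump (u 0 ^ 2 + u 1)) := by
  rw [arcScale, mul_assoc, ratio_mul arcRatio_aux u, arcChart_base, middleHeight_polar, cos_angle]
  have h := squeeze_sub (u 0 ^ 2) (1 / 8 - u 1)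
  have h2 := squeeze_neg (1 / 8 - u 1)
  rw [neg_sub] at h2
  rw [h2]
  linear_combination h

/-- The height function of the diagram without double points. -/
def emptyHeight : R2 → ℝ := bumpedHeight arcChart arcScale 2

theorem emptyHeight_arcChart {u : R2} (hu : 0 ≤ u 1) : emptyHeight (arcChart.base u) =
    arcScale u * (u 0 ^ 2 + u 1 + radialBump (u 0 ^ 2 + u 1)) := by
  rw [emptyHeight, bumpedHeight_base hu, middleHeight_arcChart]
  ring

/-- In the patch the sign of the bump term has been reversed, leaving a positive factor times x² + Y
+ bump. A point of the annulus outside the patch has cos θ = -1 or X ≥ 3/2, where `middleHeight` is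
positive. -/
theorem emptyHeight_pos {θ X : ℝ} (hX : 0 ≤ X) : 0 < emptyHeight (polar θ X) := by
  by_cases hp : polar θ X ∈ Set.range arcChart.base
  · obtain ⟨u, hu⟩ := hp
    have hu1 : 0 ≤ u 1 := by
      rw [arcChart_base, polar_eq_polar_iff] at hu
      by_contra hneg
      have h1 : squeeze (u 1 - 1 / 8) < squeeze (-(1 / 8)) := strictMono_squeeze (by linarith)
      rw [squeeze_neg, squeeze_eighth] at h1
      linarith [hu.2]
    rw [← hu, emptyHeight_arcChart hu1]
    refine mul_pos (arcScale_pos u) ?_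
    have h0 := sq_nonneg (u 0)
    rcases le_or_gt (u 0 ^ 2 + u 1) 1 with h | h
    · rw [radialBump_of_le h]
      linarith
    · have := radialBump_nonneg (u 0 ^ 2 + u 1)
      linarith
  · rw [emptyHeight, bumpedHeight_of_notMem hp, middleHeight_polar]
    have h1 := Real.cos_le_one θ
    by_contra hneg
    by_cases hθ : Real.cos θ = -1
    · rw [hθ] at hneg
      linarith
    · exact hp (mem_range_arcChart hθ (by linarith) (by linarith))

theorem isRingHeight_emptyHeight : IsRingHeight emptyHeight where
  smooth _ hp := contDiffAt_bumpedHeight contDiff_arcScale hp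
  transverse _ _ h1 _ h := absurd h (emptyHeight_pos h1.le).ne'
  outer _ := (emptyHeight_pos (by norm_num)).ne'
  inner _ h := absurd h (emptyHeight_pos le_rfl).ne'

/-! ### The patches around the branch points -/

/-- The function `s ↦ s / √(1 + s²)`. -/
def softSign (s : ℝ) : ℝ := s / √(1 + s ^ 2)

theorem hasDerivAt_softSign (s : ℝ) : HasDerivAt softSign (1 / √(1 + s ^ 2) ^ 3) s := by
  have h0 : 0 < 1 + s ^ 2 := by positivity
  have hs := Real.sq_sqrt h0.le
  have h1 : 0 < √(1 + s ^ 2) := Real.sqrt_pos.2 h0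
  have h2 := (hasDerivAt_id s).div (((hasDerivAt_pow 2 s).const_add 1).sqrt h0.ne') h1.ne'
  refine h2.congr_deriv ?_
  simp only [id]
  field_simp
  rw [hs]
  ring

theorem contDiff_sqrt_one_add : ContDiff ℝ ∞ fun s : ℝ => √(1 + s ^ 2) :=
  ContDiff.sqrt (by fun_prop) fun s => by positivity

theorem contDiff_softSign : ContDiff ℝ ∞ softSign :=
  contDiff_id.div contDiff_sqrt_one_add fun s => by positivity

theorem abs_softSign_lt (s : ℝ) : |softSign s| < 1 := by
  have h0 : 0 < 1 + s ^ 2 := by positivity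
  rw [← sq_lt_one_iff_abs_lt_one, softSign, div_pow, Real.sq_sqrt h0.le, div_lt_one h0]
  linarith

theorem strictMono_softSign : StrictMono softSign := strictMono_of_deriv_pos fun s => by
  rw [(hasDerivAt_softSign s).deriv]
  positivity

theorem abs_half_softSign_sub_lt (a b : ℝ) : |(softSign a - softSign b) / 2| < 1 := by
  have h1 := abs_lt.1 (abs_softSign_lt a)
  have h2 := abs_lt.1 (abs_softSign_lt b)
  rw [abs_lt]
  constructor <;> linarith

theorem contDiff_arcsin_softSign :
    ContDiff ℝ ∞ fun u : R2 => Real.arcsin ((softSign (u 0) - softSign (u 1)) / 2) := by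
  rw [contDiff_iff_contDiffAt]
  intro u
  have h := abs_lt.1 (abs_half_softSign_sub_lt (u 0) (u 1))
  have h1 := contDiff_softSign
  have h2 : ContDiff ℝ ∞ fun u : R2 => (softSign (u 0) - softSign (u 1)) / 2 := by fun_prop
  exact ContDiffAt.comp (g := Real.arcsin) u (Real.contDiffAt_arcsin h.1.ne' h.2.ne) h2.contDiffAt

/-- The patches around the branch points of the middle diagram. -/
def branchChart (e : ℝ) (he : e = 1 ∨ e = -1) : ColumnChart where
  arg u := e * (Real.pi / 2 + Real.arcsin ((softSign (u 0) - softSign (u 1)) / 2))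
  radius Y := softSign Y / 4
  slope Y := 1 / (4 * √(1 + Y ^ 2))
  center := e * (Real.pi / 2)
  contDiff_arg := contDiff_const.mul (contDiff_const.add contDiff_arcsin_softSign)
  contDiff_radius := contDiff_softSign.div_const _
  contDiff_slope := contDiff_const.div (contDiff_const.mul contDiff_sqrt_one_add)
    fun Y => by positivity
  slope_pos Y := by positivity
  radius_eq Y := by
    have : 0 < √(1 + Y ^ 2) := by positivity
    rw [softSign]
    field_simp
  radius_lt Y := by linarith [(abs_lt.1 (abs_softSign_lt Y)).2]
  deriv_radius_pos Y := by
    rw [((hasDerivAt_softSign Y).div_const 4).deriv]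
    positivity
  arg_injective u v h1 h2 := by
    have he0 : e ≠ 0 := by rcases he with rfl | rfl <;> norm_num
    have h3 := add_left_cancel (mul_left_cancel₀ he0 h2)
    have hu := abs_lt.1 (abs_half_softSign_sub_lt (u 0) (u 1))
    have hv := abs_lt.1 (abs_half_softSign_sub_lt (v 0) (v 1))
    have h4 := Real.injOn_arcsin ⟨hu.1.le, hu.2.le⟩ ⟨hv.1.le, hv.2.le⟩ h3
    rw [h1] at h4
    exact strictMono_softSign.injective (by linarith)
  fderiv_arg_ne_zero u := by
    have he0 : e ≠ 0 := by rcases he with rfl | rfl <;> norm_num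
    have h := abs_lt.1 (abs_half_softSign_sub_lt (u 0) (u 1))
    have h1 := hasDerivAt_slice_zero (contDiff_arcsin_softSign.const_smul e |>.add
      (contDiff_const (c := e * (Real.pi / 2)))) u
    have h2 := (((hasDerivAt_softSign (u 0)).sub_const (softSign (u 1))).div_const 2)
    have h3 := (((Real.hasDerivAt_arcsin h.1.ne' h.2.ne).comp (u 0) h2).const_mul e).add_const
      (e * (Real.pi / 2))
    have h4 := h1.unique (h3.congr_of_eventuallyEq (.of_forall fun x => by simp))
    have h5 : (fun u : R2 => e * (Real.pi / 2 +
        Real.arcsin ((softSign (u 0) - softSign (u 1)) / 2))) = fun u : R2 =>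
        e • Real.arcsin ((softSign (u 0) - softSign (u 1)) / 2) + e * (Real.pi / 2) := by
      funext u
      simp only [smul_eq_mul]
      ring
    rw [h5, h4]
    have h6 : 0 < 1 - ((softSign (u 0) - softSign (u 1)) / 2) ^ 2 := by nlinarith
    refine mul_ne_zero he0 (ne_of_gt ?_)
    positivity
  abs_arg_sub_lt u := by
    have h := abs_lt.1 (abs_half_softSign_sub_lt (u 0) (u 1))
    have h1 := Real.neg_pi_div_two_lt_arcsin.2 h.1
    have h2 := Real.arcsin_lt_pi_div_two.2 h.2
    have hpi := Real.pi_pos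
    rw [abs_lt]
    rcases he with rfl | rfl <;> constructor <;> linarith

/-- The patch is designed so that cos θ = (softSign Y - softSign x) / 2 and X = softSign Y / 4. The
terms in Y cancel, leaving softSign x / 4, a positive multiple of x, which is the slope of the
Whitney umbrella. -/
theorem middleHeight_branchChart (e : ℝ) (he : e = 1 ∨ e = -1) (u : R2) :
    middleHeight ((branchChart e he).base u) = 1 / (4 * √(1 + u 0 ^ 2)) * u 0 := by
  rw [ColumnChart.base_eq, middleHeight_polar]
  have h := abs_lt.1 (abs_half_softSign_sub_lt (u 0) (u 1))
  have h1 : Real.cos ((branchChart e he).arg u) = -((softSign (u 0) - softSign (u 1)) / 2) := by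
    rw [← Real.sin_arcsin h.1.le h.2.le]
    change Real.cos (e * (Real.pi / 2 + _)) = _
    rcases he with rfl | rfl
    · rw [one_mul, add_comm, Real.cos_add_pi_div_two]
    · rw [neg_one_mul, Real.cos_neg, add_comm, Real.cos_add_pi_div_two]
  have h2 : (branchChart e he).radius (u 1) = softSign (u 1) / 4 := rfl
  have h3 : 1 / (4 * √(1 + u 0 ^ 2)) * u 0 = softSign (u 0) / 4 := by
    have : 0 < √(1 + u 0 ^ 2) := by positivity
    rw [softSign]
    field_simp
  rw [h1, h2, h3]
  ring

theorem exists_circleExp_eq_of_cos_eq_zero {θ : ℝ} (h : Real.cos θ = 0) :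
    ∃ e : ℝ, (e = 1 ∨ e = -1) ∧ Circle.exp θ = Circle.exp (e * (Real.pi / 2)) := by
  have h1 : Real.sin θ = 1 ∨ Real.sin θ = -1 := by
    have := Real.sin_sq_add_cos_sq θ
    rw [h] at this
    exact sq_eq_one_iff.1 (by linarith)
  refine ⟨Real.sin θ, h1, Circle.ext (Complex.ext ?_ ?_)⟩
  · rw [coe_circleExp_re, coe_circleExp_re, h]
    rcases h1 with h1 | h1 <;> simp [h1]
  · rw [coe_circleExp_im, coe_circleExp_im]
    rcases h1 with h1 | h1 <;> simp [h1]

theorem isRingHeight_middleHeight : IsRingHeight middleHeight where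
  smooth _ hp := contDiffAt_middleHeight hp
  transverse θ X _ _ _ := fderiv_middleHeight_ne_zero θ X
  outer θ := by
    rw [middleHeight_polar]
    have := Real.cos_le_one θ
    linarith
  inner θ h := by
    rw [middleHeight_polar] at h
    -- The two branch points are at θ = π/2 and θ = -π/2 on the inner circle, one for each sign `e`.
    obtain ⟨e, he, h1⟩ := exists_circleExp_eq_of_cos_eq_zero (θ := θ) (by linarith)
    have h2 := (branchChart e he).isWhitneyUmbrellaAt (H := middleHeight)
      (k := fun u => 1 / (4 * √(1 + u 0 ^ 2)))
      (contDiff_const.div (contDiff_const.mul (contDiff_sqrt_one_add.comp (by fun_prop)))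
        fun Y => by positivity)
      (fun u => by positivity) fun u _ => (middleHeight_branchChart e he u).symm
    have h3 : torusCover !₂[θ, 0] = torusCover !₂[(branchChart e he).arg 0, 0] := by
      simp [torusCover, branchChart, h1]
    rw [h3]
    exact h2

/-- The creation of the double arc. -/
theorem moved_empty_middle : SurfaceKnotDiagram.Moved moveB1
    (ringDiagram emptyHeight isRingHeight_emptyHeight)
    (ringDiagram middleHeight isRingHeight_middleHeight) := by
  have h1 : moveB1 = ColumnChart.oddPicture
      (fun t u => u 0 ^ 2 + u 1 + t * radialBump (u 0 ^ 2 + u 1)) := by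
    unfold moveB1 ColumnChart.oddPicture
    congr 1
    funext t i
    rw [Subsingleton.elim i 0]
    change kinkSheet (fun u => u 0 ^ 2 + t * bump u) = _
    funext u
    ext j
    fin_cases j <;> simp [kinkSheet, oddSheet, bump, radialBump]
    left
    ring
  rw [h1]
  refine ColumnChart.moved _ _ (C := arcChart) contDiff_arcScale arcScale_pos (fun u hu => ?_)
    (fun u hu => ?_) fun p hp => (bumpedHeight_of_notMem hp).symm
  · rw [emptyHeight_arcChart hu, one_mul]
  · rw [middleHeight_arcChart]
    ring

/-! ### The patch in which two double arcs are joined -/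

/-- A smooth increasing function that is `0` below `1/4` and `1` above `1/2`. -/
def stepUp (w : ℝ) : ℝ := Real.smoothTransition (4 * w - 1)

theorem contDiff_stepUp : ContDiff ℝ ∞ stepUp := by
  unfold stepUp
  exact Real.smoothTransition.contDiff.comp (by fun_prop)

theorem stepUp_nonneg (w : ℝ) : 0 ≤ stepUp w := Real.smoothTransition.nonneg _

theorem stepUp_le_one (w : ℝ) : stepUp w ≤ 1 := Real.smoothTransition.le_one _

theorem stepUp_of_le {w : ℝ} (h : w ≤ 1 / 4) : stepUp w = 0 :=
  Real.smoothTransition.zero_of_nonpos (by linarith)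

theorem stepUp_of_ge {w : ℝ} (h : 1 / 2 ≤ w) : stepUp w = 1 :=
  Real.smoothTransition.one_of_one_le (by linarith)

theorem monotone_stepUp : Monotone stepUp := fun v w h =>
  Real.smoothTransition.monotone (by linarith)

theorem contDiff_stepUp_div : ContDiff ℝ ∞ fun w => stepUp w / w := by
  rw [contDiff_iff_contDiffAt]
  intro w
  rcases lt_or_ge w (1 / 4) with h | h
  · refine (contDiffAt_const (c := (0 : ℝ))).congr_of_eventuallyEq ?_
    filter_upwards [eventually_lt_nhds h] with v hv
    simp [stepUp_of_le hv.le]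
  · exact contDiff_stepUp.contDiffAt.div contDiffAt_id (ne_of_gt (show (0 : ℝ) < w by linarith))

/-- The correction of the first coordinate, as a function of its square `w`. -/
def spliceTerm (Y w : ℝ) : ℝ := (1 / 8 - radialBump (w + Y)) * stepUp w

theorem spliceTerm_le_eighth (Y w : ℝ) : spliceTerm Y w ≤ 1 / 8 := by
  have h1 := radialBump_le (w + Y)
  have h2 := radialBump_nonneg (w + Y)
  have h3 := stepUp_nonneg w
  have h4 := stepUp_le_one w
  unfold spliceTerm
  nlinarith

/-- Both factors are nonnegative and increasing, in x² + Y and in x² respectively. This drives the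
monotonicity arguments for `spliceCoord` and `loopHeight`. -/
theorem spliceTerm_mono {Y w Y' w' : ℝ} (hw : w ≤ w') (hr : w + Y ≤ w' + Y') :
    spliceTerm Y w ≤ spliceTerm Y' w' :=
  mul_le_mul (by linarith [antitone_radialBump hr]) (monotone_stepUp hw) (stepUp_nonneg w)
    (by linarith [radialBump_le (w' + Y')])

theorem contDiff_spliceTerm (Y : ℝ) : ContDiff ℝ ∞ (spliceTerm Y) := by
  have h1 := contDiff_radialBump
  have h2 := contDiff_stepUp
  unfold spliceTerm
  fun_prop

/-- The corrected first coordinate. -/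
def spliceCoord (u : R2) : ℝ :=
  u 0 * √(1 + (1 / 8 - radialBump (u 0 ^ 2 + u 1)) * (stepUp (u 0 ^ 2) / u 0 ^ 2))

theorem spliceRoot_nonneg (u : R2) :
    0 ≤ (1 / 8 - radialBump (u 0 ^ 2 + u 1)) * (stepUp (u 0 ^ 2) / u 0 ^ 2) :=
  mul_nonneg (by linarith [radialBump_le (u 0 ^ 2 + u 1)]) (div_nonneg (stepUp_nonneg _)
    (sq_nonneg _))

theorem contDiff_spliceRoot : ContDiff ℝ ∞ fun u : R2 =>
    √(1 + (1 / 8 - radialBump (u 0 ^ 2 + u 1)) * (stepUp (u 0 ^ 2) / u 0 ^ 2)) := by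
  have h1 := contDiff_radialBump
  have h2 : ContDiff ℝ ∞ fun u : R2 => stepUp (u 0 ^ 2) / u 0 ^ 2 :=
    contDiff_stepUp_div.comp (by fun_prop)
  exact ContDiff.sqrt (by fun_prop) fun u => by linarith [spliceRoot_nonneg u]

theorem contDiff_spliceCoord : ContDiff ℝ ∞ spliceCoord := by
  have h := contDiff_spliceRoot
  unfold spliceCoord
  fun_prop

/-- The zero curve Y = x² - bump of the B2 model leaves the region where the bump is 1/8, so x
itself cannot serve as angular coordinate. Its square is corrected by 1/8 - bump where x² is large;
`stepUp` vanishes for small x² to keep the division by x² smooth. -/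
theorem spliceCoord_sq (u : R2) : spliceCoord u ^ 2 = u 0 ^ 2 + spliceTerm (u 1) (u 0 ^ 2) := by
  rw [spliceCoord, mul_pow, Real.sq_sqrt (by linarith [spliceRoot_nonneg u]), spliceTerm]
  by_cases h : u 0 = 0
  · simp [h, stepUp_of_le]
  · field_simp

/-- At x = 0 the derivative is the square root in the definition. Elsewhere the square of the
coordinate is x² plus a monotone function of x²; differentiating and cancelling x gives a positive
value. -/
theorem fderiv_spliceCoord_pos (u : R2) :
    0 < fderiv ℝ spliceCoord u (EuclideanSpace.single 0 1) := by
  have h1 := hasDerivAt_slice_zero contDiff_spliceCoord u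
  have h2 := hasDerivAt_slice_zero contDiff_spliceRoot u
  set c := fderiv ℝ spliceCoord u (EuclideanSpace.single 0 1)
  set R := √(1 + (1 / 8 - radialBump (u 0 ^ 2 + u 1)) * (stepUp (u 0 ^ 2) / u 0 ^ 2)) with hR
  have hRpos : 0 < R := Real.sqrt_pos.2 (by linarith [spliceRoot_nonneg u])
  by_cases h0 : u 0 = 0
  · have h3 := (hasDerivAt_id (u 0)).mul h2
    have h4 := h1.unique (h3.congr_of_eventuallyEq (.of_forall fun x => by simp [spliceCoord]))
    simp only [id, h0, zero_mul, add_zero, one_mul] at h4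
    rw [h4]
    exact Real.sqrt_pos.2 (by
      have := spliceRoot_nonneg !₂[0, u 1]
      simp only [Matrix.cons_val_zero, Matrix.cons_val_one] at this ⊢
      linarith)
  · have h3 := ((contDiff_spliceTerm (u 1)).differentiable (by simp) (u 0 ^ 2)).hasDerivAt
    have hmono : Monotone (spliceTerm (u 1)) := fun v w h => spliceTerm_mono h (by linarith)
    have h4 := hmono.hasDerivAt_nonneg h3
    have h5 := (hasDerivAt_pow 2 (u 0)).add (HasDerivAt.comp (h := fun x : ℝ => x ^ 2) (u 0) h3 (hasDerivAt_pow 2 (u 0)))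
    have h6 := (h1.pow 2).unique (h5.congr_of_eventuallyEq
      (.of_forall fun x => by simp [spliceCoord_sq]))
    have h7 : spliceCoord !₂[u 0, u 1] = u 0 * R := by simp [spliceCoord, hR]
    rw [h7] at h6
    simp only [Nat.cast_ofNat, Nat.add_one_sub_one, pow_one] at h6
    have h8 : u 0 * (R * c) = u 0 * (1 + deriv (spliceTerm (u 1)) (u 0 ^ 2)) := by linarith
    have h9 := mul_left_cancel₀ h0 h8
    by_contra hneg
    nlinarith

theorem exists_spliceCoord_eq (Y z : ℝ) : ∃ x, spliceCoord !₂[x, Y] = z := by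
  have hc : Continuous fun x : ℝ => spliceCoord !₂[x, Y] := by
    refine contDiff_spliceCoord.continuous.comp (ContDiff.continuous (𝕜 := ℝ) (n := ∞) ?_)
    rw [contDiff_euclidean]
    intro i
    fin_cases i <;> simp <;> fun_prop
  have hroot : ∀ x : ℝ, 1 ≤ √(1 + (1 / 8 - radialBump (x ^ 2 + Y)) * (stepUp (x ^ 2) / x ^ 2)) := by
    intro x
    rw [Real.one_le_sqrt]
    have := spliceRoot_nonneg !₂[x, Y]
    simp only [Matrix.cons_val_zero, Matrix.cons_val_one] at this
    linarith
  refine hc.surjective (Filter.tendsto_atTop_mono' _ ?_ Filter.tendsto_id)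
    (Filter.tendsto_atBot_mono' _ ?_ Filter.tendsto_id) z
  · filter_upwards [Filter.eventually_ge_atTop 0] with x hx
    simpa [spliceCoord] using le_mul_of_one_le_right hx (hroot x)
  · filter_upwards [Filter.eventually_le_atBot 0] with x hx
    have := hroot x
    simp only [spliceCoord, id, Matrix.cons_val_zero, Matrix.cons_val_one]
    nlinarith

/-- The patch in which two double arcs are joined. -/
def spliceChart : ColumnChart :=
  squeezeChart (1 / 8) Real.pi contDiff_spliceCoord fderiv_spliceCoord_pos

theorem spliceChart_base (u : R2) : spliceChart.base u =
    polar (Real.pi + angle (spliceCoord u)) (squeeze (u 1 + 1 / 8) - 1 / 2) := by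
  rw [ColumnChart.base_eq, ← squeeze_eighth]
  rfl

theorem mem_range_spliceChart {θ X : ℝ} (hθ : Real.cos θ ≠ 1) (h1 : -3 / 2 < X) (h2 : X < 1 / 2) :
    polar θ X ∈ Set.range spliceChart.base := by
  refine mem_range_squeezeChart _ _ exists_spliceCoord_eq ?_ ?_
  · rw [Real.cos_sub_pi]
    exact fun h => hθ (neg_injective h)
  · rw [squeeze_eighth, abs_lt]
    constructor <;> linarith

theorem lt_of_polar_mem_range_spliceChart {θ X : ℝ} (h : polar θ X ∈ Set.range spliceChart.base) :
    Real.cos θ < 1 ∧ X < 1 / 2 := by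
  obtain ⟨u, hu⟩ := h
  rw [spliceChart_base, polar_eq_polar_iff] at hu
  constructor
  · rw [← coe_circleExp_re, ← hu.1, coe_circleExp_re, add_comm, Real.cos_add_pi, cos_angle]
    linarith [(abs_lt.1 (abs_squeeze_lt (spliceCoord u ^ 2))).2]
  · linarith [(abs_lt.1 (abs_squeeze_lt (u 1 + 1 / 8))).2, hu.2]

theorem spliceChart_nonneg {θ X : ℝ} {u : R2} (h : spliceChart.base u = polar θ X) (hX : 0 ≤ X) :
    0 ≤ u 1 := by
  rw [spliceChart_base, polar_eq_polar_iff] at h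
  by_contra hneg
  have h1 : squeeze (u 1 + 1 / 8) < squeeze (1 / 8) := strictMono_squeeze (by linarith)
  rw [squeeze_eighth] at h1
  linarith [h.2]

/-- The functions agree where x² + Y < 1 (the bump is 1/8) and where x² > 1/2 (`stepUp` is 1). In
the remaining region Y ≥ 1/2 ≥ x², and both are positive. -/
theorem spliceRatio_aux (u : R2) :
    (fun u : R2 => u 1 + 1 / 8 - (u 0 ^ 2 + spliceTerm (u 1) (u 0 ^ 2))) =ᶠ[𝓝 u]
      (fun u : R2 => u 1 - u 0 ^ 2 + radialBump (u 0 ^ 2 + u 1)) ∨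
    0 < (u 1 + 1 / 8 - (u 0 ^ 2 + spliceTerm (u 1) (u 0 ^ 2))) *
      (u 1 - u 0 ^ 2 + radialBump (u 0 ^ 2 + u 1)) := by
  rcases lt_or_ge (u 0 ^ 2 + u 1) 1 with h | h
  · left
    have hc : Continuous fun u : R2 => u 0 ^ 2 + u 1 := by fun_prop
    filter_upwards [hc.continuousAt.eventually_lt_const h] with v hv
    rw [spliceTerm, radialBump_of_le hv.le]
    ring
  rcases lt_or_ge (1 / 2) (u 0 ^ 2) with h' | h'
  · left
    have hc : Continuous fun u : R2 => u 0 ^ 2 := by fun_prop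
    filter_upwards [hc.continuousAt.eventually_const_lt h'] with v hv
    rw [spliceTerm, stepUp_of_ge hv.le]
    ring
  · right
    have h1 := radialBump_nonneg (u 0 ^ 2 + u 1)
    have h2 := spliceTerm_le_eighth (u 1) (u 0 ^ 2)
    rcases h.eq_or_lt with h3 | h3
    · have h4 : spliceTerm (u 1) (u 0 ^ 2) = 0 := by
        rw [spliceTerm, radialBump_of_le h3.ge]
        ring
      rw [h4, radialBump_of_le h3.ge]
      exact mul_pos (by linarith) (by linarith)
    · exact mul_pos (by linarith) (by linarith)

/-- The vertical scale in the patch `spliceChart`. -/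
def spliceScale (u : R2) : ℝ := squeezeSlope (u 1 + 1 / 8) (u 0 ^ 2 + spliceTerm (u 1) (u 0 ^ 2)) *
  ratio (fun u : R2 => u 1 + 1 / 8 - (u 0 ^ 2 + spliceTerm (u 1) (u 0 ^ 2)))
    (fun u : R2 => u 1 - u 0 ^ 2 + radialBump (u 0 ^ 2 + u 1)) u

theorem contDiff_spliceScale : ContDiff ℝ ∞ spliceScale := by
  have h1 := contDiff_radialBump
  have h2 := contDiff_stepUp
  have h3 : ContDiff ℝ ∞ fun u : R2 => spliceTerm (u 1) (u 0 ^ 2) := by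
    unfold spliceTerm
    fun_prop
  exact (contDiff_squeezeSlope (by fun_prop) (by fun_prop)).mul
    (contDiff_ratio (by fun_prop) (by fun_prop) spliceRatio_aux)

theorem spliceScale_pos (u : R2) : 0 < spliceScale u :=
  mul_pos (squeezeSlope_pos _ _) (ratio_pos spliceRatio_aux u)

/-- With θ measured from π, X - cos θ / 2 equals squeeze(Y + 1/8) - squeeze(z²) for the corrected
coordinate z, hence a positive multiple of Y + 1/8 - z². -/
theorem middleHeight_spliceChart (u : R2) : middleHeight (spliceChart.base u) =
    spliceScale u * (u 1 - u 0 ^ 2 + radialBump (u 0 ^ 2 + u 1)) := by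
  rw [spliceScale, mul_assoc, ratio_mul spliceRatio_aux u, spliceChart_base, middleHeight_polar,
    add_comm Real.pi, Real.cos_add_pi, cos_angle, spliceCoord_sq]
  linear_combination squeeze_sub (u 1 + 1 / 8) (u 0 ^ 2 + spliceTerm (u 1) (u 0 ^ 2))

/-- The height function of the diagram with a closed double curve. -/
def loopHeight : R2 → ℝ := bumpedHeight spliceChart spliceScale (-2)

theorem loopHeight_spliceChart {u : R2} (hu : 0 ≤ u 1) : loopHeight (spliceChart.base u) =
    spliceScale u * (u 1 - u 0 ^ 2 - radialBump (u 0 ^ 2 + u 1)) := by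
  rw [loopHeight, bumpedHeight_base hu, middleHeight_spliceChart]
  ring

theorem loopHeight_of_notMem {p : R2} (hp : p ∉ Set.range spliceChart.base) :
    loopHeight p = middleHeight p := bumpedHeight_of_notMem hp

theorem loopHeight_eventuallyEq {p : R2} (hp : p ∉ Set.range spliceChart.base) :
    loopHeight =ᶠ[𝓝 p] middleHeight := bumpedHeight_eventuallyEq hp

theorem loopHeight_le {θ X : ℝ} (hX : 0 ≤ X) : loopHeight (polar θ X) ≤ X - Real.cos θ / 2 := by
  rw [← middleHeight_polar]
  by_cases hp : polar θ X ∈ Set.range spliceChart.base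
  · obtain ⟨u, hu⟩ := hp
    rw [← hu, loopHeight_spliceChart (spliceChart_nonneg hu hX), middleHeight_spliceChart]
    have h1 := spliceScale_pos u
    have h2 := radialBump_nonneg (u 0 ^ 2 + u 1)
    exact mul_le_mul_of_nonneg_left (by linarith) h1.le
  · rw [loopHeight_of_notMem hp]

theorem loopHeight_of_half_le {θ X : ℝ} (hX : 1 / 2 ≤ X) :
    loopHeight (polar θ X) = X - Real.cos θ / 2 := by
  rw [loopHeight_of_notMem, middleHeight_polar]
  exact fun h => absurd (lt_of_polar_mem_range_spliceChart h).2 (by linarith)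

/-- On the inner circle Y = 0 the model is -x² - bump. The only missing direction is θ = 0, where
`middleHeight` is -1/2. -/
theorem loopHeight_zero_neg (θ : ℝ) : loopHeight (polar θ 0) < 0 := by
  by_cases hp : polar θ 0 ∈ Set.range spliceChart.base
  · obtain ⟨u, hu⟩ := hp
    have h0 : u 1 = 0 := by
      have h := hu
      rw [spliceChart_base, polar_eq_polar_iff, ← squeeze_eighth] at h
      have := strictMono_squeeze.injective (sub_eq_zero.1 h.2)
      linarith
    rw [← hu, loopHeight_spliceChart h0.ge]
    refine mul_neg_of_pos_of_neg (spliceScale_pos u) ?_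
    have h1 := sq_nonneg (u 0)
    rcases le_or_gt (u 0 ^ 2 + u 1) 1 with h | h
    · rw [radialBump_of_le h]
      linarith
    · have := radialBump_nonneg (u 0 ^ 2 + u 1)
      linarith
  · have h : Real.cos θ = 1 := by
      by_contra h
      exact hp (mem_range_spliceChart h (by norm_num) (by norm_num))
    rw [loopHeight_of_notMem hp, middleHeight_polar, h]
    norm_num

/-- On a ray, the height function changes its sign at most once. -/
theorem loopHeight_pos_of_lt {θ X X' : ℝ} (hX : 0 ≤ X) (h : X < X')
    (h0 : 0 ≤ loopHeight (polar θ X)) : 0 < loopHeight (polar θ X') := by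
  by_cases hp : polar θ X' ∈ Set.range spliceChart.base
  · obtain ⟨h1, h2⟩ := lt_of_polar_mem_range_spliceChart hp
    obtain ⟨v, hv⟩ := hp
    obtain ⟨u, hu⟩ := mem_range_spliceChart h1.ne (by linarith : -3 / 2 < X) (by linarith)
    have hu1 := spliceChart_nonneg hu hX
    have hv1 := spliceChart_nonneg hv (hX.trans h.le)
    rw [← hu, loopHeight_spliceChart hu1] at h0
    rw [← hv, loopHeight_spliceChart hv1]
    refine mul_pos (spliceScale_pos v) ?_
    have h3 := nonneg_of_mul_nonneg_right h0 (spliceScale_pos u)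
    have huv : u 1 < v 1 := by
      rw [ColumnChart.base_eq, polar_eq_polar_iff] at hu hv
      rw [← spliceChart.strictMono_radius.lt_iff_lt, hu.2, hv.2]
      exact h
    -- On a ray the corrected coordinate is constant. As Y grows, monotonicity of `spliceTerm`
    -- forces x² to decrease weakly and x² + Y to increase weakly; hence Y - x² - bump increases
    -- strictly.
    have hz : u 0 ^ 2 + spliceTerm (u 1) (u 0 ^ 2) = v 0 ^ 2 + spliceTerm (v 1) (v 0 ^ 2) := by
      rw [← spliceCoord_sq, ← spliceCoord_sq]
      rw [ColumnChart.base_eq, polar_eq_polar_iff] at hu hv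
      have h4 := spliceChart.arg_eq_of_exp_eq (hu.1.trans hv.1.symm)
      rw [strictMono_angle.injective (add_left_cancel h4)]
    have hw : v 0 ^ 2 ≤ u 0 ^ 2 := by
      by_contra hneg
      have := spliceTerm_mono (Y := u 1) (Y' := v 1) (not_le.1 hneg).le (by linarith)
      linarith
    have hr : u 0 ^ 2 + u 1 ≤ v 0 ^ 2 + v 1 := by
      by_contra hneg
      have := spliceTerm_mono (Y := v 1) (Y' := u 1) hw (by linarith)
      linarith
    have := antitone_radialBump hr
    linarith
  · rw [loopHeight_of_notMem hp, middleHeight_polar]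
    linarith [loopHeight_le (θ := θ) hX]

/-- At a zero in the patch only the model factor has to be differentiated. In the direction of Y it
gives 1 minus the derivative of the bump, which is at least 1. The formula holds for Y ≥ 0, hence
the need for Y > 0. -/
theorem fderiv_loopHeight_ne_zero {θ X : ℝ} (hX : 0 < X) (h0 : loopHeight (polar θ X) = 0) :
    fderiv ℝ loopHeight (polar θ X) ≠ 0 := by
  by_cases hp : polar θ X ∈ Set.range spliceChart.base
  · obtain ⟨u, hu⟩ := hp
    have hu1 : 0 < u 1 := by
      refine lt_of_le_of_ne (spliceChart_nonneg hu hX.le) fun h => hX.ne ?_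
      rw [ColumnChart.base_eq, polar_eq_polar_iff, spliceChart.radius_eq, ← h, zero_mul] at hu
      exact hu.2
    intro hd
    have h1 := ((contDiffAt_bumpedHeight (C := spliceChart) (s := -2) contDiff_spliceScale
      (polar_ne_zero θ X)).differentiableAt (by simp)).hasFDerivAt
    change HasFDerivAt loopHeight (fderiv ℝ loopHeight (polar θ X)) _ at h1
    rw [hd, ← hu] at h1
    have h2 := h1.comp u (spliceChart.contDiff_base.differentiable (by simp) u).hasFDerivAt
    rw [ContinuousLinearMap.zero_comp] at h2
    have h3 := hasDerivAt_slice_one h2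
    rw [← hu, loopHeight_spliceChart hu1.le] at h0
    have h4 := (mul_eq_zero.1 h0).resolve_left (spliceScale_pos u).ne'
    have e : (!₂[u 0, u 1] : R2) = u := by
      ext i
      fin_cases i <;> simp
    have h5 := hasDerivAt_slice_one
      (contDiff_spliceScale.differentiable (by simp) u).hasFDerivAt
    have h6 : HasDerivAt (fun Y => radialBump (u 0 ^ 2 + Y)) (deriv radialBump (u 0 ^ 2 + u 1))
        (u 1) := by
      have := (contDiff_radialBump.differentiable (by simp) (u 0 ^ 2 + u 1)).hasDerivAt
      simpa using this.comp_const_add (u 0 ^ 2) (u 1)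
    have h7 : deriv radialBump (u 0 ^ 2 + u 1) ≤ 0 := by
      have hn : Monotone fun r => -radialBump r := fun r s h => neg_le_neg (antitone_radialBump h)
      have := hn.hasDerivAt_nonneg
        (contDiff_radialBump.differentiable (by simp) (u 0 ^ 2 + u 1)).hasDerivAt.neg
      linarith
    have h8 := h5.mul (((hasDerivAt_id (u 1)).sub_const (u 0 ^ 2)).sub h6)
    have h9 := h3.unique (h8.congr_of_eventuallyEq (by
      filter_upwards [eventually_gt_nhds hu1] with Y hY
      rw [Function.comp_apply, loopHeight_spliceChart (by simpa using hY.le)]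
      simp))
    simp only [zero_apply, e, Pi.sub_apply, id, h4, mul_zero, zero_add] at h9
    have := spliceScale_pos u
    nlinarith
  · rw [(loopHeight_eventuallyEq hp).fderiv_eq]
    exact fderiv_middleHeight_ne_zero θ X

theorem isRingHeight_loopHeight : IsRingHeight loopHeight where
  smooth _ hp := contDiffAt_bumpedHeight contDiff_spliceScale hp
  transverse _ _ h1 _ h := fderiv_loopHeight_ne_zero h1 h
  outer θ := by
    rw [loopHeight_of_half_le (by norm_num)]
    linarith [Real.cos_le_one θ]
  inner θ h := absurd h (loopHeight_zero_neg θ).ne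

/-- The joining of the double arcs. -/
theorem moved_middle_loop : SurfaceKnotDiagram.Moved moveB2
    (ringDiagram middleHeight isRingHeight_middleHeight)
    (ringDiagram loopHeight isRingHeight_loopHeight) := by
  have h1 : moveB2 = ColumnChart.oddPicture
      (fun t u => u 1 - u 0 ^ 2 + t * radialBump (u 0 ^ 2 + u 1)) := by
    unfold moveB2 ColumnChart.oddPicture
    congr 1
    funext t i
    rw [Subsingleton.elim i 0]
    change kinkSheet (fun u => -u 0 ^ 2 + t * bump u) = _
    funext u
    ext j
    fin_cases j <;> simp [kinkSheet, oddSheet, bump, radialBump]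
    left
    ring
  rw [h1]
  refine ColumnChart.moved _ _ (C := spliceChart) contDiff_spliceScale spliceScale_pos
    (fun u hu => ?_) (fun u hu => ?_) fun p hp => loopHeight_of_notMem hp
  · rw [middleHeight_spliceChart, one_mul]
  · rw [loopHeight_spliceChart hu]
    ring

theorem equivalent_empty_loop : SurfaceKnotDiagram.Equivalent
    (ringDiagram emptyHeight isRingHeight_emptyHeight)
    (ringDiagram loopHeight isRingHeight_loopHeight) := by
  refine .trans _ (ringDiagram middleHeight isRingHeight_middleHeight) _
    (.rel _ _ (.inr (.inr ⟨moveB1, ?_, moved_empty_middle⟩)))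
    (.rel _ _ (.inr (.inr ⟨moveB2, ?_, moved_middle_loop⟩)))
  · simp [rosemanMoves]
  · simp [rosemanMoves]

/-! ## The diagram without double points -/

namespace SurfaceKnotDiagram

variable {S : Type} [TopologicalSpace S] [ChartedSpace R2 S] {D : SurfaceKnotDiagram S}

theorem hasCheckerboard_of_forall_not_under (h : ∀ x y, ¬ D.Under x y) : D.HasCheckerboard :=
  ⟨fun _ => 1, fun x => ⟨∅, fun _ _ => 0, 1, fun y => by simp [h], by simp, by simp⟩⟩

/-! ### Rack colorings of diagrams with one sheet -/

theorem subsingleton_sheets (h : IsPreconnected D.lowerSetᶜ) : Subsingleton D.Sheets := by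
  have : PreconnectedSpace ↥(D.lowerSetᶜ) := isPreconnected_iff_preconnectedSpace.1 h
  exact inferInstanceAs (Subsingleton (ConnectedComponents ↥(D.lowerSetᶜ)))

theorem card_colorings_of_forall_not_under [ConnectedSpace S] (h : ∀ x y, ¬ D.Under x y)
    (R : Type) [Rack R] : Nat.card (D.Colorings R) = Nat.card R := by
  have hl : D.lowerSet = ∅ := by simp [lowerSet, h]
  have hs : Subsingleton D.Sheets := subsingleton_sheets (by
    rw [hl, Set.compl_empty]
    exact isPreconnected_univ)
  obtain ⟨x⟩ : Nonempty S := inferInstance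
  let s : D.Sheets := ConnectedComponents.mk ⟨x, by simp [hl]⟩
  refine Nat.card_congr ⟨fun c => c.1 s, fun a => ⟨fun _ => a, ?_⟩, fun c => ?_, fun a => rfl⟩
  · rintro si sj sk ⟨x, y, γ, hxy, -⟩
    exact absurd hxy (h x y)
  · refine Subtype.ext (funext fun t => ?_)
    change c.1 s = c.1 t
    rw [Subsingleton.elim s t]

theorem isEmpty_colorings [Subsingleton D.Sheets] {si sj sk : D.Sheets} (h : D.MeetAt si sj sk)
    {R : Type} [Rack R] (hR : IsConnectedRack R) (hq : ¬ IsQuandleRack R) :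
    IsEmpty (D.Colorings R) := by
  refine ⟨fun c => hq ?_⟩
  have h1 := c.2 si sj sk h
  rw [Subsingleton.elim sk sj, Subsingleton.elim si sj] at h1
  intro b
  -- Left translations are automorphisms of the rack, so they preserve and reflect idempotence.
  have key : ∀ a b : R, Relation.EqvGen (fun a b => ∃ c : R, b = c ◃ a) a b →
      (a ◃ a = a ↔ b ◃ b = b) := by
    intro a b hab
    induction hab with
    | rel a b h =>
      obtain ⟨d, rfl⟩ := h
      rw [← Rack.self_distrib]
      exact (Rack.left_cancel d).symm
    | refl => rfl
    | symm _ _ _ ih => exact ih.symm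
    | trans _ _ _ _ _ ih1 ih2 => exact ih1.trans ih2
  exact (key _ b (hR (c.1 sj) b)).1 h1.symm

end SurfaceKnotDiagram

/-- The diagram without double points. -/
def emptyDiagram : SurfaceKnotDiagram (Circle × Circle) :=
  ringDiagram emptyHeight isRingHeight_emptyHeight

theorem not_under_emptyDiagram (x y : Circle × Circle) : ¬ emptyDiagram.Under x y := by
  obtain ⟨u, rfl⟩ := surjective_torusCover x
  rw [emptyDiagram, ringDiagram_under_iff]
  rintro ⟨-, -, h⟩
  exact (emptyHeight_pos (by linarith [Real.cos_le_one (u 1)])).ne' h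

/-! ## The diagram with a closed double curve -/

/-- The diagram with a closed double curve. -/
def loopDiagram : SurfaceKnotDiagram (Circle × Circle) :=
  ringDiagram loopHeight isRingHeight_loopHeight

theorem continuous_loopHeight_ringPoint : Continuous fun q => loopHeight (ringPoint q) := by
  have h : Continuous ringPoint := by
    refine (contMDiff_torus_iff.2 (?_ : ContDiff ℝ ∞ (ringPoint ∘ torusCover))).continuous
    rw [ringPoint_comp_torusCover]
    exact contDiff_ringLift
  rw [continuous_iff_continuousAt]
  intro q
  exact ContinuousAt.comp (g := loopHeight)
    (isRingHeight_loopHeight.smooth _ (ringPoint_ne_zero q)).continuousAt h.continuousAt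

theorem loopHeight_ringLift_ne_zero {u : R2} (h : Real.sin (u 1) = 0) :
    loopHeight (ringLift u) ≠ 0 := by
  rcases Real.sin_eq_zero_iff_cos_eq.1 h with h | h
  · rw [ringLift, h, sub_self]
    exact (loopHeight_zero_neg _).ne
  · rw [ringLift, h]
    norm_num
    exact isRingHeight_loopHeight.outer _

/-- The lower points already form a closed set: `loopHeight` does not vanish on the fold circles, so
sin φ < 0 may be replaced by sin φ ≤ 0 in describing them. -/
theorem torusCover_mem_lowerSet_iff {u : R2} : torusCover u ∈ loopDiagram.lowerSet ↔
    Real.sin (u 1) < 0 ∧ loopHeight (ringLift u) = 0 := by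
  have h1 : {x | ∃ y, loopDiagram.Under x y} =
      {q : Circle × Circle | (q.2 : ℂ).im ≤ 0 ∧ loopHeight (ringPoint q) = 0} := by
    ext q
    obtain ⟨u, rfl⟩ := surjective_torusCover q
    simp only [Set.mem_ofPred_eq, loopDiagram, ringDiagram_under_iff]
    rw [show ringPoint (torusCover u) = ringLift u from ringPoint_torusCover u,
      show ((torusCover u).2 : ℂ).im = Real.sin (u 1) from coe_circleExp_im _]
    constructor
    · rintro ⟨y, -, h1, h2⟩
      exact ⟨h1.le, h2⟩
    · rintro ⟨h1, h2⟩
      exact ⟨_, rfl, lt_of_le_of_ne h1 fun h => loopHeight_ringLift_ne_zero h h2, h2⟩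
  have h2 : IsClosed {q : Circle × Circle | (q.2 : ℂ).im ≤ 0 ∧ loopHeight (ringPoint q) = 0} :=
    (isClosed_le (Complex.continuous_im.comp (continuous_subtype_val.comp continuous_snd))
      continuous_const).inter (isClosed_eq continuous_loopHeight_ringPoint continuous_const)
  rw [SurfaceKnotDiagram.lowerSet, h1, h2.closure_eq, ← h1]
  simp only [Set.mem_ofPred_eq, loopDiagram, ringDiagram_under_iff, exists_eq_left]

theorem continuous_torusCover : Continuous torusCover := contMDiff_torusCover.continuous

theorem exists_torusCover_eq (q : Circle × Circle) :
    ∃ θ φ : ℝ, -Real.pi < φ ∧ φ ≤ Real.pi ∧ torusCover !₂[θ, φ] = q := by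
  refine ⟨Complex.arg q.1, Complex.arg q.2, Complex.neg_pi_lt_arg _, Complex.arg_le_pi _, ?_⟩
  simp [torusCover, Circle.exp_arg]

theorem continuous_slice (θ : ℝ) : Continuous fun φ : ℝ => (!₂[θ, φ] : R2) := by
  refine ContDiff.continuous (𝕜 := ℝ) (n := ∞) ?_
  rw [contDiff_euclidean]
  intro i
  fin_cases i <;> simp <;> fun_prop

/-- The upper half of the torus contains no lower points. On each lower half meridian the height
changes sign at most once, so a point with negative height can move to the inner circle, and one
with positive height to the outer circle, without meeting a lower point. Both circles belong to the
upper half. -/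
theorem isPreconnected_compl_lowerSet : IsPreconnected loopDiagram.lowerSetᶜ := by
  set U : Set (Circle × Circle) := torusCover '' {u | 0 ≤ u 1 ∧ u 1 ≤ Real.pi} with hU
  have hUc : IsPreconnected U := by
    refine IsPreconnected.image (Convex.isPreconnected ?_) _ continuous_torusCover.continuousOn
    intro u hu v hv a b ha hb hab
    simp only [Set.mem_ofPred_eq, PiLp.add_apply, PiLp.smul_apply, smul_eq_mul] at hu hv ⊢
    constructor
    · nlinarith
    · nlinarith
  have hUs : U ⊆ loopDiagram.lowerSetᶜ := by
    rintro _ ⟨u, ⟨h1, h2⟩, rfl⟩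
    rw [Set.mem_compl_iff, torusCover_mem_lowerSet_iff]
    exact fun h => absurd (Real.sin_nonneg_of_nonneg_of_le_pi h1 h2) (not_le.2 h.1)
  have hjoin : ∀ (θ : ℝ) (T : Set ℝ), IsPreconnected T →
      (∀ ψ ∈ T, torusCover !₂[θ, ψ] ∈ loopDiagram.lowerSetᶜ) →
      (∃ ψ ∈ T, torusCover !₂[θ, ψ] ∈ U) → ∀ φ ∈ T, ∃ t ⊆ loopDiagram.lowerSetᶜ,
        torusCover 0 ∈ t ∧ torusCover !₂[θ, φ] ∈ t ∧ IsPreconnected t := by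
    rintro θ T hT hTs ⟨ψ, hψ, hψU⟩ φ hφ
    have hTc : IsPreconnected ((fun ψ => torusCover !₂[θ, ψ]) '' T) :=
      hT.image _ (continuous_torusCover.comp (continuous_slice θ)).continuousOn
    refine ⟨U ∪ (fun ψ => torusCover !₂[θ, ψ]) '' T, Set.union_subset hUs ?_,
      .inl ⟨0, by simp [Real.pi_pos.le], rfl⟩, .inr ⟨φ, hφ, rfl⟩,
      IsPreconnected.union _ hψU ⟨ψ, hψ, rfl⟩ hUc hTc⟩
    rintro _ ⟨ψ, hψ, rfl⟩
    exact hTs ψ hψ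
  have hpi := Real.pi_pos
  refine isPreconnected_of_forall (torusCover 0) fun q hq => ?_
  obtain ⟨θ, φ, h1, h2, rfl⟩ := exists_torusCover_eq q
  rcases le_or_gt 0 φ with h3 | h3
  · refine ⟨U, hUs, ⟨0, by simp [hpi.le], rfl⟩, ⟨_, ?_, rfl⟩, hUc⟩
    simp [h2, h3]
  rw [Set.mem_compl_iff, torusCover_mem_lowerSet_iff, not_and] at hq
  have hne : loopHeight (polar θ (1 - Real.cos φ)) ≠ 0 := by
    simpa [ringLift] using hq (by simpa using Real.sin_neg_of_neg_of_neg_pi_lt h3 h1)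
  have hcos : ∀ ψ ψ', -Real.pi ≤ ψ → ψ ≤ ψ' → ψ' ≤ 0 → Real.cos ψ ≤ Real.cos ψ' := by
    intro ψ ψ' ha hb hc
    rw [← Real.cos_neg ψ, ← Real.cos_neg ψ']
    exact Real.cos_le_cos_of_nonneg_of_le_pi (by linarith) (by linarith) (by linarith)
  have hX : ∀ ψ, 0 ≤ 1 - Real.cos ψ := fun ψ => by linarith [Real.cos_le_one ψ]
  rcases hne.lt_or_gt with h4 | h4
  · refine hjoin θ (Set.Icc φ 0) isPreconnected_Icc (fun ψ hψ => ?_)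
      ⟨0, ⟨h3.le, le_rfl⟩, ⟨_, by simp [hpi.le], rfl⟩⟩ φ ⟨le_rfl, h3.le⟩
    rw [Set.mem_compl_iff, torusCover_mem_lowerSet_iff]
    rintro ⟨-, h5⟩
    have h5 : loopHeight (polar θ (1 - Real.cos ψ)) = 0 := by simpa [ringLift] using h5
    rcases (hcos φ ψ h1.le hψ.1 hψ.2).eq_or_lt with h6 | h6
    · rw [h6] at h4
      exact h4.ne h5
    · exact lt_asymm h4 (loopHeight_pos_of_lt (hX ψ) (by linarith) h5.ge)
  · refine hjoin θ (Set.Icc (-Real.pi) φ) isPreconnected_Icc (fun ψ hψ => ?_)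
      ⟨-Real.pi, ⟨le_rfl, h1.le⟩, ⟨!₂[θ, Real.pi], by simp [hpi.le], ?_⟩⟩ φ ⟨h1.le, le_rfl⟩
    · rw [Set.mem_compl_iff, torusCover_mem_lowerSet_iff]
      rintro ⟨-, h5⟩
      have h5 : loopHeight (polar θ (1 - Real.cos ψ)) = 0 := by simpa [ringLift] using h5
      rcases (hcos ψ φ hψ.1 hψ.2 h3.le).eq_or_lt with h6 | h6
      · rw [← h6] at h4
        exact h4.ne' h5
      · exact (loopHeight_pos_of_lt (hX φ) (by linarith) h4.le).ne' h5
    · rw [torusCover_eq_iff]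
      exact ⟨⟨0, by simp⟩, ⟨1, by simp; ring⟩⟩

/-! ### A double point -/

/-- The lower double point with argument zero. -/
def lowerPoint : R2 := !₂[0, -(Real.pi / 3)]

/-- The upper double point with argument zero. -/
def upperPoint : R2 := !₂[0, Real.pi / 3]

theorem flipPoint_lowerPoint : flipPoint lowerPoint = upperPoint := by
  simp [flipPoint, lowerPoint, upperPoint]

/-- The patch misses the ray θ = 0, where the height is therefore known exactly. It vanishes at X =
1/2, that is, cos φ = 1/2, giving the double point at φ = ± π/3. -/
theorem loopHeight_polar_zero (X : ℝ) : loopHeight (polar 0 X) = X - 1 / 2 := by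
  rw [loopHeight_of_notMem, middleHeight_polar, Real.cos_zero]
  exact fun h => absurd (lt_of_polar_mem_range_spliceChart h).1 (by simp)

theorem hasDerivAt_of_coord {ι : Type*} [Fintype ι] {f : ℝ → EuclideanSpace ℝ ι}
    {f' : EuclideanSpace ℝ ι} {t : ℝ} (h : ∀ i, HasDerivAt (fun t => f t i) (f' i) t) :
    HasDerivAt f f' t := by
  have h1 : HasDerivAt (fun t => WithLp.ofLp (f t)) (WithLp.ofLp f') t := hasDerivAt_pi.2 h
  exact (PiLp.continuousLinearEquiv 2 ℝ fun _ : ι => ℝ).symm.hasFDerivAt.comp_hasDerivAt t h1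

theorem loopDiagram_proj_meridian (φ : ℝ) : loopDiagram.proj (torusCover !₂[0, φ]) =
    !₂[Real.exp (1 - Real.cos φ), 0, Real.sin φ * (1 / 2 - Real.cos φ)] := by
  have h : ringLift !₂[0, φ] = polar 0 (1 - Real.cos φ) := by simp [ringLift]
  rw [loopDiagram, ringDiagram_proj, ringProj_torusCover, h, loopHeight_polar_zero]
  simp
  left
  ring

theorem hasDerivAt_loopDiagram_proj_meridian {φ : ℝ} (h : Real.cos φ = 1 / 2) :
    HasDerivAt (fun φ => loopDiagram.proj (torusCover !₂[0, φ]))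
      !₂[Real.exp (1 / 2) * Real.sin φ, 0, Real.sin φ ^ 2] φ := by
  simp only [loopDiagram_proj_meridian]
  refine hasDerivAt_of_coord fun i => ?_
  fin_cases i
  · have := ((Real.hasDerivAt_cos φ).const_sub 1).exp
    rw [h] at this
    norm_num at this
    simpa using this
  · simpa using hasDerivAt_const φ (0 : ℝ)
  · have := (Real.hasDerivAt_sin φ).mul ((Real.hasDerivAt_cos φ).const_sub (1 / 2))
    rw [h] at this
    refine HasDerivAt.congr_deriv (f' := _) (this.congr_of_eventuallyEq (.of_forall fun t => ?_)) ?_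
    · simp
    · simp [sq]

theorem hasDerivAt_loopDiagram_proj_longitude {φ : ℝ} (h : Real.cos φ = 1 / 2) :
    HasDerivAt (fun θ => loopDiagram.proj (torusCover !₂[θ, φ])) !₂[0, Real.exp (1 / 2), 0] 0 := by
  have h0 : (fun θ => loopDiagram.proj (torusCover !₂[θ, φ])) = fun θ =>
      !₂[Real.exp (1 / 2) * Real.cos θ, Real.exp (1 / 2) * Real.sin θ,
        Real.sin φ * (1 / 2 - Real.cos θ / 2)] := by
    funext θ
    rw [loopDiagram, ringDiagram_proj, ringProj_torusCover]
    have h1 : ringLift !₂[θ, φ] = polar θ (1 / 2) := by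
      simp [ringLift, h]
      norm_num
    rw [h1, loopHeight_of_half_le le_rfl]
    simp
  rw [h0]
  refine hasDerivAt_of_coord fun i => ?_
  fin_cases i
  · simpa using (Real.hasDerivAt_cos 0).const_mul (Real.exp (1 / 2))
  · simpa using (Real.hasDerivAt_sin 0).const_mul (Real.exp (1 / 2))
  · simpa using ((((Real.hasDerivAt_cos 0).div_const 2).const_sub 2⁻¹).const_mul (Real.sin φ))

theorem contDiff_loopDiagram_proj : ContDiff ℝ ∞ (loopDiagram.proj ∘ torusCover) :=
  contDiff_ringProj isRingHeight_loopHeight.smooth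

theorem fderiv_loopDiagram_proj_longitude : fderiv ℝ (loopDiagram.proj ∘ torusCover) upperPoint
    (EuclideanSpace.single 0 1) = !₂[0, Real.exp (1 / 2), 0] :=
  (hasDerivAt_slice_zero contDiff_loopDiagram_proj upperPoint).unique
    (by simpa [upperPoint] using hasDerivAt_loopDiagram_proj_longitude Real.cos_pi_div_three)

theorem fderiv_loopDiagram_proj_meridian : fderiv ℝ (loopDiagram.proj ∘ torusCover) upperPoint
    (EuclideanSpace.single 1 1) = !₂[Real.exp (1 / 2) * (√3 / 2), 0, (√3 / 2) ^ 2] :=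
  (hasDerivAt_slice_one
    (contDiff_loopDiagram_proj.differentiable (by simp) upperPoint).hasFDerivAt).unique
    (by simpa [upperPoint, -Real.cos_pi_div_three, Real.sin_pi_div_three] using
      hasDerivAt_loopDiagram_proj_meridian Real.cos_pi_div_three)

/-- A curve that crosses the upper sheet at the double point. -/
def crossing (t : ℝ) : R2 := !₂[0, -(Real.pi / 3) - t]

theorem hasDerivAt_crossing : HasDerivAt (fun t => loopDiagram.proj (torusCover (crossing t)))
    !₂[Real.exp (1 / 2) * (√3 / 2), 0, -(√3 / 2) ^ 2] 0 := by
  have h1 : Real.cos (-(Real.pi / 3) - 0) = 1 / 2 := by simp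
  have h2 := (hasDerivAt_loopDiagram_proj_meridian h1).scomp (0 : ℝ)
    ((hasDerivAt_id (0 : ℝ)).const_sub (-(Real.pi / 3)))
  refine h2.congr_deriv ?_
  ext i
  fin_cases i <;> simp

theorem under_lowerPoint_iff (y : Circle × Circle) :
    loopDiagram.Under (torusCover lowerPoint) y ↔ y = torusCover upperPoint := by
  rw [loopDiagram, ringDiagram_under_iff, flipPoint_lowerPoint]
  have h1 : Real.sin (lowerPoint 1) < 0 := by simp [lowerPoint]
  have h2 : loopHeight (ringLift lowerPoint) = 0 := by
    simp [lowerPoint, ringLift, loopHeight_polar_zero]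
    norm_num
  simp [h1, h2]

theorem crossing_notMem_lowerSet {t : ℝ} (h0 : t ≠ 0) (h1 : |t| < 1) :
    torusCover (crossing t) ∈ loopDiagram.lowerSetᶜ := by
  rw [Set.mem_compl_iff, torusCover_mem_lowerSet_iff]
  rintro ⟨-, h⟩
  have h2 : Real.cos (-(Real.pi / 3) - t) = 1 / 2 := by
    have : loopHeight (polar 0 (1 - Real.cos (-(Real.pi / 3) - t))) = 0 := by
      simpa [ringLift, crossing] using h
    rw [loopHeight_polar_zero] at this
    linarith
  have h3 := abs_lt.1 h1
  have hpi := Real.pi_gt_three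
  rw [← Real.cos_pi_div_three, ← Real.cos_neg] at h2
  have h4 := Real.injOn_cos ⟨by linarith, by linarith⟩ ⟨by linarith, by linarith⟩ h2
  exact h0 (by linarith)

theorem contDiff_crossing : ContDiff ℝ ∞ crossing := by
  unfold crossing
  rw [contDiff_euclidean]
  intro i
  fin_cases i <;> simp <;> fun_prop

theorem eventually_crossing_notMem :
    ∀ᶠ t in 𝓝[≠] (0 : ℝ), torusCover (crossing t) ∈ loopDiagram.lowerSetᶜ := by
  have h : ∀ᶠ t : ℝ in 𝓝 0, |t| < 1 :=
    (continuous_abs.continuousAt (x := (0 : ℝ))).eventually_lt_const (by simp)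
  filter_upwards [self_mem_nhdsWithin, nhdsWithin_le_nhds h] with t ht0 ht1
  exact crossing_notMem_lowerSet ht0 ht1

theorem crossing_zero : crossing 0 = lowerPoint := by simp [crossing, lowerPoint]

theorem tendsto_neg_nhdsGT_zero : Filter.Tendsto (fun t : ℝ => -t) (𝓝[>] 0) (𝓝[≠] 0) := by
  refine tendsto_nhdsWithin_iff.2 ⟨?_, ?_⟩
  · have : Filter.Tendsto (fun t : ℝ => -t) (𝓝 0) (𝓝 0) := by
      simpa using (continuous_neg (G := ℝ)).tendsto 0
    exact this.mono_left nhdsWithin_le_nhds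
  · filter_upwards [self_mem_nhdsWithin] with t ht
    simpa using (ne_of_gt ht : t ≠ 0)

theorem nhdsGT_zero_le_nhdsNE : 𝓝[>] (0 : ℝ) ≤ 𝓝[≠] 0 :=
  nhdsWithin_mono _ fun _ ht => ne_of_gt ht

/-! ### The obstruction to a checkerboard coloring -/

/-- A function changes its sign at a simple zero. -/
theorem eventually_signUnit_eq_neg {g : ℝ → ℝ} {m : ℝ} (hg : HasDerivAt g m 0) (hm : m ≠ 0)
    (h0 : g 0 = 0) : ∀ᶠ t in 𝓝[>] (0 : ℝ), signUnit (g t) = -signUnit (g (-t)) := by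
  have h1 := hasDerivAt_iff_tendsto_slope_zero.1 hg
  simp only [zero_add, h0, sub_zero, smul_eq_mul] at h1
  have h2 : ∀ᶠ t in 𝓝[≠] (0 : ℝ), 0 < m * (t⁻¹ * g t) :=
    (h1.const_mul m).eventually_const_lt (mul_self_pos.2 hm)
  filter_upwards [self_mem_nhdsWithin, h2.filter_mono nhdsGT_zero_le_nhdsNE,
    tendsto_neg_nhdsGT_zero.eventually h2] with t ht hp hn
  have ht0 : 0 < t⁻¹ := inv_pos.2 ht
  rw [inv_neg] at hn
  rcases hm.lt_or_gt with hm | hm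
  · have h3 : g t < 0 := by
      by_contra h
      have := mul_nonneg ht0.le (not_lt.1 h)
      nlinarith
    have h4 : 0 < g (-t) := by
      by_contra h
      have := mul_nonneg ht0.le (neg_nonneg.2 (not_lt.1 h))
      nlinarith
    rw [signUnit_of_nonpos h3.le, signUnit_of_pos h4]
  · have h3 : 0 < g t := by
      by_contra h
      have := mul_nonneg ht0.le (neg_nonneg.2 (not_lt.1 h))
      nlinarith
    have h4 : g (-t) < 0 := by
      by_contra h
      have := mul_nonneg ht0.le (not_lt.1 h)
      nlinarith
    rw [signUnit_of_pos h3, signUnit_of_nonpos h4.le, neg_neg]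

/-- The checkerboard coloring would have to change at the double curve, whose complement is
connected. -/
theorem not_hasCheckerboard_loopDiagram : ¬ loopDiagram.HasCheckerboard := by
  rintro ⟨c, hc⟩
  have hL : IsClosed loopDiagram.lowerSet := isClosed_closure
  have hnot : ∀ q ∈ loopDiagram.lowerSetᶜ, ∀ y, ¬ loopDiagram.Under q y := by
    intro q hq y h
    exact hq (subset_closure ⟨y, h⟩)
  -- Away from the lower points the product in the local formula is empty, so the coloring is
  -- locally constant, and the complement is connected.
  have hconst : ∀ x ∈ loopDiagram.lowerSetᶜ, ∀ y ∈ loopDiagram.lowerSetᶜ, c x = c y := by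
    have hloc : IsLocallyConstant fun x : ↥(loopDiagram.lowerSetᶜ) => c x := by
      rw [IsLocallyConstant.iff_eventually_eq]
      rintro ⟨x, hx⟩
      obtain ⟨s, F, ε, hs, -, hev⟩ := hc x
      have hs0 : s = ∅ := Finset.eq_empty_of_forall_notMem fun y hy => hnot x hx y ((hs y).1 hy)
      subst hs0
      have h1 : c x = ε := by simpa using hev.self_of_nhds (hnot x hx)
      rw [nhds_subtype_eq_comap, Filter.eventually_comap]
      filter_upwards [hev] with y hy z hz
      subst hz
      simpa [h1] using hy (hnot _ z.2)
    have : PreconnectedSpace ↥(loopDiagram.lowerSetᶜ) :=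
      isPreconnected_iff_preconnectedSpace.1 isPreconnected_compl_lowerSet
    intro x hx y hy
    exact hloc.apply_eq_of_preconnectedSpace ⟨x, hx⟩ ⟨y, hy⟩
  obtain ⟨s, F, ε, hs, hF, hev⟩ := hc (torusCover lowerPoint)
  have hs1 : s = {torusCover upperPoint} := by
    ext y
    rw [hs, under_lowerPoint_iff, Finset.mem_singleton]
  subst hs1
  set G := F (torusCover upperPoint)
  have hG : loopDiagram.IsSheetEquation (torusCover upperPoint) G := hF _ (by simp)
  have hproj : loopDiagram.proj (torusCover lowerPoint) = loopDiagram.proj (torusCover upperPoint) :=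
    ((under_lowerPoint_iff _).2 rfl).1
  have hd := (hG.contDiffAt.differentiableAt (by simp)).hasFDerivAt
  set L := fderiv ℝ G (loopDiagram.proj (torusCover upperPoint)) with hLdef
  -- The sheet equation vanishes along the upper sheet, so its differential kills the tangent plane
  -- there.
  have htan : L.comp (fderiv ℝ (loopDiagram.proj ∘ torusCover) upperPoint) = 0 := by
    have h1 := hd.comp upperPoint
      (contDiff_loopDiagram_proj.differentiable (by simp) upperPoint).hasFDerivAt
    refine h1.unique ((hasFDerivAt_const (0 : ℝ) upperPoint).congr_of_eventuallyEq ?_)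
    exact continuous_torusCover.continuousAt.eventually hG.eventually_eq_zero
  have ht0 := congrArg (fun A : R2 →L[ℝ] ℝ => A (EuclideanSpace.single 0 1)) htan
  have ht1 := congrArg (fun A : R2 →L[ℝ] ℝ => A (EuclideanSpace.single 1 1)) htan
  simp only [ContinuousLinearMap.comp_apply, fderiv_loopDiagram_proj_longitude,
    fderiv_loopDiagram_proj_meridian, zero_apply] at ht0 ht1
  have hexp : ∀ a b d : ℝ, L !₂[a, b, d] = a * L (EuclideanSpace.single 0 1) +
      b * L (EuclideanSpace.single 1 1) + d * L (EuclideanSpace.single 2 1) := by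
    intro a b d
    have : (!₂[a, b, d] : R3) = a • EuclideanSpace.single 0 1 + b • EuclideanSpace.single 1 1 +
        d • EuclideanSpace.single 2 1 := by
      ext i
      fin_cases i <;> simp
    rw [this]
    simp
  rw [hexp] at ht0 ht1
  have h3 : (0 : ℝ) < √3 / 2 := by positivity
  have he := Real.exp_pos (1 / 2)
  have hcross : HasDerivAt (fun t => G (loopDiagram.proj (torusCover (crossing t))))
      (L !₂[Real.exp (1 / 2) * (√3 / 2), 0, -(√3 / 2) ^ 2]) 0 := by
    have hd' : HasFDerivAt G L (loopDiagram.proj (torusCover (crossing 0))) := by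
      rw [crossing_zero, hproj]
      exact hd
    exact hd'.comp_hasDerivAt 0 hasDerivAt_crossing
  -- The velocity of the crossing curve and the two tangent vectors of the upper sheet form a basis;
  -- if `L` vanished on all three it would be zero.
  have hne : L !₂[Real.exp (1 / 2) * (√3 / 2), 0, -(√3 / 2) ^ 2] ≠ 0 := by
    rw [hexp]
    intro h
    apply hG.fderiv_ne_zero
    change L = 0
    have l1 : L (EuclideanSpace.single 1 1) = 0 := by
      have : Real.exp (1 / 2) * L (EuclideanSpace.single 1 1) = 0 := by linarith
      exact (mul_eq_zero.1 this).resolve_left he.ne'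
    have l0 : L (EuclideanSpace.single 0 1) = 0 := by
      have : Real.exp (1 / 2) * (√3 / 2) * L (EuclideanSpace.single 0 1) = 0 := by linarith
      exact (mul_eq_zero.1 this).resolve_left (by positivity)
    have l2 : L (EuclideanSpace.single 2 1) = 0 := by
      have : (√3 / 2) ^ 2 * L (EuclideanSpace.single 2 1) = 0 := by linarith
      exact (mul_eq_zero.1 this).resolve_left (by positivity)
    ext v
    have hv : v = !₂[v 0, v 1, v 2] := by
      ext i
      fin_cases i <;> simp
    rw [hv, hexp, l0, l1, l2]
    simp
  have hG0 : G (loopDiagram.proj (torusCover (crossing 0))) = 0 := by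
    rw [crossing_zero, hproj]
    exact hG.eventually_eq_zero.self_of_nhds
  have hcol : ∀ᶠ t in 𝓝[≠] (0 : ℝ), c (torusCover (crossing t)) =
      ε * signUnit (G (loopDiagram.proj (torusCover (crossing t)))) := by
    have hcont : Filter.Tendsto (fun t => torusCover (crossing t)) (𝓝 0)
        (𝓝 (torusCover lowerPoint)) := by
      rw [← crossing_zero]
      exact (continuous_torusCover.comp contDiff_crossing.continuous).continuousAt
    filter_upwards [eventually_crossing_notMem, nhdsWithin_le_nhds (hcont.eventually hev)] with t
      ht0 ht1
    simpa using ht1 (hnot _ ht0)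
  have hsign : ∀ᶠ t in 𝓝[>] (0 : ℝ),
      signUnit (G (loopDiagram.proj (torusCover (crossing t)))) =
        -signUnit (G (loopDiagram.proj (torusCover (crossing (-t))))) :=
    eventually_signUnit_eq_neg hcross hne hG0
  have hneg := tendsto_neg_nhdsGT_zero
  have hpos := nhdsGT_zero_le_nhdsNE
  obtain ⟨t, t1, t2, t3, t4, t5⟩ := (hsign.and ((eventually_crossing_notMem.filter_mono hpos).and
    ((hneg.eventually eventually_crossing_notMem).and ((hcol.filter_mono hpos).and
      (hneg.eventually hcol))))).exists
  have h6 := hconst _ t2 _ t3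
  rw [t4, t5, t1, mul_neg] at h6
  exact units_ne_neg_self _ h6.symm

theorem exists_meetAt_loopDiagram : ∃ si sj sk, loopDiagram.MeetAt si sj sk := by
  have hup : torusCover upperPoint ∈ loopDiagram.lowerSetᶜ := by
    rw [Set.mem_compl_iff, torusCover_mem_lowerSet_iff]
    rintro ⟨h, -⟩
    simp [upperPoint] at h
    linarith [Real.sqrt_nonneg 3]
  let s : loopDiagram.Sheets := ConnectedComponents.mk ⟨_, hup⟩
  have := SurfaceKnotDiagram.subsingleton_sheets isPreconnected_compl_lowerSet
  have hon : ∀ {q}, q ∈ loopDiagram.lowerSetᶜ → loopDiagram.OnSheet q s := fun hq =>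
    ⟨hq, Subsingleton.elim (α := loopDiagram.Sheets) _ _⟩
  refine ⟨s, s, s, torusCover lowerPoint, torusCover upperPoint, fun t => torusCover (crossing t),
    (under_lowerPoint_iff _).2 rfl, fun z hz => ?_, hon hup,
    contMDiff_torusCover.comp contDiff_crossing.contMDiff, congrArg torusCover crossing_zero, ?_, ?_⟩
  · rcases ringProj_eq_torusCover (H := loopHeight) hz with h | h
    · exact .inl h
    · exact .inr (by rw [h.1, flipPoint_lowerPoint])
  -- The determinant is 2 e (√3 / 2)³, positive because `crossing` runs in the direction of
  -- decreasing φ.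
  · have h1 : diffAt loopDiagram.proj (torusCover upperPoint) =
        fderiv ℝ (loopDiagram.proj ∘ torusCover) upperPoint :=
      mfderiv_torus (contMDiff_ringProj isRingHeight_loopHeight.smooth) upperPoint
    rw [h1, fderiv_loopDiagram_proj_longitude, fderiv_loopDiagram_proj_meridian,
      hasDerivAt_crossing.deriv, det3, Matrix.det_fin_three]
    have he := Real.exp_pos (1 / 2)
    have h3 : (0 : ℝ) < √3 / 2 := by positivity
    simp
    nlinarith [mul_pos (mul_pos he he) (pow_pos h3 3)]
  · have h : ∀ᶠ t : ℝ in 𝓝 0, |t| < 1 :=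
      (continuous_abs.continuousAt (x := (0 : ℝ))).eventually_lt_const (by simp)
    filter_upwards [self_mem_nhdsWithin, nhdsWithin_le_nhds h] with t ht0 ht1
    have ht : t ≠ 0 := ne_of_gt ht0
    exact ⟨hon (crossing_notMem_lowerSet (neg_ne_zero.2 ht) (by rwa [abs_neg])),
      hon (crossing_notMem_lowerSet ht ht1)⟩

end

theorem corollary6p2 :
    ∃ (S : Type) (_ : TopologicalSpace S) (_ : ChartedSpace R2 S) (_ : ClosedOrientedSurface S)
      (D₁ D₂ : SurfaceKnotDiagram S),
      Nonempty (S ≃ₜ Circle × Circle) ∧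
      D₁.BoundsSolidTorus ∧ D₂.BoundsSolidTorus ∧
      D₁.IsRegular ∧ D₂.IsRegular ∧
      D₁.Equivalent D₂ ∧ ¬ D₁.RegularEquivalent D₂ ∧
      ∀ (R : Type) [Rack R] [Finite R], IsConnectedRack R → ¬ IsQuandleRack R →
        Nat.card (D₁.Colorings R) = Nat.card R ∧ IsEmpty (D₂.Colorings R) := by
  refine ⟨Circle × Circle, inferInstance, inferInstance, inferInstance, emptyDiagram, loopDiagram,
    ⟨Homeomorph.refl _⟩, ringDiagram_boundsSolidTorus _, ringDiagram_boundsSolidTorus _,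
    ringDiagram_isRegular _ fun θ => (emptyHeight_pos le_rfl).ne',
    ringDiagram_isRegular _ fun θ => (loopHeight_zero_neg θ).ne, equivalent_empty_loop,
    fun h => not_hasCheckerboard_loopDiagram (h.hasCheckerboard_iff.1
      (SurfaceKnotDiagram.hasCheckerboard_of_forall_not_under not_under_emptyDiagram)),
    fun R _ _ hR hq => ⟨?_, ?_⟩⟩
  · have : ConnectedSpace (Circle × Circle) :=
      (inferInstance : ClosedOrientedSurface (Circle × Circle)).connected
    exact SurfaceKnotDiagram.card_colorings_of_forall_not_under not_under_emptyDiagram R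
  · have := SurfaceKnotDiagram.subsingleton_sheets isPreconnected_compl_lowerSet
    obtain ⟨si, sj, sk, h⟩ := exists_meetAt_loopDiagram
    exact SurfaceKnotDiagram.isEmpty_colorings h hR hq
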